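/- **Setting.** Let $\mathcal X\subset\mathbb R^q$ be compact, $\mathcal Z$ a measurable space with a probability measure $\mu$, $\Theta\subseteq\mathbb R^d$ open, $\gamma>0$. Let $T_\theta:\mathcal Z\to\mathcal X$ ($\theta\in\Theta$) be measurable maps such that $\theta\mapsto T_\theta(z)$ is $C^2$ for every $z$, with first and second derivatives $\nabla_\theta T_\theta(z)$, $\nabla^2_\theta T_\theta(z)$ bounded uniformly in $z$, locally in $\theta$; put $\alpha_\theta=T_{\theta\sharp}\mu$. Let $U\supseteq\mathcal X$ be open and let the cost $c$ be such that $c$, $\nabla_1c$, $\nabla_{11}c$ exist and are continuous on $U\times\mathcal X$, with $c(\cdot,y)\in C^2(U)$ for $y\in\mathcal X$. For probability measures $\alpha,\beta$ on $\mathcal X$ let $$\mathrm{OT}_\gamma(\alpha,\beta)=\min_{\pi\in\Pi(\alpha,\beta)}\int c\,d\pi+\gamma\,\mathrm{KL}(\pi\|\alpha\otimes\beta),\qquad \mathcal S(\alpha,\beta)=\mathrm{OT}_\gamma(\alpha,\beta)-\tfrac12\mathrm{OT}_\gamma(\alpha,\alpha)-\tfrac12\mathrm{OT}_\gamma(\beta,\beta),$$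 $$\mathcal A(f,\alpha)(y)=-\gamma\log\int e^{(f(x)-c(x,y))/\gamma}d\alpha(x),\qquad \mathcal H_1(f;\alpha,\beta)=\int f\,d\alpha+\int\mathcal A(f,\alpha)\,d\beta .$$ Let $\mathcal B(f)(x)=-\gamma\log\int e^{(g(y)-c(x,y))/\gamma}d\beta(y)$ with $g=\mathcal A(f,\alpha)$ (so $\mathcal B(f)=\mathcal A(\mathcal A(f,\alpha),\beta)$ if $c$ is symmetric). A *Sinkhorn potential* of $\mathrm{OT}_\gamma(\alpha,\beta)$ is an $f\in\mathcal C(\mathcal X)$ such that $f=\mathcal B(f)$ on $\mathcal X$ and $(f,\mathcal A(f,\alpha))$ maximizes $\int f\,d\alpha+\int g\,d\beta-\gamma\int(e^{(f\oplus g-c)/\gamma}-1)\,d\alpha\otimes\beta$ over $f,g\in\mathcal C(\mathcal X)$. Fix $x_0\in\mathcal X$. Write $\mathcal T_y(x,f)=e^{-c(x,y)/\gamma}e^{f(x)/\gamma}$. Derivatives in $f$ are Fréchet derivatives on $\mathcal C(\mathcal X)$ with the sup norm. **Claim.** (1) For all $\alpha,\beta$ there is exactly one Sinkhorn potential $f$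 with $f(x_0)=0$, and $\mathrm{OT}_\gamma(\alpha,\beta)=\mathcal H_1(f;\alpha,\beta)$ for every Sinkhorn potential $f$. (2) $f\mapsto\mathcal H_1(f;\alpha,\beta)$ is twice differentiable on $\mathcal C(\mathcal X)$, and $$D^2_{11}\mathcal H_1[g_1,g_2]=\int\Big(-\frac{\int\mathcal T_y(x,f)g_1(x)g_2(x)\,d\alpha(x)}{\gamma\int\mathcal T_y(x,f)\,d\alpha(x)}+\frac{\int\mathcal T_y(x,f)g_1(x)\,d\alpha(x)\int\mathcal T_y(x,f)g_2(x)\,d\alpha(x)}{\gamma\,[\int\mathcal T_y(x,f)\,d\alpha(x)]^2}\Big)d\beta(y).$$ (3) Fix $\beta$ and write $\mathcal H_1(f,\theta)=\mathcal H_1(f;\alpha_\theta,\beta)$. For every $f\in\mathcal C(\mathcal X)$ with a $C^2$ extension (again written $f$) to a neighbourhood of $\mathcal X$, $\mathcal H_1(f,\cdot)$ is twice differentiable on $\Theta$; with $T=T_\theta(z)$, $J=\nabla_\theta T_\theta(z)$, $u=\nabla_1c(T,y)-\nabla f(T)$ and $\langle\phi\rangle_y=\int\mathcal T_y(T,f)\,\phi\,d\mu(z)\big/\int\mathcal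 T_y(T,f)\,d\mu(z)$, $$D^2_{22}\mathcal H_1(f,\theta)=\int\big(\nabla^2_\theta T\times_1\nabla f(T)+J^\top\nabla^2f(T)J\big)d\mu-\frac1\gamma\int\langle J^\top uu^\top J\rangle_y\,d\beta(y)+\int\langle\nabla^2_\theta T\times_1u\rangle_y\,d\beta(y)$$ $$+\int\big\langle J^\top[\nabla_{11}c(T,y)-\nabla^2f(T)]J\big\rangle_y\,d\beta(y)+\frac1\gamma\int\langle J^\top u\rangle_y\langle J^\top u\rangle_y^\top\,d\beta(y).$$ (4) Let $f_\theta$ be a Sinkhorn potential of $\mathrm{OT}_\gamma(\alpha_\theta,\beta)$ for each $\theta\in\Theta$. Then $f_\theta$ has the $C^2$ extension $\mathcal B(f_\theta)$ (the formula above, evaluated near $\mathcal X$); if $f_\theta(x_0)=0$ for all $\theta$, then $\theta\mapsto f_\theta\in\mathcal C(\mathcal X)$ is Fréchet differentiable on $\Theta$; $\theta\mapsto\mathrm{OT}_\gamma(\alpha_\theta,\beta)$ is twice differentiable on $\Theta$; and at every $\theta\in\Theta$ where $\theta\mapsto f_\theta$ is differentiable, with derivative $Df_\theta$, $$\nabla^2_\theta\mathrm{OT}_\gamma(\alpha_\theta,\beta)=-D^2_{11}\mathcal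 H_1(f_\theta,\theta)\circ(Df_\theta,Df_\theta)+D^2_{22}\mathcal H_1(f_\theta,\theta).$$ (5) Assume moreover that $c$ is jointly $C^2$ on $U\times U$, and put $\tilde{\mathcal H}_1(f,\theta)=\mathcal H_1(f;\alpha_\theta,\alpha_\theta)$. For $f$ as in (3), $\tilde{\mathcal H}_1(f,\cdot)$ is twice differentiable on $\Theta$; with $\psi_{z,w}(\theta)=c(T_\theta(z),T_\theta(w))-f(T_\theta(z))$, whose gradient and Hessian in $\theta$ are given by the chain rule, and $\langle\phi\rangle_w=\int\mathcal T_{T_\theta(w)}(T_\theta(z),f)\,\phi\,d\mu(z)\big/\int\mathcal T_{T_\theta(w)}(T_\theta(z),f)\,d\mu(z)$, $$D^2_{22}\tilde{\mathcal H}_1(f,\theta)=\int\big(\nabla^2_\theta T\times_1\nabla f(T)+J^\top\nabla^2f(T)J\big)d\mu+\int\Big(-\frac1\gamma\langle\nabla\psi_{z,w}\nabla\psi_{z,w}^\top\rangle_w+\langle\nabla^2\psi_{z,w}\rangle_w+\frac1\gamma\langle\nabla\psi_{z,w}\rangle_w\langle\nabla\psi_{z,w}\rangle_w^\top\Big)d\mu(w).$$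 All assertions of (4) hold for $\mathrm{OT}_\gamma(\alpha_\theta,\alpha_\theta)$, its Sinkhorn potentials $k_\theta$ and $\tilde{\mathcal H}_1$ in place of $\mathrm{OT}_\gamma(\alpha_\theta,\beta)$, $f_\theta$ and $\mathcal H_1$. Consequently, for $\theta_1\in\Theta$, $\beta=\alpha_{\theta_1}$ and families $f_\theta$, $k_\theta$ of potentials on $\Theta$ that are differentiable at $\theta_1$, the Sinkhorn information matrix exists and is $$\nabla^2_\theta\mathcal S(\alpha_\theta,\alpha_{\theta_1})_{|\theta=\theta_1}=\Big[-D^2_{11}\mathcal H_1\circ(Df,Df)+D^2_{22}\mathcal H_1\Big](f_{\theta_1},\theta_1)-\frac12\Big[-D^2_{11}\tilde{\mathcal H}_1\circ(Dk,Dk)+D^2_{22}\tilde{\mathcal H}_1\Big](k_{\theta_1},\theta_1),$$ each term being given by the closed forms above. -/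

import Mathlib

open MeasureTheory Filter Topology

namespace SiNG

/-- Second Fréchet derivative `D²F(x)`, as a bilinear map. -/
noncomputable def D2 {V W : Type*} [NormedAddCommGroup V] [NormedSpace ℝ V]
    [NormedAddCommGroup W] [NormedSpace ℝ W] (F : V → W) (x : V) : V →L[ℝ] V →L[ℝ] W :=
  fderiv ℝ (fderiv ℝ F) x

/-- `F` is twice Fréchet differentiable at `x`: it is differentiable near `x` and its derivative
is differentiable at `x`. -/
def TwiceDifferentiableAt {V W : Type*} [NormedAddCommGroup V] [NormedSpace ℝ V]
    [NormedAddCommGroup W] [NormedSpace ℝ W] (F : V → W) (x : V) : Prop :=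
  (∀ᶠ y in 𝓝 x, DifferentiableAt ℝ F y) ∧ DifferentiableAt ℝ (fderiv ℝ F) x

section OptimalTransport

variable {q : ℕ} {X : Set (EuclideanSpace ℝ (Fin q))}

/-- Entropy-regularized optimal transport
`OT_γ(α, β) = min_{π ∈ Π(α, β)} ⟨c, π⟩ + γ KL(π ‖ α ⊗ β)` (plans of infinite `KL` play no role in
the minimum; `π = α ⊗ β` is always admissible). -/
noncomputable def OT (γ : ℝ) (c : EuclideanSpace ℝ (Fin q) → EuclideanSpace ℝ (Fin q) → ℝ)
    (α β : Measure X) : ℝ :=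
  sInf {r : ℝ | ∃ π : Measure (X × X), π.fst = α ∧ π.snd = β ∧
    InformationTheory.klDiv π (α.prod β) ≠ ⊤ ∧
    r = (∫ p, c p.1 p.2 ∂π) + γ * (InformationTheory.klDiv π (α.prod β)).toReal}

/-- Sinkhorn divergence. -/
noncomputable def sinkhornDiv (γ : ℝ)
    (c : EuclideanSpace ℝ (Fin q) → EuclideanSpace ℝ (Fin q) → ℝ) (α β : Measure X) : ℝ :=
  OT γ c α β - OT γ c α α / 2 - OT γ c β β / 2

/-- Two-variable dual functional
`H₂(f, g; α, β) = ⟨f, α⟩ + ⟨g, β⟩ - γ ⟨exp((f ⊕ g - c)/γ) - 1, α ⊗ β⟩`. -/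
noncomputable def H2 (γ : ℝ) (c : EuclideanSpace ℝ (Fin q) → EuclideanSpace ℝ (Fin q) → ℝ)
    (f g : X → ℝ) (α β : Measure X) : ℝ :=
  (∫ x, f x ∂α) + (∫ y, g y ∂β)
    - γ * ∫ p : X × X, (Real.exp ((f p.1 + g p.2 - c p.1 p.2) / γ) - 1) ∂(α.prod β)

/-- Sinkhorn mapping `A(f, α)(y) = -γ log ∫ exp(-c(x, y)/γ + f(x)/γ) dα(x)`. The right-hand side
makes sense for every `y` of the ambient space, not only for `y ∈ X`. -/
noncomputable def sinkhornMap (γ : ℝ)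
    (c : EuclideanSpace ℝ (Fin q) → EuclideanSpace ℝ (Fin q) → ℝ)
    (f : X → ℝ) (α : Measure X) (y : EuclideanSpace ℝ (Fin q)) : ℝ :=
  -γ * Real.log (∫ x : X, Real.exp (-c x y / γ + f x / γ) ∂α)

/-- `B(f) = A(A(f, α), β)`. The outer mapping integrates the second argument of the cost; for a
symmetric cost it is the same mapping `A`. -/
noncomputable def sinkhornB (γ : ℝ)
    (c : EuclideanSpace ℝ (Fin q) → EuclideanSpace ℝ (Fin q) → ℝ)
    (f : X → ℝ) (α β : Measure X) : EuclideanSpace ℝ (Fin q) → ℝ :=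
  sinkhornMap γ (fun y x => c x y) (fun y : X => sinkhornMap γ c f α y) β

/-- One-variable dual functional `H₁(f; α, β) = ⟨f, α⟩ + ⟨A(f, α), β⟩`. -/
noncomputable def H1 (γ : ℝ) (c : EuclideanSpace ℝ (Fin q) → EuclideanSpace ℝ (Fin q) → ℝ)
    (f : X → ℝ) (α β : Measure X) : ℝ :=
  (∫ x, f x ∂α) + ∫ y : X, sinkhornMap γ c f α y ∂β

/-- `f ∈ C(X)` is a Sinkhorn potential of `OT_γ(α, β)`: together with `g = A(f, α)` it maximizes
the dual functional over `C(X) × C(X)`, and it is a fixed point of `B` on the whole of `X` (which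
fixes its values off the support of `α`). -/
def IsSinkhornPotential (γ : ℝ)
    (c : EuclideanSpace ℝ (Fin q) → EuclideanSpace ℝ (Fin q) → ℝ)
    (f : C(X, ℝ)) (α β : Measure X) : Prop :=
  (∀ f' g' : C(X, ℝ), H2 γ c f' g' α β ≤ H2 γ c f (fun y : X => sinkhornMap γ c f α y) α β) ∧
  ∀ x : X, sinkhornB γ c f α β x = f x

/-- The kernel `𝒯_y(x, f) = exp(-c(x, y)/γ) exp(f(x)/γ)`. -/
noncomputable def kernelT (γ : ℝ)
    (c : EuclideanSpace ℝ (Fin q) → EuclideanSpace ℝ (Fin q) → ℝ)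
    (f : EuclideanSpace ℝ (Fin q) → ℝ) (y x : EuclideanSpace ℝ (Fin q)) : ℝ :=
  Real.exp (-c x y / γ) * Real.exp (f x / γ)

/-- Closed form of `D²H₁(f; α, β)[g₁, g₂]`, the derivatives being taken in `f`. -/
noncomputable def closedD11 (γ : ℝ)
    (c : EuclideanSpace ℝ (Fin q) → EuclideanSpace ℝ (Fin q) → ℝ)
    (α β : Measure X) (f g₁ g₂ : X → ℝ) : ℝ :=
  let t : X → X → ℝ := fun y x => Real.exp (-c x y / γ) * Real.exp (f x / γ)
  ∫ y, (-((∫ x, t y x * g₁ x * g₂ x ∂α) / (γ * ∫ x, t y x ∂α))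
      + ((∫ x, t y x * g₁ x ∂α) * (∫ x, t y x * g₂ x ∂α)) / (γ * (∫ x, t y x ∂α) ^ 2)) ∂β

/-- Regularity of the cost in its first argument: `c`, `∇₁c` and `∇²₁₁c` exist and are continuous
on `U × X`. -/
def IsC2Cost (X U : Set (EuclideanSpace ℝ (Fin q)))
    (c : EuclideanSpace ℝ (Fin q) → EuclideanSpace ℝ (Fin q) → ℝ) : Prop :=
  ContinuousOn (fun p : EuclideanSpace ℝ (Fin q) × EuclideanSpace ℝ (Fin q) => c p.1 p.2)
    (U ×ˢ X) ∧
  (∀ y ∈ X, ContDiffOn ℝ 2 (fun x => c x y) U) ∧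
  ContinuousOn (fun p : EuclideanSpace ℝ (Fin q) × EuclideanSpace ℝ (Fin q) =>
    fderiv ℝ (fun x => c x p.2) p.1) (U ×ˢ X) ∧
  ContinuousOn (fun p : EuclideanSpace ℝ (Fin q) × EuclideanSpace ℝ (Fin q) =>
    D2 (fun x => c x p.2) p.1) (U ×ˢ X)

/-- `F` extends `f ∈ C(X)` to a function that is `C²` on an open neighbourhood of `X`. -/
def IsC2Extension (f : C(X, ℝ)) (F : EuclideanSpace ℝ (Fin q) → ℝ) : Prop :=
  (∀ x : X, F x = f x) ∧
  ∃ V : Set (EuclideanSpace ℝ (Fin q)), IsOpen V ∧ X ⊆ V ∧ ContDiffOn ℝ 2 F V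

end OptimalTransport

section PushForward

variable {q d : ℕ} {X : Set (EuclideanSpace ℝ (Fin q))} {Z : Type*} [MeasurableSpace Z]

/-- The push-forward measure `α_θ = (T_θ)_♯ μ`. -/
noncomputable def pushα (T : EuclideanSpace ℝ (Fin d) → Z → X) (μ : Measure Z)
    (θ : EuclideanSpace ℝ (Fin d)) : Measure X :=
  μ.map (T θ)

/-- First Jacobian `∇_θ T_θ(z)`. -/
noncomputable def jac (T : EuclideanSpace ℝ (Fin d) → Z → X) (θ : EuclideanSpace ℝ (Fin d))
    (z : Z) : EuclideanSpace ℝ (Fin d) →L[ℝ] EuclideanSpace ℝ (Fin q) :=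
  fderiv ℝ (fun θ' => (T θ' z : EuclideanSpace ℝ (Fin q))) θ

/-- Second Jacobian `∇²_θ T_θ(z)`. -/
noncomputable def jac2 (T : EuclideanSpace ℝ (Fin d) → Z → X) (θ : EuclideanSpace ℝ (Fin d))
    (z : Z) : EuclideanSpace ℝ (Fin d) →L[ℝ] EuclideanSpace ℝ (Fin d) →L[ℝ]
      EuclideanSpace ℝ (Fin q) :=
  D2 (fun θ' => (T θ' z : EuclideanSpace ℝ (Fin q))) θ

/-- Regularity of the parametrized map on the open parameter set `Θ`: `T_θ` is measurable,
`θ ↦ T_θ(z)` is `C²`, and its first two derivatives are bounded uniformly in `z`, locally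
in `θ`. -/
def IsC2Param (Θ : Set (EuclideanSpace ℝ (Fin d))) (T : EuclideanSpace ℝ (Fin d) → Z → X) :
    Prop :=
  (∀ θ ∈ Θ, Measurable (T θ)) ∧
  (∀ z, ContDiffOn ℝ 2 (fun θ => (T θ z : EuclideanSpace ℝ (Fin q))) Θ) ∧
  ∀ θ₀ ∈ Θ, ∃ G : ℝ, ∀ᶠ θ in 𝓝 θ₀, ∀ z, ‖jac T θ z‖ ≤ G ∧ ‖jac2 T θ z‖ ≤ G

/-- Closed form of `D²₂₂H₁(f, θ)[h₁, h₂]` for `H₁(f, θ) = ⟨f, α_θ⟩ + ⟨A(f, α_θ), β⟩` with `β`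
fixed, where `f` is (a `C²` extension of) the function in `C(X)`. -/
noncomputable def closedD22 (γ : ℝ)
    (c : EuclideanSpace ℝ (Fin q) → EuclideanSpace ℝ (Fin q) → ℝ)
    (T : EuclideanSpace ℝ (Fin d) → Z → X) (μ : Measure Z) (β : Measure X)
    (f : EuclideanSpace ℝ (Fin q) → ℝ) (θ h₁ h₂ : EuclideanSpace ℝ (Fin d)) : ℝ :=
  let t : X → Z → ℝ := fun y z => kernelT γ c f y (T θ z)
  let u : X → Z → (EuclideanSpace ℝ (Fin q) →L[ℝ] ℝ) := fun y z =>
    fderiv ℝ (fun x => c x y) (T θ z) - fderiv ℝ f (T θ z)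
  (∫ z, (fderiv ℝ f (T θ z) (jac2 T θ z h₁ h₂)
      + D2 f (T θ z) (jac T θ z h₁) (jac T θ z h₂)) ∂μ)
  - (1 / γ) * (∫ y, (∫ z, t y z * (u y z (jac T θ z h₁) * u y z (jac T θ z h₂)) ∂μ)
      / (∫ z, t y z ∂μ) ∂β)
  + (∫ y, (∫ z, t y z * u y z (jac2 T θ z h₁ h₂) ∂μ) / (∫ z, t y z ∂μ) ∂β)
  + (∫ y, (∫ z, t y z * (D2 (fun x => c x y) (T θ z) (jac T θ z h₁) (jac T θ z h₂)
      - D2 f (T θ z) (jac T θ z h₁) (jac T θ z h₂)) ∂μ) / (∫ z, t y z ∂μ) ∂β)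
  + (1 / γ) * (∫ y, ((∫ z, t y z * u y z (jac T θ z h₁) ∂μ)
      * (∫ z, t y z * u y z (jac T θ z h₂) ∂μ)) / (∫ z, t y z ∂μ) ^ 2 ∂β)

/-- Closed form of `D²₂₂H̃₁(f, θ)[h₁, h₂]` for `H̃₁(f, θ) = ⟨f, α_θ⟩ + ⟨A(f, α_θ), α_θ⟩`, where
both measures move with `θ`. Here `m` and `s` are the first and second `θ`-derivatives of
`c(T_θ(z), T_θ(w)) - f(T_θ(z))`. -/
noncomputable def closedD22Self (γ : ℝ)
    (c : EuclideanSpace ℝ (Fin q) → EuclideanSpace ℝ (Fin q) → ℝ)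
    (T : EuclideanSpace ℝ (Fin d) → Z → X) (μ : Measure Z)
    (f : EuclideanSpace ℝ (Fin q) → ℝ) (θ h₁ h₂ : EuclideanSpace ℝ (Fin d)) : ℝ :=
  let C : EuclideanSpace ℝ (Fin q) × EuclideanSpace ℝ (Fin q) → ℝ := fun p => c p.1 p.2
  let P : Z → Z → EuclideanSpace ℝ (Fin q) × EuclideanSpace ℝ (Fin q) := fun w z =>
    (↑(T θ z), ↑(T θ w))
  let t : Z → Z → ℝ := fun w z => kernelT γ c f (T θ w) (T θ z)
  let m : Z → Z → EuclideanSpace ℝ (Fin d) → ℝ := fun w z h =>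
    fderiv ℝ C (P w z) (jac T θ z h, jac T θ w h) - fderiv ℝ f (T θ z) (jac T θ z h)
  let s : Z → Z → ℝ := fun w z =>
    D2 C (P w z) (jac T θ z h₁, jac T θ w h₁) (jac T θ z h₂, jac T θ w h₂)
    + fderiv ℝ C (P w z) (jac2 T θ z h₁ h₂, jac2 T θ w h₁ h₂)
    - D2 f (T θ z) (jac T θ z h₁) (jac T θ z h₂)
    - fderiv ℝ f (T θ z) (jac2 T θ z h₁ h₂)
  (∫ z, (fderiv ℝ f (T θ z) (jac2 T θ z h₁ h₂)
      + D2 f (T θ z) (jac T θ z h₁) (jac T θ z h₂)) ∂μ)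
  - (1 / γ) * (∫ w, (∫ z, t w z * (m w z h₁ * m w z h₂) ∂μ) / (∫ z, t w z ∂μ) ∂μ)
  + (∫ w, (∫ z, t w z * s w z ∂μ) / (∫ z, t w z ∂μ) ∂μ)
  + (1 / γ) * (∫ w, ((∫ z, t w z * m w z h₁ ∂μ) * (∫ z, t w z * m w z h₂ ∂μ))
      / (∫ z, t w z ∂μ) ^ 2 ∂μ)

end PushForward

end SiNG

/-! Everything is pulled back to fixed probability spaces. If the marginals are the images of `μ`
and `ν` under `T θ` and `R θ`, put `C θ (i, j) = c (T θ i) (R θ j)`, `φ θ = f θ ∘ T θ` and `ψ θ =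
A(f θ, α_θ) ∘ R θ`. Then `φ = softmin_ν (C - ψ)` and `ψ = softmin_μ (C - φ)`, a Schrödinger system
in which only the cost moves, with two locally bounded derivatives. The choices `R = id` and `R = T`
treat `OT(α_θ, β)` and `OT(α_θ, α_θ)` at the same time.

Differentiability of the potentials uses no implicit function theorem. When `|C| ≤ B`, the soft
minimum contracts oscillations by the factor `1 - exp(-4B/γ)` (`abs_softmin_increment_sub_le`).
Hence potentials normalized at one point are Lipschitz in the sup norm of the cost
(`Schrodinger.abs_sub_le`). The second difference of four nearby potentials solves the linearized
system up to an error of second order, and the same contraction makes it of second order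
(`Schrodinger.abs_second_difference_le`). A Lipschitz map whose second differences are quadratically
small is differentiable, its derivative being a dyadic limit (`exists_hasFDerivAt_of_additive`). All
bounds are uniform in the point, so they also give differentiability in `C(X)`, once `Z` is enlarged
by a null copy of `X` on which the map is the identity (`augment`).

The value `∫ φ + ∫ ψ` equals `OT`, by nonnegativity of the relative entropy with respect to the plan
of density `P = exp(-(C - φ - ψ)/γ)` (`Schrodinger.isLeast`). The unit marginals of `P` give the
envelope formula: the first derivative of the value is `∫ P C'`. A second derivative therefore needs
only first derivatives of the potentials. With `e = C' - φ' - ψ'`, differentiating the marginal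
constraints shows that `e` has zero mean conditionally on either coordinate, and the Hessian is `∫ P
C'' - (1/γ) ∫ P e ⊗ e` (`Schrodinger.hasFDerivAt_value`).

The semi-dual functional at a frozen potential `N` has the usual Hessian of a log-partition
function: the mean of the second derivative minus a Gibbs covariance of `C' - N'`. For fixed `j`,
`C' - N'` is `e + ζ` plus a constant, where `ζ` is the derivative of the potential in `C(X)` read at
the moving point. The cross terms between `e` and `ζ` integrate to zero, and what remains is exactly
`-D₁₁[Df, Df] + D₂₂` (`Schrodinger.hessian_identity`). No mixed derivative of the semi-dual is ever
computed. -/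

set_option maxSynthPendingDepth 3

namespace SiNG

/-! ### Calculus of uniformly bounded differentiable families. -/

section Families

variable {E Y F G H : Type*} [NormedAddCommGroup E] [NormedSpace ℝ E]
  [NormedAddCommGroup F] [NormedSpace ℝ F] [NormedAddCommGroup G] [NormedSpace ℝ G]
  [NormedAddCommGroup H] [NormedSpace ℝ H] [MeasurableSpace Y]

/-- A family `Ψ θ y`, measurable in `y` and differentiable in `θ ∈ Θ` with derivative `Ψ'`, such
that `Ψ` and `Ψ'` are bounded uniformly in `y`, locally in `θ`. -/
structure DiffFamily (Θ : Set E) (Ψ : E → Y → F) (Ψ' : E → Y → E →L[ℝ] F) : Prop where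
  isOpen : IsOpen Θ
  meas : ∀ θ ∈ Θ, StronglyMeasurable (Ψ θ)
  deriv : ∀ θ ∈ Θ, ∀ y, HasFDerivAt (fun θ' => Ψ θ' y) (Ψ' θ y) θ
  bdd : ∀ θ₀ ∈ Θ, ∃ K : ℝ, ∀ᶠ θ in 𝓝 θ₀, ∀ y, ‖Ψ θ y‖ ≤ K ∧ ‖Ψ' θ y‖ ≤ K

/-- Expansion in a finite basis writes `g` as a finite sum of fixed continuous linear images of the
functions `g · (b i)`. -/
theorem stronglyMeasurable_clm [FiniteDimensional ℝ E] {g : Y → E →L[ℝ] F}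
    (hg : ∀ v, StronglyMeasurable fun y => g y v) : StronglyMeasurable g := by
  let b := Module.finBasis ℝ E
  have h : g = fun y => ∑ i, ContinuousLinearMap.smulRightL ℝ E F
      (LinearMap.toContinuousLinearMap (b.coord i)) (g y (b i)) := by
    funext y
    ext v
    conv_lhs => rw [← b.sum_repr v, map_sum]
    simp
  rw [h]
  exact Finset.stronglyMeasurable_fun_sum _ fun i _ =>
    (ContinuousLinearMap.smulRightL ℝ E F _).continuous.comp_stronglyMeasurable (hg _)

namespace DiffFamily

variable {Θ : Set E} {Ψ : E → Y → F} {Ψ' : E → Y → E →L[ℝ] F}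

/-- The derivative is a pointwise limit of measurable difference quotients, which is why
`DiffFamily` does not ask for its measurability. -/
theorem meas_deriv [FiniteDimensional ℝ E] (h : DiffFamily Θ Ψ Ψ') {θ : E} (hθ : θ ∈ Θ) :
    StronglyMeasurable (Ψ' θ) := by
  classical
  refine stronglyMeasurable_clm fun v => ?_
  refine stronglyMeasurable_of_tendsto (u := (atTop : Filter ℝ))
    -- Measurability is known only for parameters in `Θ`; the value `0` is used for the small `t`
    -- that leave it and does not affect the limit.
    (f := fun t y => if θ + t⁻¹ • v ∈ Θ then t • (Ψ (θ + t⁻¹ • v) y - Ψ θ y) else 0) ?_ ?_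
  · intro t
    by_cases ht : θ + t⁻¹ • v ∈ Θ
    · simp only [ht, if_true]
      exact ((h.meas _ ht).sub (h.meas _ hθ)).const_smul t
    · simp only [ht, if_false]
      exact stronglyMeasurable_const
  · rw [tendsto_pi_nhds]
    intro y
    refine ((h.deriv θ hθ y).lim_real v).congr' ?_
    have h1 : Tendsto (fun t : ℝ => θ + t⁻¹ • v) atTop (𝓝 θ) := by
      have : Tendsto (fun t : ℝ => θ + t⁻¹ • v) atTop (𝓝 (θ + (0 : ℝ) • v)) :=
        tendsto_const_nhds.add (tendsto_inv_atTop_zero.smul_const v)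
      simpa using this
    filter_upwards [h1.eventually (h.isOpen.mem_nhds hθ)] with t ht
    have ht' : θ + t⁻¹ • v ∈ Θ := ht
    simp [ht']

theorem exists_bound (h : DiffFamily Θ Ψ Ψ') {θ : E} (hθ : θ ∈ Θ) :
    ∃ K, ∀ y, ‖Ψ θ y‖ ≤ K ∧ ‖Ψ' θ y‖ ≤ K := by
  obtain ⟨K, hK⟩ := h.bdd θ hθ
  exact ⟨K, hK.self_of_nhds⟩

theorem integrable (h : DiffFamily Θ Ψ Ψ') {θ : E} (hθ : θ ∈ Θ) (ρ : Measure Y)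
    [IsFiniteMeasure ρ] : Integrable (Ψ θ) ρ := by
  obtain ⟨K, hK⟩ := h.exists_bound hθ
  exact Integrable.of_bound (h.meas θ hθ).aestronglyMeasurable K (ae_of_all _ fun y => (hK y).1)

theorem integrable_deriv [FiniteDimensional ℝ E] (h : DiffFamily Θ Ψ Ψ') {θ : E} (hθ : θ ∈ Θ)
    (ρ : Measure Y) [IsFiniteMeasure ρ] : Integrable (Ψ' θ) ρ := by
  obtain ⟨K, hK⟩ := h.exists_bound hθ
  exact Integrable.of_bound (h.meas_deriv hθ).aestronglyMeasurable K
    (ae_of_all _ fun y => (hK y).2)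

theorem hasFDerivAt_integral [FiniteDimensional ℝ E] (h : DiffFamily Θ Ψ Ψ') {θ : E} (hθ : θ ∈ Θ)
    (ρ : Measure Y) [IsFiniteMeasure ρ] :
    HasFDerivAt (fun θ' => ∫ y, Ψ θ' y ∂ρ) (∫ y, Ψ' θ y ∂ρ) θ := by
  obtain ⟨K, hK⟩ := h.bdd θ hθ
  have hs : {θ' | θ' ∈ Θ ∧ ∀ y, ‖Ψ θ' y‖ ≤ K ∧ ‖Ψ' θ' y‖ ≤ K} ∈ 𝓝 θ :=
    Filter.inter_mem (h.isOpen.mem_nhds hθ) hK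
  obtain ⟨ε, hε, hball⟩ := Metric.mem_nhds_iff.1 hs
  refine hasFDerivAt_integral_of_dominated_of_fderiv_le (bound := fun _ => K)
    (Metric.ball_mem_nhds θ hε) ?_ (h.integrable hθ ρ) (h.meas_deriv hθ).aestronglyMeasurable ?_
    (integrable_const _) ?_
  · filter_upwards [h.isOpen.mem_nhds hθ] with θ' hθ'
    exact (h.meas θ' hθ').aestronglyMeasurable
  · exact ae_of_all _ fun y θ' hθ' => ((hball hθ').2 y).2
  · exact ae_of_all _ fun y θ' hθ' => h.deriv θ' (hball hθ').1 y

theorem of_eventually {Ψ₁ : E → Y → F} {Ψ₁' : E → Y → E →L[ℝ] F} (h : DiffFamily Θ Ψ Ψ')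
    (h₁ : ∀ θ ∈ Θ, Ψ θ = Ψ₁ θ) (h₂ : ∀ θ ∈ Θ, Ψ' θ = Ψ₁' θ) : DiffFamily Θ Ψ₁ Ψ₁' where
  isOpen := h.isOpen
  meas θ hθ := h₁ θ hθ ▸ h.meas θ hθ
  deriv θ hθ y := by
    rw [← h₂ θ hθ]
    refine (h.deriv θ hθ y).congr_of_eventuallyEq ?_
    filter_upwards [h.isOpen.mem_nhds hθ] with θ' hθ'
    rw [h₁ θ' hθ']
  bdd θ hθ := by
    obtain ⟨K, hK⟩ := h.bdd θ hθ
    refine ⟨K, ?_⟩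
    filter_upwards [hK, h.isOpen.mem_nhds hθ] with θ' h' hθ'
    rw [← h₁ θ' hθ', ← h₂ θ' hθ']
    exact h'

theorem comp_measurable {Y' : Type*} [MeasurableSpace Y'] (h : DiffFamily Θ Ψ Ψ') {g : Y' → Y}
    (hg : Measurable g) : DiffFamily Θ (fun θ y => Ψ θ (g y)) (fun θ y => Ψ' θ (g y)) where
  isOpen := h.isOpen
  meas θ hθ := (h.meas θ hθ).comp_measurable hg
  deriv θ hθ y := h.deriv θ hθ (g y)
  bdd θ hθ := by
    obtain ⟨K, hK⟩ := h.bdd θ hθ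
    exact ⟨K, hK.mono fun θ' h' y => h' (g y)⟩

theorem clm (h : DiffFamily Θ Ψ Ψ') (B : F →L[ℝ] G) :
    DiffFamily Θ (fun θ y => B (Ψ θ y)) (fun θ y => B.comp (Ψ' θ y)) where
  isOpen := h.isOpen
  meas θ hθ := B.continuous.comp_stronglyMeasurable (h.meas θ hθ)
  deriv θ hθ y := B.hasFDerivAt.comp θ (h.deriv θ hθ y)
  bdd θ hθ := by
    obtain ⟨K, hK⟩ := h.bdd θ hθ
    refine ⟨‖B‖ * K, hK.mono fun θ' h' y => ⟨?_, ?_⟩⟩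
    · exact (B.le_opNorm _).trans (by gcongr; exact (h' y).1)
    · exact (B.opNorm_comp_le _).trans (by gcongr; exact (h' y).2)

theorem add {Φ : E → Y → F} {Φ' : E → Y → E →L[ℝ] F} (h : DiffFamily Θ Ψ Ψ')
    (k : DiffFamily Θ Φ Φ') :
    DiffFamily Θ (fun θ y => Ψ θ y + Φ θ y) (fun θ y => Ψ' θ y + Φ' θ y) where
  isOpen := h.isOpen
  meas θ hθ := (h.meas θ hθ).add (k.meas θ hθ)
  deriv θ hθ y := (h.deriv θ hθ y).add (k.deriv θ hθ y)
  bdd θ hθ := by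
    obtain ⟨K, hK⟩ := h.bdd θ hθ
    obtain ⟨K', hK'⟩ := k.bdd θ hθ
    refine ⟨K + K', (hK.and hK').mono fun θ' h' y => ⟨?_, ?_⟩⟩
    · exact (norm_add_le _ _).trans (add_le_add (h'.1 y).1 (h'.2 y).1)
    · exact (norm_add_le _ _).trans (add_le_add (h'.1 y).2 (h'.2 y).2)

theorem const_smul (h : DiffFamily Θ Ψ Ψ') (a : ℝ) :
    DiffFamily Θ (fun θ y => a • Ψ θ y) (fun θ y => a • Ψ' θ y) := by
  have := h.clm (a • ContinuousLinearMap.id ℝ F)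
  refine this.of_eventually (fun θ _ => rfl) (fun θ _ => ?_)
  funext y
  ext v
  simp

theorem sub {Φ : E → Y → F} {Φ' : E → Y → E →L[ℝ] F} (h : DiffFamily Θ Ψ Ψ')
    (k : DiffFamily Θ Φ Φ') :
    DiffFamily Θ (fun θ y => Ψ θ y - Φ θ y) (fun θ y => Ψ' θ y - Φ' θ y) := by
  refine (h.add (k.const_smul (-1))).of_eventually (fun θ _ => ?_) (fun θ _ => ?_) <;>
  · funext y
    simp [sub_eq_add_neg]

theorem bilinear {Φ : E → Y → G} {Φ' : E → Y → E →L[ℝ] G} (B : F →L[ℝ] G →L[ℝ] H)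
    (h : DiffFamily Θ Ψ Ψ') (k : DiffFamily Θ Φ Φ') :
    DiffFamily Θ (fun θ y => B (Ψ θ y) (Φ θ y))
      (fun θ y => B.precompR E (Ψ θ y) (Φ' θ y) + B.precompL E (Ψ' θ y) (Φ θ y)) where
  isOpen := h.isOpen
  meas θ hθ := by
    have := (h.meas θ hθ).prodMk (k.meas θ hθ)
    exact B.continuous₂.comp_stronglyMeasurable this
  deriv θ hθ y := B.hasFDerivAt_of_bilinear (h.deriv θ hθ y) (k.deriv θ hθ y)
  bdd θ hθ := by
    obtain ⟨K, hK⟩ := h.bdd θ hθ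
    obtain ⟨K', hK'⟩ := k.bdd θ hθ
    refine ⟨‖B‖ * K * K' + ‖B.precompR E‖ * K * K' + ‖B.precompL E‖ * K * K',
      (hK.and hK').mono fun θ' h' y => ?_⟩
    obtain ⟨a, b⟩ := h'.1 y
    obtain ⟨a', b'⟩ := h'.2 y
    have hK0 : 0 ≤ K := (norm_nonneg _).trans a
    have hK0' : 0 ≤ K' := (norm_nonneg _).trans a'
    have h1 : ‖B (Ψ θ' y) (Φ θ' y)‖ ≤ ‖B‖ * K * K' :=
      (B.le_opNorm₂ _ _).trans (by gcongr)
    have h2 : ‖B.precompR E (Ψ θ' y) (Φ' θ' y)‖ ≤ ‖B.precompR E‖ * K * K' :=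
      ((B.precompR E).le_opNorm₂ _ _).trans (by gcongr)
    have h3 : ‖B.precompL E (Ψ' θ' y) (Φ θ' y)‖ ≤ ‖B.precompL E‖ * K * K' :=
      ((B.precompL E).le_opNorm₂ _ _).trans (by gcongr)
    have h4 := (norm_nonneg _).trans h1
    have h5 := (norm_nonneg _).trans h2
    have h6 := (norm_nonneg _).trans h3
    exact ⟨by linarith, (norm_add_le _ _).trans (by linarith)⟩

theorem smul {Φ : E → Y → ℝ} {Φ' : E → Y → E →L[ℝ] ℝ} (k : DiffFamily Θ Φ Φ')
    (h : DiffFamily Θ Ψ Ψ') :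
    DiffFamily Θ (fun θ y => Φ θ y • Ψ θ y)
      (fun θ y => Φ θ y • Ψ' θ y + (Φ' θ y).smulRight (Ψ θ y)) := by
  refine (k.bilinear (ContinuousLinearMap.lsmul ℝ ℝ) h).of_eventually (fun θ _ => ?_)
    (fun θ _ => ?_)
  · funext y
    simp
  · funext y
    ext v
    simp

/-- The compact set `K` keeps the values away from the boundary of the domain `O`. It serves for the
logarithm and the inverse, which are unbounded near `0`. -/
theorem scalar_comp {Ψ : E → Y → ℝ} {Ψ' : E → Y → E →L[ℝ] ℝ} (h : DiffFamily Θ Ψ Ψ')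
    {s s' : ℝ → ℝ} (hm : Measurable s) {O : Set ℝ} (hs : ∀ t ∈ O, HasDerivAt s (s' t) t)
    (hs' : ContinuousOn s' O)
    (hK : ∀ θ₀ ∈ Θ, ∃ K, IsCompact K ∧ K ⊆ O ∧ ∀ᶠ θ in 𝓝 θ₀, ∀ y, Ψ θ y ∈ K) :
    DiffFamily Θ (fun θ y => s (Ψ θ y)) (fun θ y => s' (Ψ θ y) • Ψ' θ y) where
  isOpen := h.isOpen
  meas θ hθ := (hm.comp (h.meas θ hθ).measurable).stronglyMeasurable
  deriv θ hθ y := by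
    obtain ⟨K, -, hKO, hK⟩ := hK θ hθ
    exact (hs _ (hKO (hK.self_of_nhds y))).comp_hasFDerivAt θ (h.deriv θ hθ y)
  bdd θ hθ := by
    obtain ⟨K, hKc, hKO, hK⟩ := hK θ hθ
    obtain ⟨K', hK'⟩ := h.bdd θ hθ
    have hc : ContinuousOn s K := fun t ht => (hs t (hKO ht)).continuousAt.continuousWithinAt
    obtain ⟨a, ha⟩ := hKc.exists_bound_of_continuousOn hc
    obtain ⟨b, hb⟩ := hKc.exists_bound_of_continuousOn (hs'.mono hKO)
    refine ⟨max a (b * K'), (hK.and hK').mono fun θ' h' y => ⟨?_, ?_⟩⟩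
    · exact (ha _ (h'.1 y)).trans (le_max_left _ _)
    · rw [norm_smul]
      refine le_trans ?_ (le_max_right _ _)
      have := hb _ (h'.1 y)
      have h0 : 0 ≤ b := (norm_nonneg _).trans this
      exact mul_le_mul this (h'.2 y).2 (norm_nonneg _) h0

theorem exp_comp {Ψ : E → Y → ℝ} {Ψ' : E → Y → E →L[ℝ] ℝ} (h : DiffFamily Θ Ψ Ψ') :
    DiffFamily Θ (fun θ y => Real.exp (Ψ θ y)) (fun θ y => Real.exp (Ψ θ y) • Ψ' θ y) := by
  refine h.scalar_comp Real.measurable_exp (O := Set.univ) (fun t _ => Real.hasDerivAt_exp t)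
    Real.continuous_exp.continuousOn fun θ hθ => ?_
  obtain ⟨K, hK⟩ := h.bdd θ hθ
  refine ⟨Set.Icc (-K) K, isCompact_Icc, Set.subset_univ _, hK.mono fun θ' h' y => ?_⟩
  exact abs_le.1 (h' y).1

/-- The uniform bounds survive unchanged because `ρ` has mass one. The remaining coordinate `b`
keeps track of uniformity in the second marginal. -/
theorem integral_left {A B : Type*} [MeasurableSpace A] [MeasurableSpace B]
    [FiniteDimensional ℝ E] {Ψ : E → A × B → F} {Ψ' : E → A × B → E →L[ℝ] F}
    (h : DiffFamily Θ Ψ Ψ') (ρ : Measure A) [IsProbabilityMeasure ρ] :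
    DiffFamily Θ (fun θ b => ∫ a, Ψ θ (a, b) ∂ρ) (fun θ b => ∫ a, Ψ' θ (a, b) ∂ρ) where
  isOpen := h.isOpen
  meas θ hθ := (h.meas θ hθ).integral_prod_left'
  deriv θ hθ b := (h.comp_measurable (measurable_prodMk_right (y := b))).hasFDerivAt_integral hθ ρ
  bdd θ hθ := by
    obtain ⟨K, hK⟩ := h.bdd θ hθ
    refine ⟨K, hK.mono fun θ' h' b => ⟨?_, ?_⟩⟩
    · simpa using norm_integral_le_of_norm_le_const (μ := ρ)
        (ae_of_all _ fun a => (h' (a, b)).1)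
    · simpa using norm_integral_le_of_norm_le_const (μ := ρ)
        (ae_of_all _ fun a => (h' (a, b)).2)

end DiffFamily

end Families

end SiNG

namespace SiNG

/-- The soft minimum `-γ log ∫ exp(-a/γ) dρ`. -/
noncomputable def softmin {A : Type*} [MeasurableSpace A] (γ : ℝ) (ρ : Measure A) (a : A → ℝ) :
    ℝ :=
  -γ * Real.log (∫ x, Real.exp (-a x / γ) ∂ρ)

/-- The mean of `φ` for the Gibbs measure of density proportional to `exp(-a/γ)`. -/
noncomputable def gibbsMean {A : Type*} [MeasurableSpace A] (γ : ℝ) (ρ : Measure A) (a φ : A → ℝ) :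
    ℝ :=
  (∫ x, Real.exp (-a x / γ) * φ x ∂ρ) / ∫ x, Real.exp (-a x / γ) ∂ρ

theorem integrable_of_bounded {A F : Type*} [MeasurableSpace A] [NormedAddCommGroup F]
    {ρ : Measure A} [IsFiniteMeasure ρ] {f : A → F} (hf : StronglyMeasurable f) {K : ℝ}
    (hK : ∀ x, ‖f x‖ ≤ K) : Integrable f ρ :=
  Integrable.of_bound hf.aestronglyMeasurable K (ae_of_all _ hK)

/-! ### Soft minima of differentiable families, and the chain rule. -/

section SoftminFamilies

variable {E A B : Type*} [NormedAddCommGroup E] [NormedSpace ℝ E] [FiniteDimensional ℝ E]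
  [MeasurableSpace A] [MeasurableSpace B]

namespace DiffFamily

variable {Y : Type*} [MeasurableSpace Y] {Θ : Set E}

omit [FiniteDimensional ℝ E] in
theorem gibbs {Ψ : E → Y → ℝ} {Ψ' : E → Y → E →L[ℝ] ℝ} (h : DiffFamily Θ Ψ Ψ') (γ : ℝ) :
    DiffFamily Θ (fun θ y => Real.exp (-Ψ θ y / γ))
      (fun θ y => (-γ⁻¹ * Real.exp (-Ψ θ y / γ)) • Ψ' θ y) := by
  refine (h.const_smul (-γ⁻¹)).exp_comp.of_eventually (fun θ _ => ?_) (fun θ _ => ?_)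
  · funext y
    congr 1
    simp only [smul_eq_mul]
    ring
  · funext y
    rw [smul_smul, mul_comm]
    congr 3
    simp only [smul_eq_mul]
    ring

variable {Ψ : E → A × B → ℝ} {Ψ' : E → A × B → E →L[ℝ] ℝ}
  {Ψ'' : E → A × B → E →L[ℝ] E →L[ℝ] ℝ}

-- A bound `K` on `Ψ` confines the partition function to `[exp(-K/γ), exp(K/γ)]`, uniformly in `b`.
omit [FiniteDimensional ℝ E] in
theorem partition_mem_compact (h : DiffFamily Θ Ψ Ψ') {γ : ℝ} (hγ : 0 < γ) (ρ : Measure A)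
    [IsProbabilityMeasure ρ] {θ₀ : E} (hθ₀ : θ₀ ∈ Θ) :
    ∃ K, IsCompact K ∧ K ⊆ Set.Ioi (0 : ℝ) ∧
      ∀ᶠ θ in 𝓝 θ₀, ∀ b, ∫ a, Real.exp (-Ψ θ (a, b) / γ) ∂ρ ∈ K := by
  obtain ⟨K, hK⟩ := h.bdd θ₀ hθ₀
  refine ⟨Set.Icc (Real.exp (-K / γ)) (Real.exp (K / γ)), isCompact_Icc,
    fun t ht => (Real.exp_pos _).trans_le ht.1, ?_⟩
  filter_upwards [hK, h.isOpen.mem_nhds hθ₀] with θ hθ hθΘ b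
  have hi : Integrable (fun a => Real.exp (-Ψ θ (a, b) / γ)) ρ :=
    ((h.gibbs γ).comp_measurable (measurable_prodMk_right (y := b))).integrable hθΘ ρ
  have hb : ∀ a, Real.exp (-K / γ) ≤ Real.exp (-Ψ θ (a, b) / γ) ∧
      Real.exp (-Ψ θ (a, b) / γ) ≤ Real.exp (K / γ) := fun a => by
    have := abs_le.1 (hθ (a, b)).1
    constructor <;> gcongr <;> linarith
  constructor
  · simpa using integral_mono (μ := ρ) (integrable_const _) hi fun a => (hb a).1
  · simpa using integral_mono (μ := ρ) hi (integrable_const _) fun a => (hb a).2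

theorem exists_softmin (h : DiffFamily Θ Ψ Ψ') {γ : ℝ} (hγ : 0 < γ) (ρ : Measure A)
    [IsProbabilityMeasure ρ] :
    DiffFamily Θ (fun θ b => softmin γ ρ fun a => Ψ θ (a, b))
      (fun θ b => (∫ a, Real.exp (-Ψ θ (a, b) / γ) ∂ρ)⁻¹ •
        ∫ a, Real.exp (-Ψ θ (a, b) / γ) • Ψ' θ (a, b) ∂ρ) := by
  have hZ := (h.gibbs γ).integral_left ρ
  have := (hZ.scalar_comp Real.measurable_log (O := Set.Ioi 0) (s' := fun t => t⁻¹)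
    (fun t ht => Real.hasDerivAt_log (ne_of_gt ht))
    (continuousOn_inv₀.mono fun t ht => ne_of_gt ht)
    fun θ hθ => h.partition_mem_compact hγ ρ hθ).const_smul (-γ)
  refine this.of_eventually (fun θ _ => rfl) fun θ _ => ?_
  funext b
  rw [smul_comm]
  congr 1
  simp_rw [mul_smul]
  rw [integral_smul, smul_smul]
  field_simp
  simp

/-- The soft minimum is a log-partition function: its gradient is the Gibbs mean of the gradient,
and differentiating that quotient produces a covariance. All closed forms of Hessians in the
parameter come from these two formulas. -/
theorem exists_softmin₂ (h : DiffFamily Θ Ψ Ψ') (h' : DiffFamily Θ Ψ' Ψ'') {γ : ℝ} (hγ : 0 < γ)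
    (ρ : Measure A) [IsProbabilityMeasure ρ] :
    ∃ M' M'', DiffFamily Θ (fun θ b => softmin γ ρ fun a => Ψ θ (a, b)) M' ∧
      DiffFamily Θ M' M'' ∧
      (∀ θ ∈ Θ, ∀ b v, M' θ b v =
        gibbsMean γ ρ (fun a => Ψ θ (a, b)) (fun a => Ψ' θ (a, b) v)) ∧
      ∀ θ ∈ Θ, ∀ b v w, M'' θ b v w =
        gibbsMean γ ρ (fun a => Ψ θ (a, b)) (fun a => Ψ'' θ (a, b) v w)
        - (1 / γ) * gibbsMean γ ρ (fun a => Ψ θ (a, b)) (fun a => Ψ' θ (a, b) v * Ψ' θ (a, b) w)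
        + (1 / γ) * (gibbsMean γ ρ (fun a => Ψ θ (a, b)) (fun a => Ψ' θ (a, b) v)
          * gibbsMean γ ρ (fun a => Ψ θ (a, b)) (fun a => Ψ' θ (a, b) w)) := by
  have hZ := (h.gibbs γ).integral_left ρ
  have hZi := hZ.scalar_comp measurable_inv (O := Set.Ioi 0) (s' := fun t => -(t ^ 2)⁻¹)
    (fun t ht => hasDerivAt_inv (ne_of_gt ht))
    (((continuous_id.pow 2).continuousOn.inv₀ fun t ht => pow_ne_zero 2 (ne_of_gt ht)).neg)
    fun θ hθ => h.partition_mem_compact hγ ρ hθ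
  have hN := (h.gibbs γ).smul h'
  have hM := hZi.smul (hN.integral_left ρ)
  have hi1 : ∀ θ ∈ Θ, ∀ b, Integrable (fun a => Real.exp (-Ψ θ (a, b) / γ) • Ψ' θ (a, b)) ρ :=
    fun θ hθ b => (hN.comp_measurable (measurable_prodMk_right (y := b))).integrable hθ ρ
  refine ⟨_, _, h.exists_softmin hγ ρ, hM, ?_, ?_⟩
  · intro θ hθ b v
    rw [smul_apply, ContinuousLinearMap.integral_apply (hi1 θ hθ b), gibbsMean, div_eq_inv_mul]
    rfl
  · intro θ hθ b v w
    have hme : StronglyMeasurable fun a => Real.exp (-Ψ θ (a, b) / γ) :=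
      ((h.gibbs γ).meas θ hθ).comp_measurable measurable_prodMk_right
    have hm1 : StronglyMeasurable fun a => Ψ' θ (a, b) :=
      (h'.meas θ hθ).comp_measurable measurable_prodMk_right
    have hm2 : StronglyMeasurable fun a => Ψ'' θ (a, b) :=
      (h'.meas_deriv hθ).comp_measurable measurable_prodMk_right
    obtain ⟨K, hK⟩ := (h.gibbs γ).exists_bound hθ
    obtain ⟨K', hK'⟩ := h'.exists_bound hθ
    have hi2 : Integrable (fun a => Real.exp (-Ψ θ (a, b) / γ) • Ψ'' θ (a, b)) ρ := by
      refine integrable_of_bounded (hme.smul hm2) (K := K * K') fun a => ?_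
      rw [norm_smul]
      exact mul_le_mul (hK (a, b)).1 (hK' (a, b)).2 (norm_nonneg _)
        ((norm_nonneg _).trans (hK (a, b)).1)
    have hi3 : Integrable (fun a => (-γ⁻¹ * Real.exp (-Ψ θ (a, b) / γ)) • Ψ' θ (a, b)) ρ := by
      simp_rw [mul_smul]
      exact (hi1 θ hθ b).smul (-γ⁻¹)
    -- The rank-one term is the full derivative of the integrand minus the term of `hi2`, both
    -- integrable.
    have hi4 : Integrable (fun a => ((-γ⁻¹ * Real.exp (-Ψ θ (a, b) / γ)) • Ψ' θ (a, b)).smulRight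
        (Ψ' θ (a, b))) ρ :=
      ((hN.comp_measurable (measurable_prodMk_right (y := b))).integrable_deriv hθ ρ).sub hi2
        |>.congr (ae_of_all _ fun a => by simp)
    have e1 : (∫ a, (Real.exp (-Ψ θ (a, b) / γ) • Ψ'' θ (a, b)
        + ((-γ⁻¹ * Real.exp (-Ψ θ (a, b) / γ)) • Ψ' θ (a, b)).smulRight (Ψ' θ (a, b))) ∂ρ) v w
        = (∫ a, Real.exp (-Ψ θ (a, b) / γ) * Ψ'' θ (a, b) v w ∂ρ)
          - γ⁻¹ * ∫ a, Real.exp (-Ψ θ (a, b) / γ) * (Ψ' θ (a, b) v * Ψ' θ (a, b) w) ∂ρ := by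
      rw [integral_add hi2 hi4, add_apply, add_apply, ContinuousLinearMap.integral_apply hi2,
        ContinuousLinearMap.integral_apply hi4,
        ContinuousLinearMap.integral_apply (hi2.apply_continuousLinearMap v),
        ContinuousLinearMap.integral_apply (hi4.apply_continuousLinearMap v), sub_eq_add_neg,
        ← neg_mul, ← integral_const_mul]
      simp only [smul_apply, ContinuousLinearMap.smulRight_apply, smul_eq_mul]
      congr 2
      funext a
      ring
    have e2 : ∀ u, (∫ a, Real.exp (-Ψ θ (a, b) / γ) • Ψ' θ (a, b) ∂ρ) u
        = ∫ a, Real.exp (-Ψ θ (a, b) / γ) * Ψ' θ (a, b) u ∂ρ := fun u => by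
      rw [ContinuousLinearMap.integral_apply (hi1 θ hθ b)]
      rfl
    have e3 : ∀ u, (∫ a, (-γ⁻¹ * Real.exp (-Ψ θ (a, b) / γ)) • Ψ' θ (a, b) ∂ρ) u
        = -γ⁻¹ * ∫ a, Real.exp (-Ψ θ (a, b) / γ) * Ψ' θ (a, b) u ∂ρ := fun u => by
      simp_rw [mul_smul]
      rw [integral_smul, smul_apply, e2, smul_eq_mul]
    simp only [add_apply, smul_apply, ContinuousLinearMap.smulRight_apply, smul_eq_mul] at e1 ⊢
    rw [e1, e2, e3]
    unfold gibbsMean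
    ring

section Chain

variable {V F Y : Type*} [NormedAddCommGroup V] [NormedSpace ℝ V] [NormedAddCommGroup F]
  [NormedSpace ℝ F] [MeasurableSpace Y] {Θ : Set E} {S : E → Y → V} {S' : E → Y → E →L[ℝ] V}
  {S'' : E → Y → E →L[ℝ] E →L[ℝ] V}

-- Bounds on `G` are needed only on the set `K` where `S` takes its values; in the applications `K`
-- is the compact set `X` or `X ×ˢ X`.
omit [FiniteDimensional ℝ E] in
theorem chain (hS : DiffFamily Θ S S') {G : Y → V → F} {G' : Y → V → V →L[ℝ] F} {K : Set V}
    (hSK : ∀ θ ∈ Θ, ∀ y, S θ y ∈ K) (hG : ∀ y, ∀ x ∈ K, HasFDerivAt (G y) (G' y x) x)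
    (hm : ∀ θ ∈ Θ, StronglyMeasurable fun y => G y (S θ y)) {C : ℝ}
    (hC : ∀ y, ∀ x ∈ K, ‖G y x‖ ≤ C ∧ ‖G' y x‖ ≤ C) :
    DiffFamily Θ (fun θ y => G y (S θ y)) (fun θ y => (G' y (S θ y)).comp (S' θ y)) where
  isOpen := hS.isOpen
  meas := hm
  deriv θ hθ y := (hG y _ (hSK θ hθ y)).comp θ (hS.deriv θ hθ y)
  bdd θ hθ := by
    obtain ⟨D, hD⟩ := hS.bdd θ hθ
    refine ⟨max C (C * D), ?_⟩
    filter_upwards [hD, hS.isOpen.mem_nhds hθ] with θ' h' hθ' y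
    obtain ⟨c1, c2⟩ := hC y _ (hSK θ' hθ' y)
    refine ⟨c1.trans (le_max_left _ _), le_trans ?_ (le_max_right _ _)⟩
    refine (ContinuousLinearMap.opNorm_comp_le _ _).trans ?_
    exact mul_le_mul c2 (h' y).2 (norm_nonneg _) ((norm_nonneg _).trans c1)

omit [FiniteDimensional ℝ E] in
theorem chain₂ (hS : DiffFamily Θ S S') (hS' : DiffFamily Θ S' S'') {G' : Y → V → V →L[ℝ] F}
    {G'' : Y → V → V →L[ℝ] V →L[ℝ] F} {K : Set V}
    (hSK : ∀ θ ∈ Θ, ∀ y, S θ y ∈ K) (hG : ∀ y, ∀ x ∈ K, HasFDerivAt (G' y) (G'' y x) x)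
    (hm : ∀ θ ∈ Θ, StronglyMeasurable fun y => G' y (S θ y)) {C : ℝ}
    (hC : ∀ y, ∀ x ∈ K, ‖G' y x‖ ≤ C ∧ ‖G'' y x‖ ≤ C) :
    ∃ Q, DiffFamily Θ (fun θ y => (G' y (S θ y)).comp (S' θ y)) Q ∧
      ∀ θ y v w, Q θ y v w = G'' y (S θ y) (S' θ y v) (S' θ y w) + G' y (S θ y) (S'' θ y v w) := by
  refine ⟨_, (hS.chain hSK hG hm hC).bilinear (ContinuousLinearMap.compL ℝ E V F) hS', ?_⟩
  intro θ y v w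
  simp [add_comm]

end Chain

end DiffFamily

end SoftminFamilies

end SiNG

namespace SiNG

/-- Bounded measurable real functions. -/
structure BddMeas {A : Type*} [MeasurableSpace A] (a : A → ℝ) : Prop where
  meas : StronglyMeasurable a
  bdd : ∃ K, ∀ x, |a x| ≤ K

namespace BddMeas

variable {A : Type*} [MeasurableSpace A] {a b : A → ℝ}

theorem const (k : ℝ) : BddMeas fun _ : A => k :=
  ⟨stronglyMeasurable_const, |k|, fun _ => le_rfl⟩

theorem add (ha : BddMeas a) (hb : BddMeas b) : BddMeas fun x => a x + b x := by
  obtain ⟨K, hK⟩ := ha.bdd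
  obtain ⟨L, hL⟩ := hb.bdd
  exact ⟨ha.meas.add hb.meas, K + L, fun x => (abs_add_le _ _).trans (add_le_add (hK x) (hL x))⟩

theorem mul (ha : BddMeas a) (hb : BddMeas b) : BddMeas fun x => a x * b x := by
  obtain ⟨K, hK⟩ := ha.bdd
  obtain ⟨L, hL⟩ := hb.bdd
  refine ⟨ha.meas.mul hb.meas, K * L, fun x => ?_⟩
  rw [abs_mul]
  exact mul_le_mul (hK x) (hL x) (abs_nonneg _) ((abs_nonneg _).trans (hK x))

theorem const_mul (ha : BddMeas a) (k : ℝ) : BddMeas fun x => k * a x :=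
  (BddMeas.const k).mul ha

theorem neg (ha : BddMeas a) : BddMeas fun x => -a x := by
  simpa using ha.const_mul (-1)

theorem sub (ha : BddMeas a) (hb : BddMeas b) : BddMeas fun x => a x - b x := by
  simpa [sub_eq_add_neg] using ha.add hb.neg

theorem exp (ha : BddMeas a) : BddMeas fun x => Real.exp (a x) := by
  obtain ⟨K, hK⟩ := ha.bdd
  refine ⟨Real.continuous_exp.comp_stronglyMeasurable ha.meas, Real.exp K, fun x => ?_⟩
  rw [abs_of_pos (Real.exp_pos _)]
  exact Real.exp_le_exp.2 (abs_le.1 (hK x)).2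

theorem gibbs (ha : BddMeas a) (γ : ℝ) : BddMeas fun x => Real.exp (-a x / γ) := by
  simpa [div_eq_mul_inv, mul_comm] using (ha.const_mul (-γ⁻¹)).exp

theorem comp {B : Type*} [MeasurableSpace B] {g : B → A} (ha : BddMeas a) (hg : Measurable g) :
    BddMeas fun x => a (g x) :=
  ⟨ha.meas.comp_measurable hg, ha.bdd.imp fun _ hK x => hK (g x)⟩

theorem integrable (ha : BddMeas a) (ρ : Measure A) [IsFiniteMeasure ρ] : Integrable a ρ := by
  obtain ⟨K, hK⟩ := ha.bdd
  exact integrable_of_bounded ha.meas hK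

theorem integral_left {B : Type*} [MeasurableSpace B] {f : B × A → ℝ} (hf : BddMeas f)
    (ρ : Measure B) [IsProbabilityMeasure ρ] : BddMeas fun a => ∫ b, f (b, a) ∂ρ := by
  obtain ⟨K, hK⟩ := hf.bdd
  refine ⟨hf.meas.integral_prod_left', K, fun a => ?_⟩
  simpa using norm_integral_le_of_norm_le_const (μ := ρ) (f := fun b => f (b, a)) (C := K)
    (ae_of_all _ fun b => hK (b, a))

end BddMeas

/-! ### Comparison, Taylor expansion and oscillation contraction for soft minima. -/

section Softmin

variable {A : Type*} [MeasurableSpace A] {γ : ℝ} {ρ : Measure A} [IsProbabilityMeasure ρ]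
  {a b φ ψ : A → ℝ}

theorem partition_pos (ha : BddMeas a) : 0 < ∫ x, Real.exp (-a x / γ) ∂ρ :=
  integral_exp_pos ((ha.gibbs γ).integrable ρ)

/-- Pointwise, `exp(-a/γ) ≥ exp(-b/γ) exp(-s/γ)`. Nonexpansiveness in the sup norm and compatibility
with additive constants are both consequences. -/
theorem softmin_le (hγ : 0 < γ) (ha : BddMeas a) (hb : BddMeas b) {s : ℝ}
    (h : ∀ x, a x ≤ b x + s) : softmin γ ρ a ≤ softmin γ ρ b + s := by
  have h1 : (∫ x, Real.exp (-b x / γ) ∂ρ) * Real.exp (-s / γ) ≤ ∫ x, Real.exp (-a x / γ) ∂ρ := by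
    rw [← integral_mul_const]
    refine integral_mono (((hb.gibbs γ).integrable ρ).mul_const _) ((ha.gibbs γ).integrable ρ)
      fun x => ?_
    simp only
    rw [← Real.exp_add, Real.exp_le_exp, ← add_div]
    gcongr
    linarith [h x]
  have h2 := Real.log_le_log (mul_pos (partition_pos hb) (Real.exp_pos _)) h1
  rw [Real.log_mul (partition_pos hb).ne' (Real.exp_pos _).ne', Real.log_exp] at h2
  have h3 := mul_le_mul_of_nonneg_left h2 hγ.le
  rw [mul_add, mul_div_cancel₀ _ hγ.ne'] at h3
  unfold softmin
  linarith

theorem abs_softmin_sub_le (hγ : 0 < γ) (ha : BddMeas a) (hb : BddMeas b) {s : ℝ}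
    (h : ∀ x, |a x - b x| ≤ s) : |softmin γ ρ a - softmin γ ρ b| ≤ s := by
  have h1 := softmin_le (ρ := ρ) hγ ha hb (s := s) fun x => by linarith [(abs_le.1 (h x)).2]
  have h2 := softmin_le (ρ := ρ) hγ hb ha (s := s) fun x => by linarith [(abs_le.1 (h x)).1]
  exact abs_le.2 ⟨by linarith, by linarith⟩

theorem softmin_add_const (hγ : 0 < γ) (ha : BddMeas a) (k : ℝ) :
    softmin γ ρ (fun x => a x + k) = softmin γ ρ a + k := by
  have h1 := softmin_le (ρ := ρ) hγ (ha.add (BddMeas.const k)) ha (s := k) fun x => le_rfl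
  have h2 := softmin_le (ρ := ρ) hγ ha (ha.add (BddMeas.const k)) (s := -k) fun x => by simp
  linarith

theorem exp_softmin (hγ : 0 < γ) (ha : BddMeas a) :
    Real.exp (softmin γ ρ a / γ) = (∫ x, Real.exp (-a x / γ) ∂ρ)⁻¹ := by
  rw [softmin, neg_mul, neg_div, mul_div_cancel_left₀ _ hγ.ne', Real.exp_neg,
    Real.exp_log (partition_pos ha)]

/-- The Gibbs mean is the integral against the normalized density. -/
theorem gibbsMean_eq (hγ : 0 < γ) (ha : BddMeas a) (φ : A → ℝ) :
    gibbsMean γ ρ a φ = ∫ x, Real.exp ((softmin γ ρ a - a x) / γ) * φ x ∂ρ := by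
  rw [gibbsMean, div_eq_inv_mul, ← exp_softmin hγ ha, ← integral_const_mul]
  congr 1
  funext x
  rw [← mul_assoc, ← Real.exp_add]
  ring_nf

theorem gibbsMean_const (ha : BddMeas a) (k : ℝ) :
    gibbsMean γ ρ a (fun _ => k) = k := by
  rw [gibbsMean, integral_mul_const, mul_div_cancel_left₀ _ (partition_pos ha).ne']

theorem integral_exp_softmin (hγ : 0 < γ) (ha : BddMeas a) :
    ∫ x, Real.exp ((softmin γ ρ a - a x) / γ) ∂ρ = 1 := by
  have := gibbsMean_const (γ := γ) (ρ := ρ) ha 1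
  rw [gibbsMean_eq hγ ha] at this
  simpa using this

theorem gibbsMean_add (ha : BddMeas a) (hφ : BddMeas φ) (hψ : BddMeas ψ) :
    gibbsMean γ ρ a (fun x => φ x + ψ x) = gibbsMean γ ρ a φ + gibbsMean γ ρ a ψ := by
  simp only [gibbsMean, mul_add]
  rw [integral_add (((ha.gibbs γ).mul hφ).integrable ρ) (((ha.gibbs γ).mul hψ).integrable ρ),
    add_div]

theorem gibbsMean_sub (ha : BddMeas a) (hφ : BddMeas φ) (hψ : BddMeas ψ) :
    gibbsMean γ ρ a (fun x => φ x - ψ x) = gibbsMean γ ρ a φ - gibbsMean γ ρ a ψ := by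
  simp only [gibbsMean, mul_sub]
  rw [integral_sub (((ha.gibbs γ).mul hφ).integrable ρ) (((ha.gibbs γ).mul hψ).integrable ρ),
    sub_div]

theorem gibbsMean_mono (ha : BddMeas a) (hφ : BddMeas φ) (hψ : BddMeas ψ) (h : ∀ x, φ x ≤ ψ x) :
    gibbsMean γ ρ a φ ≤ gibbsMean γ ρ a ψ := by
  refine div_le_div_of_nonneg_right ?_ (partition_pos ha).le
  exact integral_mono (((ha.gibbs γ).mul hφ).integrable ρ) (((ha.gibbs γ).mul hψ).integrable ρ)
    fun x => mul_le_mul_of_nonneg_left (h x) (Real.exp_pos _).le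

theorem abs_gibbsMean_le (ha : BddMeas a) (hφ : BddMeas φ) {s : ℝ} (h : ∀ x, |φ x| ≤ s) :
    |gibbsMean γ ρ a φ| ≤ s := by
  have h1 := gibbsMean_mono (γ := γ) (ρ := ρ) ha hφ (BddMeas.const s) fun x => (abs_le.1 (h x)).2
  have h2 := gibbsMean_mono (γ := γ) (ρ := ρ) ha (BddMeas.const (-s)) hφ
    fun x => (abs_le.1 (h x)).1
  rw [gibbsMean_const ha] at h1 h2
  exact abs_le.2 ⟨h2, h1⟩

/-- A segment in the space of costs, seen as a family with real parameter. The factor `Unit` stands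
for the extra coordinate that the results on families of soft minima carry. -/
theorem diffFamily_line (ha : BddMeas a) (hφ : BddMeas φ) :
    DiffFamily Set.univ (fun (t : ℝ) (p : A × Unit) => a p.1 + t * φ p.1)
        (fun _ p => (1 : ℝ →L[ℝ] ℝ).smulRight (φ p.1)) ∧
      DiffFamily Set.univ (fun (_ : ℝ) (p : A × Unit) => (1 : ℝ →L[ℝ] ℝ).smulRight (φ p.1))
        (fun _ _ => 0) := by
  obtain ⟨K, hK⟩ := ha.bdd
  obtain ⟨L, hL⟩ := hφ.bdd
  refine ⟨⟨isOpen_univ, fun t _ => ?_, fun t _ p => ?_, fun t₀ _ => ?_⟩,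
    ⟨isOpen_univ, fun t _ => ?_, fun t _ p => hasFDerivAt_const _ _, fun t₀ _ => ⟨L, ?_⟩⟩⟩
  · exact (ha.add (hφ.const_mul t)).meas.comp_measurable measurable_fst
  · have : HasDerivAt (fun t => a p.1 + t * φ p.1) (φ p.1) t := by
      simpa using ((hasDerivAt_id t).mul_const (φ p.1)).const_add (a p.1)
    exact this.hasFDerivAt
  · refine ⟨max (K + (|t₀| + 1) * L) L, ?_⟩
    filter_upwards [Metric.ball_mem_nhds t₀ one_pos] with t ht p
    have ht : |t| ≤ |t₀| + 1 := by
      rw [Metric.mem_ball, Real.dist_eq] at ht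
      have := abs_sub_abs_le_abs_sub t t₀
      linarith
    constructor
    · refine le_trans ?_ (le_max_left _ _)
      rw [Real.norm_eq_abs]
      refine (abs_add_le _ _).trans (add_le_add (hK _) ?_)
      rw [abs_mul]
      gcongr
      exact hL _
    · refine le_trans ?_ (le_max_right _ _)
      simpa using hL _
  · exact (ContinuousLinearMap.smulRightL ℝ ℝ ℝ 1).continuous.comp_stronglyMeasurable
      (hφ.meas.comp_measurable measurable_fst)
  · exact Eventually.of_forall fun t p => ⟨by simpa using hL _,
      by simpa using (abs_nonneg _).trans (hL p.1)⟩

theorem hasDerivAt_softmin_line (hγ : 0 < γ) (ha : BddMeas a) (hφ : BddMeas φ) (t : ℝ) :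
    HasDerivAt (fun t => softmin γ ρ fun x => a x + t * φ x)
        (gibbsMean γ ρ (fun x => a x + t * φ x) φ) t ∧
      HasDerivAt (fun t => gibbsMean γ ρ (fun x => a x + t * φ x) φ)
        (-(1 / γ) * gibbsMean γ ρ (fun x => a x + t * φ x) (fun x => φ x * φ x)
          + (1 / γ) * gibbsMean γ ρ (fun x => a x + t * φ x) φ ^ 2) t := by
  obtain ⟨h1, h2⟩ := diffFamily_line ha hφ
  obtain ⟨M', M'', k1, k2, e1, e2⟩ := h1.exists_softmin₂ h2 hγ ρ
  have d1 := (k1.deriv t (Set.mem_univ t) ()).hasDerivAt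
  rw [e1 t (Set.mem_univ t)] at d1
  have d2 := ((k2.deriv t (Set.mem_univ t) ()).clm_apply (hasFDerivAt_const (1 : ℝ) t)).hasDerivAt
  have e3 : (fun t => M' t () 1) = fun t => gibbsMean γ ρ (fun x => a x + t * φ x) φ := by
    funext t
    simpa using e1 t (Set.mem_univ t) () 1
  rw [e3] at d2
  refine ⟨by simpa using d1, ?_⟩
  have e4 : gibbsMean γ ρ (fun x => a x + t * φ x) (fun _ => 0) = 0 := by simp [gibbsMean]
  refine d2.congr_deriv ?_
  simp [e2 t (Set.mem_univ t), e4, sq]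

/-- The second derivative along the segment is minus a Gibbs variance over `γ`, so the mean value
inequality applies twice. The variance is bounded crudely by `s² + s²`; what matters is that the
constant does not depend on `a` or `ρ`. -/
theorem abs_softmin_taylor (hγ : 0 < γ) (ha : BddMeas a) (hφ : BddMeas φ) {s : ℝ}
    (h : ∀ x, |φ x| ≤ s) :
    |softmin γ ρ (fun x => a x + φ x) - softmin γ ρ a - gibbsMean γ ρ a φ| ≤ 2 * s ^ 2 / γ := by
  have hs : 0 ≤ s := by
    obtain ⟨x⟩ := ρ.nonempty_of_neZero
    exact (abs_nonneg _).trans (h x)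
  have hat : ∀ t, BddMeas fun x => a x + t * φ x := fun t => ha.add (hφ.const_mul t)
  have hγ' : 0 ≤ 1 / γ := by positivity
  have b1 : ∀ t ∈ Set.Icc (0 : ℝ) 1,
      ‖gibbsMean γ ρ (fun x => a x + t * φ x) φ - gibbsMean γ ρ (fun x => a x + 0 * φ x) φ‖
        ≤ 2 * s ^ 2 / γ := by
    intro t ht
    have := norm_image_sub_le_of_norm_deriv_le_segment_01' (C := 2 * s ^ 2 / γ)
      (f := fun r => gibbsMean γ ρ (fun x => a x + (r * t) * φ x) φ)
      (f' := fun r => (-(1 / γ) * gibbsMean γ ρ (fun x => a x + (r * t) * φ x) (fun x => φ x * φ x)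
          + (1 / γ) * gibbsMean γ ρ (fun x => a x + (r * t) * φ x) φ ^ 2) * t)
      (fun r _ => ((hasDerivAt_softmin_line hγ ha hφ (r * t)).2.comp r
        (by simpa using (hasDerivAt_id r).mul_const t)).hasDerivWithinAt) ?_
    · simpa using this
    · intro r _
      have g1 := abs_gibbsMean_le (γ := γ) (ρ := ρ) (hat (r * t)) hφ h
      have g2 := abs_gibbsMean_le (γ := γ) (ρ := ρ) (hat (r * t)) (hφ.mul hφ) (s := s ^ 2)
        fun x => by
          rw [abs_mul, sq]
          exact mul_le_mul (h x) (h x) (abs_nonneg _) hs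
      have g3 : gibbsMean γ ρ (fun x => a x + (r * t) * φ x) φ ^ 2 ≤ s ^ 2 := sq_le_sq' (abs_le.1 g1).1 (abs_le.1 g1).2
      rw [norm_mul, Real.norm_eq_abs, Real.norm_eq_abs, abs_of_nonneg ht.1]
      have g4 : |-(1 / γ) * gibbsMean γ ρ (fun x => a x + (r * t) * φ x) (fun x => φ x * φ x)
          + (1 / γ) * gibbsMean γ ρ (fun x => a x + (r * t) * φ x) φ ^ 2| ≤ 2 * s ^ 2 / γ := by
        rw [neg_mul, neg_add_eq_sub, ← mul_sub, abs_mul, abs_of_nonneg hγ', mul_comm, mul_one_div]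
        gcongr
        refine (abs_sub _ _).trans ?_
        rw [abs_of_nonneg (sq_nonneg (gibbsMean γ ρ (fun x => a x + (r * t) * φ x) φ))]
        linarith
      calc _ ≤ 2 * s ^ 2 / γ * 1 := mul_le_mul g4 ht.2 ht.1 ((abs_nonneg _).trans g4)
        _ = _ := mul_one _
  have := norm_image_sub_le_of_norm_deriv_le_segment_01' (C := 2 * s ^ 2 / γ)
    (f := fun t => softmin γ ρ (fun x => a x + t * φ x)
      - t * gibbsMean γ ρ (fun x => a x + 0 * φ x) φ)
    (fun t _ => (((hasDerivAt_softmin_line hγ ha hφ t).1).sub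
      (by simpa using (hasDerivAt_id t).mul_const _)).hasDerivWithinAt)
    (fun t ht => b1 t ⟨ht.1, ht.2.le⟩)
  simp only [one_mul, zero_mul, add_zero, sub_zero, Real.norm_eq_abs] at this
  rw [sub_right_comm]
  exact this

/-- The normalized densities `exp((softmin - a)/γ)` and `exp((softmin - b)/γ)` compare with ratio at
least `exp(-2D/γ)`: one `D` from the costs and one from the soft minima. This is a Doeblin
minorization. -/
theorem gibbsMean_ge (hγ : 0 < γ) (ha : BddMeas a) (hb : BddMeas b) (hφ : BddMeas φ)
    (h0 : ∀ x, 0 ≤ φ x) {D : ℝ} (hD : ∀ x, |a x - b x| ≤ D) :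
    Real.exp (-2 * D / γ) * gibbsMean γ ρ b φ ≤ gibbsMean γ ρ a φ := by
  rw [gibbsMean_eq hγ ha, gibbsMean_eq hγ hb, ← integral_const_mul]
  have hs := abs_softmin_sub_le (ρ := ρ) hγ ha hb hD
  have hbb : ∀ {a : A → ℝ}, BddMeas a →
      BddMeas fun x => Real.exp ((softmin γ ρ a - a x) / γ) * φ x := fun {a} ha => by
    refine BddMeas.mul ?_ hφ
    simpa [neg_sub] using (ha.sub (BddMeas.const (softmin γ ρ a))).gibbs γ
  refine integral_mono (((hbb hb).const_mul _).integrable ρ) ((hbb ha).integrable ρ) fun x => ?_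
  simp only
  rw [← mul_assoc, ← Real.exp_add, ← add_div]
  refine mul_le_mul_of_nonneg_right (Real.exp_le_exp.2 ?_) (h0 x)
  gcongr
  have := abs_le.1 hs
  have := abs_le.1 (hD x)
  linarith

/-- The minorization is applied to the nonnegative function `inf φ + R - φ`, whose mean for `b` is
at most `R`. -/
theorem gibbsMean_sub_le (hγ : 0 < γ) (ha : BddMeas a) (hb : BddMeas b) (hφ : BddMeas φ)
    {D R : ℝ} (hD : ∀ x, |a x - b x| ≤ D) (hR : ∀ x x', φ x - φ x' ≤ R) :
    gibbsMean γ ρ a φ - gibbsMean γ ρ b φ ≤ (1 - Real.exp (-2 * D / γ)) * R := by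
  obtain ⟨x₀⟩ := ρ.nonempty_of_neZero
  obtain ⟨K, hK⟩ := hφ.bdd
  have hbd : BddBelow (Set.range φ) := ⟨-K, by rintro _ ⟨x, rfl⟩; exact (abs_le.1 (hK x)).1⟩
  set m := sInf (Set.range φ) with hm
  have m1 : ∀ x, m ≤ φ x := fun x => csInf_le hbd ⟨x, rfl⟩
  have m2 : ∀ x, φ x ≤ m + R := fun x => by
    have : φ x - R ≤ m := le_csInf ⟨φ x₀, x₀, rfl⟩ (by
      rintro _ ⟨x', rfl⟩
      linarith [hR x x'])
    linarith
  have h1 := gibbsMean_ge (ρ := ρ) hγ ha hb ((BddMeas.const (m + R)).sub hφ)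
    (fun x => by linarith [m2 x]) hD
  have h2 := gibbsMean_mono (γ := γ) (ρ := ρ) hb (BddMeas.const m) hφ m1
  rw [gibbsMean_sub hb (BddMeas.const _) hφ, gibbsMean_sub ha (BddMeas.const _) hφ,
    gibbsMean_const ha, gibbsMean_const hb] at h1
  rw [gibbsMean_const hb] at h2
  have hD0 : 0 ≤ D := (abs_nonneg _).trans (hD x₀)
  have hk : Real.exp (-2 * D / γ) ≤ 1 := by
    rw [Real.exp_le_one_iff]
    exact div_nonpos_of_nonpos_of_nonneg (by linarith) hγ.le
  nlinarith

theorem abs_gibbsMean_sub_le (hγ : 0 < γ) (ha : BddMeas a) (hb : BddMeas b) (hφ : BddMeas φ)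
    {D R : ℝ} (hD : ∀ x, |a x - b x| ≤ D) (hR : ∀ x x', |φ x - φ x'| ≤ R) :
    |gibbsMean γ ρ a φ - gibbsMean γ ρ b φ| ≤ (1 - Real.exp (-2 * D / γ)) * R := by
  have hR' : ∀ x x', φ x - φ x' ≤ R := fun x x' => (le_abs_self _).trans (hR x x')
  have h1 := gibbsMean_sub_le (ρ := ρ) hγ ha hb hφ hD hR'
  have h2 := gibbsMean_sub_le (ρ := ρ) hγ hb ha hφ (fun x => by rw [abs_sub_comm]; exact hD x) hR'
  exact abs_le.2 ⟨by linarith, h1⟩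

/-- The soft minimum contracts oscillations. -/
theorem abs_softmin_increment_sub_le (hγ : 0 < γ) (ha : BddMeas a) (hb : BddMeas b)
    (hφ : BddMeas φ) {D R : ℝ} (hD : ∀ x, |a x - b x| ≤ D) (hR : ∀ x x', |φ x - φ x'| ≤ R) :
    |(softmin γ ρ (fun x => a x + φ x) - softmin γ ρ a)
      - (softmin γ ρ (fun x => b x + φ x) - softmin γ ρ b)|
      ≤ (1 - Real.exp (-2 * D / γ)) * R := by
  -- The `t`-derivative of the difference is a difference of Gibbs means of `φ` at `a + tφ` and `b +
  -- tφ`, two costs still within `D` of each other.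
  have := norm_image_sub_le_of_norm_deriv_le_segment_01'
    (C := (1 - Real.exp (-2 * D / γ)) * R)
    (f := fun t => softmin γ ρ (fun x => a x + t * φ x) - softmin γ ρ (fun x => b x + t * φ x))
    (fun t _ => ((hasDerivAt_softmin_line hγ ha hφ t).1.sub
      (hasDerivAt_softmin_line hγ hb hφ t).1).hasDerivWithinAt)
    (fun t _ => abs_gibbsMean_sub_le hγ (ha.add (hφ.const_mul t)) (hb.add (hφ.const_mul t)) hφ
      (by simpa using hD) hR)
  simp only [one_mul, zero_mul, add_zero, Real.norm_eq_abs] at this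
  rw [sub_sub_sub_comm]
  exact this

end Softmin

end SiNG

namespace SiNG

/-- `φ` and `ψ` solve the Schrödinger system of the cost `C`, everywhere. -/
structure Schrodinger {I J : Type*} [MeasurableSpace I] [MeasurableSpace J] (γ : ℝ) (μ : Measure I)
    (ν : Measure J) (C : I × J → ℝ) (φ : I → ℝ) (ψ : J → ℝ) : Prop where
  left : BddMeas φ
  right : BddMeas ψ
  left_eq : ∀ i, φ i = softmin γ ν fun j => C (i, j) - ψ j
  right_eq : ∀ j, ψ j = softmin γ μ fun i => C (i, j) - φ i

/-- Boundedness makes the supremum `M` of the oscillations finite, so that `M ≤ q M + e` can be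
solved for `M`. -/
theorem oscillation_le {I : Type*} {R : I → ℝ} (hR : ∃ K, ∀ i, |R i| ≤ K) {q e : ℝ} (hq : q < 1)
    (h : ∀ M, (∀ i i', |R i - R i'| ≤ M) → ∀ i i', |R i - R i'| ≤ q * M + e) (i i' : I) :
    |R i - R i'| ≤ e / (1 - q) := by
  obtain ⟨K, hK⟩ := hR
  have hb : BddAbove (Set.range fun p : I × I => |R p.1 - R p.2|) := by
    refine ⟨K + K, ?_⟩
    rintro _ ⟨p, rfl⟩
    exact (abs_sub _ _).trans (add_le_add (hK _) (hK _))
  set M := sSup (Set.range fun p : I × I => |R p.1 - R p.2|)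
  have hM : ∀ i i', |R i - R i'| ≤ M := fun i i' => le_csSup hb ⟨(i, i'), rfl⟩
  have h2 : M ≤ q * M + e := by
    refine csSup_le ⟨_, (i, i'), rfl⟩ ?_
    rintro _ ⟨p, rfl⟩
    exact h M hM p.1 p.2
  refine (hM i i').trans ?_
  rw [le_div_iff₀ (by linarith)]
  linarith

/-! ### Stability of Schrödinger systems: Lipschitz bounds and second differences. -/

namespace Schrodinger

variable {I J : Type*} [MeasurableSpace I] [MeasurableSpace J] {γ : ℝ} {μ : Measure I}
  {ν : Measure J} [IsProbabilityMeasure μ] [IsProbabilityMeasure ν]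
  {C C₁ C₂ C₃ : I × J → ℝ} {φ φ₁ φ₂ φ₃ : I → ℝ} {ψ ψ₁ ψ₂ ψ₃ : J → ℝ}

omit [IsProbabilityMeasure μ] [IsProbabilityMeasure ν] in
theorem swap (S : Schrodinger γ μ ν C φ ψ) :
    Schrodinger γ ν μ (fun p => C (p.2, p.1)) ψ φ :=
  ⟨S.right, S.left, S.right_eq, S.left_eq⟩

omit [IsProbabilityMeasure μ] [IsProbabilityMeasure ν] in
theorem bddMeas_right (hC : BddMeas C) (S : Schrodinger γ μ ν C φ ψ) (i : I) :
    BddMeas fun j => C (i, j) - ψ j :=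
  (hC.comp measurable_prodMk_left).sub S.right

section Comparison

variable {B s : ℝ} (hγ : 0 < γ) (hC : BddMeas C) (hC₁ : BddMeas C₁)
  (hB : ∀ p, |C p| ≤ B) (hB₁ : ∀ p, |C₁ p| ≤ B) (hs : ∀ p, |C₁ p - C p| ≤ s)
  (S : Schrodinger γ μ ν C φ ψ) (S₁ : Schrodinger γ μ ν C₁ φ₁ ψ₁)

-- Replacing `C₁` by `C` in the equation of `φ₁` costs `s` at each of the two points. What is left
-- is an increment of soft minima with base costs `C (i, ·) - ψ` and `C (i', ·) - ψ`, which differ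
-- by at most `2 * B`, so oscillations are contracted.
include hγ hC hC₁ hB hs S S₁ in
omit [IsProbabilityMeasure μ] in
theorem oscillation_step {M : ℝ}
    (hM : ∀ j j', |(ψ₁ j - ψ j) - (ψ₁ j' - ψ j')| ≤ M) (i i' : I) :
    |(φ₁ i - φ i) - (φ₁ i' - φ i')| ≤ (1 - Real.exp (-2 * (2 * B) / γ)) * M + 2 * s := by
  have key : ∀ i, |φ₁ i - softmin γ ν (fun j => (C (i, j) - ψ j) + -(ψ₁ j - ψ j))| ≤ s := by
    intro i
    rw [S₁.left_eq]
    refine abs_softmin_sub_le hγ (bddMeas_right hC₁ S₁ i)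
      ((bddMeas_right hC S i).add (S₁.right.sub S.right).neg) fun j => ?_
    have : C₁ (i, j) - ψ₁ j - (C (i, j) - ψ j + -(ψ₁ j - ψ j)) = C₁ (i, j) - C (i, j) := by ring
    rw [this]
    exact hs _
  have h1 := abs_softmin_increment_sub_le (ρ := ν) hγ (bddMeas_right hC S i)
    (bddMeas_right hC S i') (S₁.right.sub S.right).neg (D := 2 * B) (R := M)
    (fun j => by
      rw [sub_sub_sub_cancel_right]
      refine (abs_sub _ _).trans ?_
      linarith [hB (i, j), hB (i', j)])
    (fun j j' => by
      rw [← abs_neg]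
      convert hM j j' using 2
      ring)
  rw [← S.left_eq, ← S.left_eq] at h1
  have k1 := abs_le.1 (key i)
  have k2 := abs_le.1 (key i')
  have k3 := abs_le.1 h1
  exact abs_le.2 ⟨by linarith, by linarith⟩

-- One step for each equation of the system sends a bound `M` on the oscillation of `φ₁ - φ` to `q
-- (q M + 2 s) + 2 s ≤ q M + 4 s`, with `1 - q = exp(-4B/γ)`.
include hγ hC hC₁ hB hs S S₁ in
theorem oscillation_sub_le (i i' : I) :
    |(φ₁ i - φ i) - (φ₁ i' - φ i')| ≤ 4 * s / Real.exp (-2 * (2 * B) / γ) := by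
  obtain ⟨j₀⟩ := ν.nonempty_of_neZero
  have hκ := Real.exp_pos (-2 * (2 * B) / γ)
  have hs0 : 0 ≤ s := (abs_nonneg _).trans (hs (i, j₀))
  have hB0 : 0 ≤ B := (abs_nonneg _).trans (hB (i, j₀))
  have hκ1 : Real.exp (-2 * (2 * B) / γ) ≤ 1 := by
    rw [Real.exp_le_one_iff]
    exact div_nonpos_of_nonpos_of_nonneg (by linarith) hγ.le
  have := oscillation_le (R := fun i => φ₁ i - φ i) (S₁.left.sub S.left).bdd
    (q := 1 - Real.exp (-2 * (2 * B) / γ)) (e := 4 * s) (by linarith) (fun M hM i i' => ?_) i i'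
  · simpa using this
  · have hM0 : 0 ≤ M := (abs_nonneg _).trans (hM i i')
    have step := oscillation_step hγ (hC.comp measurable_swap) (hC₁.comp measurable_swap)
      (fun p => hB p.swap) (fun p => hs p.swap) S.swap S₁.swap hM
    have := oscillation_step hγ hC hC₁ hB hs S S₁ step i i'
    have h3 := mul_le_mul_of_nonneg_right hκ1 hM0
    have h4 := mul_nonneg hκ.le hs0
    nlinarith [mul_nonneg hκ.le (mul_nonneg (sub_nonneg.2 hκ1) hM0)]

/-- The Lipschitz constant of normalized potentials with respect to the cost. -/
noncomputable def lipConst (γ B : ℝ) : ℝ := 2 + 4 / Real.exp (-2 * (2 * B) / γ)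

theorem lipConst_pos (γ B : ℝ) : 0 < lipConst γ B := by
  unfold lipConst
  positivity

-- The oscillation bound leaves a free constant, fixed by the normalization: if `ψ₁ - ψ` were larger
-- than this somewhere it would exceed `s` everywhere, and the soft minima giving `φ i₀` and `φ₁ i₀`
-- could not both vanish.
include hγ hC hC₁ hB hs S S₁ in
theorem right_sub_le {i₀ : I} (h0 : φ i₀ = 0) (h0₁ : φ₁ i₀ = 0) (j : J) :
    ψ₁ j - ψ j ≤ s + 4 * s / Real.exp (-2 * (2 * B) / γ) := by
  have hR := oscillation_sub_le hγ (hC.comp measurable_swap) (hC₁.comp measurable_swap)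
      (fun p => hB p.swap) (fun p => hs p.swap) S.swap S₁.swap j
  have := softmin_le (ρ := ν) hγ (bddMeas_right hC₁ S₁ i₀) (bddMeas_right hC S i₀)
    (s := s - (ψ₁ j - ψ j - 4 * s / Real.exp (-2 * (2 * B) / γ))) (fun j' => by
      have := (abs_le.1 (hR j')).2
      have := (abs_le.1 (hs (i₀, j'))).2
      linarith)
  rw [← S.left_eq, ← S₁.left_eq, h0, h0₁] at this
  linarith

include hγ hC hC₁ hB hB₁ hs S S₁ in
theorem abs_sub_le {i₀ : I} (h0 : φ i₀ = 0) (h0₁ : φ₁ i₀ = 0) :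
    (∀ i, |φ₁ i - φ i| ≤ lipConst γ B * s) ∧ ∀ j, |ψ₁ j - ψ j| ≤ lipConst γ B * s := by
  obtain ⟨j₀⟩ := ν.nonempty_of_neZero
  have hs0 : 0 ≤ s := (abs_nonneg _).trans (hs (i₀, j₀))
  have hs' : ∀ p, |C p - C₁ p| ≤ s := fun p => by
    rw [abs_sub_comm]
    exact hs p
  have h1 : ∀ j, |ψ₁ j - ψ j| ≤ s + 4 * s / Real.exp (-2 * (2 * B) / γ) := fun j =>
    abs_le.2 ⟨by linarith [right_sub_le hγ hC₁ hC hB₁ hs' S₁ S h0₁ h0 j],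
      right_sub_le hγ hC hC₁ hB hs S S₁ h0 h0₁ j⟩
  have e : lipConst γ B * s = s + (s + 4 * s / Real.exp (-2 * (2 * B) / γ)) := by
    unfold lipConst
    ring
  refine ⟨fun i => ?_, fun j => by rw [e]; linarith [h1 j]⟩
  rw [S₁.left_eq, S.left_eq, e]
  refine abs_softmin_sub_le hγ (bddMeas_right hC₁ S₁ i) (bddMeas_right hC S i) fun j => ?_
  have : C₁ (i, j) - ψ₁ j - (C (i, j) - ψ j) = (C₁ (i, j) - C (i, j)) - (ψ₁ j - ψ j) := by ring
  rw [this]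
  exact (abs_sub _ _).trans (add_le_add (hs _) (h1 j))

include hγ hC hC₁ hs S S₁ in
omit [IsProbabilityMeasure μ] in
theorem left_taylor {t : ℝ} (ht : ∀ j, |ψ₁ j - ψ j| ≤ t) (i : I) :
    |φ₁ i - φ i - gibbsMean γ ν (fun j => C (i, j) - ψ j)
      (fun j => (C₁ (i, j) - C (i, j)) - (ψ₁ j - ψ j))| ≤ 2 * (s + t) ^ 2 / γ := by
  have := abs_softmin_taylor (ρ := ν) hγ (bddMeas_right hC S i)
    (((hC₁.comp measurable_prodMk_left).sub (hC.comp measurable_prodMk_left)).sub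
      (S₁.right.sub S.right)) (s := s + t)
    (fun j => (abs_sub _ _).trans (add_le_add (hs (i, j)) (ht j)))
  rw [← S.left_eq] at this
  convert this using 4
  rw [S₁.left_eq]
  congr 1
  funext j
  ring

end Comparison

section Additivity

variable {B s ε : ℝ} (hγ : 0 < γ) (hC : BddMeas C) (hC₁ : BddMeas C₁) (hC₂ : BddMeas C₂)
  (hC₃ : BddMeas C₃) (hB : ∀ p, |C p| ≤ B) (hB₁ : ∀ p, |C₁ p| ≤ B) (hB₂ : ∀ p, |C₂ p| ≤ B)
  (hB₃ : ∀ p, |C₃ p| ≤ B)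
  (hs₁ : ∀ p, |C₁ p - C p| ≤ s) (hs₂ : ∀ p, |C₂ p - C p| ≤ s) (hs₃ : ∀ p, |C₃ p - C p| ≤ s)
  (hε : ∀ p, |C₃ p - C₁ p - C₂ p + C p| ≤ ε)
  (S : Schrodinger γ μ ν C φ ψ) (S₁ : Schrodinger γ μ ν C₁ φ₁ ψ₁)
  (S₂ : Schrodinger γ μ ν C₂ φ₂ ψ₂) (S₃ : Schrodinger γ μ ν C₃ φ₃ ψ₃)

-- Three Taylor expansions at the same base point `C - ψ` are combined with signs. The linear terms
-- form second differences, that of the cost being at most `ε`, and the three remainders are `2 (s +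
-- t)² / γ` each.
include hγ hC hC₁ hC₂ hC₃ hs₁ hs₂ hs₃ hε S S₁ S₂ S₃ in
omit [IsProbabilityMeasure μ] in
theorem second_difference_linear {t : ℝ} (ht₁ : ∀ j, |ψ₁ j - ψ j| ≤ t)
    (ht₂ : ∀ j, |ψ₂ j - ψ j| ≤ t) (ht₃ : ∀ j, |ψ₃ j - ψ j| ≤ t) (i : I) :
    |(φ₃ i - φ₁ i - φ₂ i + φ i) + gibbsMean γ ν (fun j => C (i, j) - ψ j)
      (fun j => ψ₃ j - ψ₁ j - ψ₂ j + ψ j)| ≤ ε + 6 * (s + t) ^ 2 / γ := by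
  have e1 := abs_le.1 (left_taylor hγ hC hC₁ hs₁ S S₁ ht₁ i)
  have e2 := abs_le.1 (left_taylor hγ hC hC₂ hs₂ S S₂ ht₂ i)
  have e3 := abs_le.1 (left_taylor hγ hC hC₃ hs₃ S S₃ ht₃ i)
  have hb := bddMeas_right hC S i
  have m : ∀ {D : I × J → ℝ}, BddMeas D → BddMeas fun j => D (i, j) :=
    fun hD => hD.comp measurable_prodMk_left
  rw [gibbsMean_sub hb ((m hC₁).sub (m hC)) (S₁.right.sub S.right), gibbsMean_sub hb (m hC₁) (m hC),
    gibbsMean_sub hb S₁.right S.right] at e1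
  rw [gibbsMean_sub hb ((m hC₂).sub (m hC)) (S₂.right.sub S.right), gibbsMean_sub hb (m hC₂) (m hC),
    gibbsMean_sub hb S₂.right S.right] at e2
  rw [gibbsMean_sub hb ((m hC₃).sub (m hC)) (S₃.right.sub S.right), gibbsMean_sub hb (m hC₃) (m hC),
    gibbsMean_sub hb S₃.right S.right] at e3
  have e4 := abs_le.1 (abs_gibbsMean_le (γ := γ) (ρ := ν) hb
    ((((m hC₃).sub (m hC₁)).sub (m hC₂)).add (m hC)) fun j => hε (i, j))
  rw [gibbsMean_add hb (((m hC₃).sub (m hC₁)).sub (m hC₂)) (m hC),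
    gibbsMean_sub hb ((m hC₃).sub (m hC₁)) (m hC₂), gibbsMean_sub hb (m hC₃) (m hC₁)] at e4
  rw [gibbsMean_add hb ((S₃.right.sub S₁.right).sub S₂.right) S.right,
    gibbsMean_sub hb (S₃.right.sub S₁.right) S₂.right, gibbsMean_sub hb S₃.right S₁.right]
  have e5 : 6 * (s + t) ^ 2 / γ = 3 * (2 * (s + t) ^ 2 / γ) := by ring
  rw [e5]
  exact abs_le.2 ⟨by linarith, by linarith⟩

omit [IsProbabilityMeasure μ] in
theorem oscillation_linear_step {R : I → ℝ} {Q : J → ℝ} {τ M : ℝ} (hγ : 0 < γ) (hC : BddMeas C)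
    (hB : ∀ p, |C p| ≤ B) (S : Schrodinger γ μ ν C φ ψ) (hQ : BddMeas Q)
    (h : ∀ i, |R i + gibbsMean γ ν (fun j => C (i, j) - ψ j) Q| ≤ τ)
    (hM : ∀ j j', |Q j - Q j'| ≤ M) (i i' : I) :
    |R i - R i'| ≤ (1 - Real.exp (-2 * (2 * B) / γ)) * M + 2 * τ := by
  have h1 := abs_le.1 (abs_gibbsMean_sub_le (ρ := ν) hγ (bddMeas_right hC S i)
    (bddMeas_right hC S i') hQ (D := 2 * B) (fun j => by
      rw [sub_sub_sub_cancel_right]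
      refine (abs_sub _ _).trans ?_
      linarith [hB (i, j), hB (i', j)]) hM)
  have h2 := abs_le.1 (h i)
  have h3 := abs_le.1 (h i')
  exact abs_le.2 ⟨by linarith, by linarith⟩

theorem oscillation_linear {R : I → ℝ} {Q : J → ℝ} {τ : ℝ} (hγ : 0 < γ) (hC : BddMeas C)
    (hB : ∀ p, |C p| ≤ B) (S : Schrodinger γ μ ν C φ ψ) (hR : BddMeas R) (hQ : BddMeas Q)
    (h : ∀ i, |R i + gibbsMean γ ν (fun j => C (i, j) - ψ j) Q| ≤ τ)
    (h' : ∀ j, |Q j + gibbsMean γ μ (fun i => C (i, j) - φ i) R| ≤ τ) (i i' : I) :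
    |R i - R i'| ≤ 4 * τ / Real.exp (-2 * (2 * B) / γ) := by
  obtain ⟨j₀⟩ := ν.nonempty_of_neZero
  have hκ := Real.exp_pos (-2 * (2 * B) / γ)
  have hτ0 : 0 ≤ τ := (abs_nonneg _).trans (h i)
  have hB0 : 0 ≤ B := (abs_nonneg _).trans (hB (i, j₀))
  have hκ1 : Real.exp (-2 * (2 * B) / γ) ≤ 1 := by
    rw [Real.exp_le_one_iff]
    exact div_nonpos_of_nonpos_of_nonneg (by linarith) hγ.le
  have := oscillation_le (R := R) hR.bdd
    (q := 1 - Real.exp (-2 * (2 * B) / γ)) (e := 4 * τ) (by linarith) (fun M hM i i' => ?_) i i'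
  · simpa using this
  · have hM0 : 0 ≤ M := (abs_nonneg _).trans (hM i i')
    have step := oscillation_linear_step hγ (hC.comp measurable_swap) (fun p => hB p.swap) S.swap
      hR h' hM
    have := oscillation_linear_step hγ hC hB S hQ h step i i'
    have h3 := mul_le_mul_of_nonneg_right hκ1 hM0
    have h4 := mul_nonneg hκ.le hτ0
    nlinarith [mul_nonneg hκ.le (mul_nonneg (sub_nonneg.2 hκ1) hM0)]

/-- Quantitative invertibility of the linearized system on normalized pairs, by the argument of the
nonlinear Lipschitz bound: contraction controls the oscillation and `R i₀ = 0` fixes the constant.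
-/
theorem abs_le_of_linear {R : I → ℝ} {Q : J → ℝ} {τ : ℝ} (hγ : 0 < γ) (hC : BddMeas C)
    (hB : ∀ p, |C p| ≤ B) (S : Schrodinger γ μ ν C φ ψ) (hR : BddMeas R) (hQ : BddMeas Q)
    (h : ∀ i, |R i + gibbsMean γ ν (fun j => C (i, j) - ψ j) Q| ≤ τ)
    (h' : ∀ j, |Q j + gibbsMean γ μ (fun i => C (i, j) - φ i) R| ≤ τ) {i₀ : I} (h0 : R i₀ = 0) :
    (∀ i, |R i| ≤ lipConst γ B * τ) ∧ ∀ j, |Q j| ≤ lipConst γ B * τ := by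
  have hτ0 : 0 ≤ τ := (abs_nonneg _).trans (h i₀)
  have hosc := oscillation_linear hγ (hC.comp measurable_swap) (fun p => hB p.swap) S.swap
      hQ hR h' h
  have e : lipConst γ B * τ = τ + (τ + 4 * τ / Real.exp (-2 * (2 * B) / γ)) := by
    unfold lipConst
    ring
  have hi := h i₀
  rw [h0, zero_add] at hi
  have hi := abs_le.1 hi
  have h1 : ∀ j, |Q j| ≤ τ + 4 * τ / Real.exp (-2 * (2 * B) / γ) := fun j => by
    have hb := bddMeas_right hC S i₀
    have g1 := gibbsMean_mono (γ := γ) (ρ := ν) hb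
      (BddMeas.const (Q j - 4 * τ / Real.exp (-2 * (2 * B) / γ))) hQ
      (fun j' => by linarith [(abs_le.1 (hosc j j')).2])
    have g2 := gibbsMean_mono (γ := γ) (ρ := ν) hb hQ
      (BddMeas.const (Q j + 4 * τ / Real.exp (-2 * (2 * B) / γ)))
      (fun j' => by linarith [(abs_le.1 (hosc j j')).1])
    rw [gibbsMean_const hb] at g1 g2
    exact abs_le.2 ⟨by linarith, by linarith⟩
  refine ⟨fun i => ?_, fun j => by rw [e]; linarith [h1 j]⟩
  have g := abs_le.1 (abs_gibbsMean_le (γ := γ) (ρ := ν) (bddMeas_right hC S i) hQ h1)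
  have := abs_le.1 (h i)
  rw [e]
  exact abs_le.2 ⟨by linarith, by linarith⟩

-- With `s` of first order and `ε` of second order in the parameter, the bound is of second order.
-- The pair of second differences solves the linearized system with error `τ = ε + 6 (s + L s)² /
-- γ`, where `L s` is the Lipschitz bound on the potentials.
include hγ hC hC₁ hC₂ hC₃ hB hB₁ hB₂ hB₃ hs₁ hs₂ hs₃ hε S S₁ S₂ S₃ in
theorem abs_second_difference_le {i₀ : I} (h0 : φ i₀ = 0) (h0₁ : φ₁ i₀ = 0) (h0₂ : φ₂ i₀ = 0)
    (h0₃ : φ₃ i₀ = 0) :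
    (∀ i, |φ₃ i - φ₁ i - φ₂ i + φ i|
      ≤ lipConst γ B * (ε + 6 * (s + lipConst γ B * s) ^ 2 / γ)) ∧
    ∀ j, |ψ₃ j - ψ₁ j - ψ₂ j + ψ j|
      ≤ lipConst γ B * (ε + 6 * (s + lipConst γ B * s) ^ 2 / γ) := by
  obtain ⟨a1, b1⟩ := abs_sub_le hγ hC hC₁ hB hB₁ hs₁ S S₁ h0 h0₁
  obtain ⟨a2, b2⟩ := abs_sub_le hγ hC hC₂ hB hB₂ hs₂ S S₂ h0 h0₂
  obtain ⟨a3, b3⟩ := abs_sub_le hγ hC hC₃ hB hB₃ hs₃ S S₃ h0 h0₃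
  refine abs_le_of_linear hγ hC hB S (((S₃.left.sub S₁.left).sub S₂.left).add S.left)
    (((S₃.right.sub S₁.right).sub S₂.right).add S.right)
    (second_difference_linear hγ hC hC₁ hC₂ hC₃ hs₁ hs₂ hs₃ hε S S₁ S₂ S₃ b1 b2 b3)
    (second_difference_linear hγ (hC.comp measurable_swap) (hC₁.comp measurable_swap)
      (hC₂.comp measurable_swap) (hC₃.comp measurable_swap) (fun p => hs₁ p.swap)
      (fun p => hs₂ p.swap) (fun p => hs₃ p.swap) (fun p => hε p.swap) S.swap S₁.swap S₂.swap
      S₃.swap a1 a2 a3) (i₀ := i₀) ?_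
  simp [h0, h0₁, h0₂, h0₃]

end Additivity

end Schrodinger

end SiNG

namespace SiNG

/-! ### From quadratically small second differences to derivatives. -/

section ApproximatelyAdditive

variable {E V : Type*} [NormedAddCommGroup E] [NormedSpace ℝ E] [NormedAddCommGroup V]
  [NormedSpace ℝ V]

/-- A map that is Lipschitz at `0` and additive up to a quadratic error is differentiable
at `0`. -/
theorem exists_hasFDerivAt_of_additive [CompleteSpace V] {Q : E → V} {r K : ℝ} (hr : 0 < r)
    (hQ : ∀ h, ‖h‖ < r → ‖Q h‖ ≤ K * ‖h‖)
    (hadd : ∀ h k, ‖h‖ < r → ‖k‖ < r → ‖Q (h + k) - Q h - Q k‖ ≤ K * (‖h‖ + ‖k‖) ^ 2) :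
    ∃ D : E →L[ℝ] V, HasFDerivAt Q D 0 := by
  -- The derivative is sought as the limit of these dyadic difference quotients, as in the
  -- Hyers–Ulam theorem on approximately additive maps.
  let a : E → ℕ → V := fun h n => (2 : ℝ) ^ n • Q ((2⁻¹ : ℝ) ^ n • h)
  have hsmall : ∀ h : E, ∀ᶠ n : ℕ in atTop, ‖(2⁻¹ : ℝ) ^ n • h‖ < r := fun h => by
    have : Tendsto (fun n : ℕ => ‖(2⁻¹ : ℝ) ^ n • h‖) atTop (𝓝 0) := by
      have := ((tendsto_pow_atTop_nhds_zero_of_lt_one (r := (2⁻¹ : ℝ)) (by norm_num)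
        (by norm_num)).smul_const h).norm
      simpa using this
    exact this.eventually_lt_const hr
  have hnorm : ∀ (h : E) (n : ℕ), ‖(2⁻¹ : ℝ) ^ n • h‖ = (2⁻¹ : ℝ) ^ n * ‖h‖ := fun h n => by
    rw [norm_smul, Real.norm_of_nonneg (by positivity)]
  have hpow : ∀ n : ℕ, (2 : ℝ) ^ n * (2⁻¹ : ℝ) ^ n = 1 := fun n => by
    rw [← mul_pow]
    norm_num
  -- Near-additivity at two equal halves bounds consecutive terms by `K ‖h‖² / 2ⁿ`. The constant is
  -- written as `2 * K * ‖h‖ ^ 2 / 2` for the geometric-series lemmas, which then give `‖Q h - D h‖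
  -- ≤ 2 K ‖h‖²`.
  have hdist : ∀ h, ‖h‖ < r → ∀ n, dist (a h n) (a h (n + 1)) ≤ 2 * K * ‖h‖ ^ 2 / 2 / 2 ^ n := by
    intro h hh n
    have hn : ‖(2⁻¹ : ℝ) ^ (n + 1) • h‖ < r := by
      rw [hnorm]
      refine lt_of_le_of_lt ?_ hh
      exact mul_le_of_le_one_left (norm_nonneg _) (pow_le_one₀ (by norm_num) (by norm_num))
    have h1 := hadd _ _ hn hn
    have h2 : (2⁻¹ : ℝ) ^ (n + 1) • h + (2⁻¹ : ℝ) ^ (n + 1) • h = (2⁻¹ : ℝ) ^ n • h := by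
      rw [← add_smul, pow_succ]
      congr 1
      ring
    rw [h2, hnorm] at h1
    have h3 : a h n - a h (n + 1) = (2 : ℝ) ^ n • (Q ((2⁻¹ : ℝ) ^ n • h)
        - Q ((2⁻¹ : ℝ) ^ (n + 1) • h) - Q ((2⁻¹ : ℝ) ^ (n + 1) • h)) := by
      simp only [a, smul_sub, pow_succ]
      module
    rw [dist_eq_norm, h3, norm_smul, Real.norm_of_nonneg (by positivity)]
    calc _ ≤ (2 : ℝ) ^ n * (K * ((2⁻¹ : ℝ) ^ (n + 1) * ‖h‖ + (2⁻¹ : ℝ) ^ (n + 1) * ‖h‖) ^ 2) := by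
          gcongr
      _ = ((2 : ℝ) ^ n * (2⁻¹ : ℝ) ^ n) * (2⁻¹ : ℝ) ^ n * K * ‖h‖ ^ 2 := by
          rw [pow_succ]
          ring
      _ = _ := by
          rw [hpow, inv_pow]
          field_simp
  have hlim₀ : ∀ h, ‖h‖ < r → ∃ l, Tendsto (a h) atTop (𝓝 l) := fun h hh =>
    cauchySeq_tendsto_of_complete (cauchySeq_of_le_geometric_two (hdist h hh))
  -- For large `h`, the sequence is, after a shift of the index by `m`, `2 ^ m` times the one of the
  -- small vector `2⁻ᵐ h`.
  have hlim : ∀ h, ∃ l, Tendsto (a h) atTop (𝓝 l) := by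
    intro h
    obtain ⟨m, hm⟩ := (hsmall h).exists
    obtain ⟨l, hl⟩ := hlim₀ _ hm
    refine ⟨(2 : ℝ) ^ m • l, ?_⟩
    rw [← tendsto_add_atTop_iff_nat m]
    refine (hl.const_smul ((2 : ℝ) ^ m)).congr fun n => ?_
    simp only [a, smul_smul, pow_add]
    rw [mul_comm]
  choose D hD using hlim
  have hDadd : ∀ h k, D (h + k) = D h + D k := by
    intro h k
    have h1 : Tendsto (fun n => a (h + k) n - a h n - a k n) atTop (𝓝 (D (h + k) - D h - D k)) :=
      ((hD _).sub (hD _)).sub (hD _)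
    have h2 : Tendsto (fun n => a (h + k) n - a h n - a k n) atTop (𝓝 0) := by
      refine squeeze_zero_norm' (a := fun n : ℕ => K * (‖h‖ + ‖k‖) ^ 2 * (2⁻¹ : ℝ) ^ n) ?_ ?_
      · filter_upwards [hsmall h, hsmall k] with n hn kn
        have h3 := hadd _ _ hn kn
        rw [← smul_add, hnorm, hnorm] at h3
        simp only [a]
        rw [← smul_sub, ← smul_sub, norm_smul, Real.norm_of_nonneg (by positivity)]
        calc _ ≤ (2 : ℝ) ^ n * (K * ((2⁻¹ : ℝ) ^ n * ‖h‖ + (2⁻¹ : ℝ) ^ n * ‖k‖) ^ 2) := by gcongr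
          _ = ((2 : ℝ) ^ n * (2⁻¹ : ℝ) ^ n) * (K * (‖h‖ + ‖k‖) ^ 2 * (2⁻¹ : ℝ) ^ n) := by ring
          _ = _ := by rw [hpow, one_mul]
      · simpa using (tendsto_pow_atTop_nhds_zero_of_lt_one (r := (2⁻¹ : ℝ)) (by norm_num)
          (by norm_num)).const_mul (K * (‖h‖ + ‖k‖) ^ 2)
    have := tendsto_nhds_unique h1 h2
    rw [sub_sub, sub_eq_zero] at this
    exact this
  have hDbd : ∀ h, ‖D h‖ ≤ K * ‖h‖ := by
    intro h
    refine le_of_tendsto (hD h).norm ?_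
    filter_upwards [hsmall h] with n hn
    have := hQ _ hn
    rw [hnorm] at this
    simp only [a]
    rw [norm_smul, Real.norm_of_nonneg (by positivity)]
    calc _ ≤ (2 : ℝ) ^ n * (K * ((2⁻¹ : ℝ) ^ n * ‖h‖)) := by gcongr
      _ = ((2 : ℝ) ^ n * (2⁻¹ : ℝ) ^ n) * (K * ‖h‖) := by ring
      _ = _ := by rw [hpow, one_mul]
  let D₀ : E →+ V := AddMonoidHom.mk' D hDadd
  have hcont : Continuous D₀ := AddMonoidHomClass.continuous_of_bound D₀ K hDbd
  refine ⟨D₀.toRealLinearMap hcont, ?_⟩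
  have hQ0 : Q 0 = 0 := by
    have := hQ 0 (by simpa using hr)
    simpa using this
  have h1 : HasFDerivAt (fun h => Q h - D₀.toRealLinearMap hcont h) (0 : E →L[ℝ] V) 0 := by
    refine Asymptotics.IsBigO.hasFDerivAt (n := 2) (Asymptotics.IsBigO.of_bound (2 * K) ?_)
      one_lt_two
    filter_upwards [Metric.ball_mem_nhds (0 : E) hr] with h hh
    rw [mem_ball_zero_iff] at hh
    have := dist_le_of_le_geometric_two_of_tendsto₀ (hdist h hh) (hD h)
    simp only [sub_zero, norm_pow, norm_norm]
    rw [dist_eq_norm] at this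
    simpa [a, D₀] using this
  have h2 := h1.add (D₀.toRealLinearMap hcont).hasFDerivAt
  rw [zero_add] at h2
  exact h2.congr_of_eventuallyEq (Eventually.of_forall fun h => by simp)

theorem exists_hasFDerivAt_of_second_difference [CompleteSpace V] {Q : E → V} {θ : E} {r K : ℝ}
    (hr : 0 < r) (hQ : ∀ h, ‖h‖ < r → ‖Q (θ + h) - Q θ‖ ≤ K * ‖h‖)
    (hadd : ∀ h k, ‖h‖ < r → ‖k‖ < r →
      ‖Q (θ + (h + k)) - Q (θ + h) - Q (θ + k) + Q θ‖ ≤ K * (‖h‖ + ‖k‖) ^ 2) :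
    ∃ D : E →L[ℝ] V, HasFDerivAt Q D θ := by
  obtain ⟨D, hD⟩ := exists_hasFDerivAt_of_additive (Q := fun h => Q (θ + h) - Q θ) hr hQ
    fun h k hh hk => by
      have e : Q (θ + (h + k)) - Q θ - (Q (θ + h) - Q θ) - (Q (θ + k) - Q θ)
        = Q (θ + (h + k)) - Q (θ + h) - Q (θ + k) + Q θ := by abel
      rw [e]
      exact hadd h k hh hk
  refine ⟨D, ?_⟩
  rw [hasFDerivAt_iff_isLittleO_nhds_zero] at hD ⊢
  simpa using hD

end ApproximatelyAdditive

section SecondDifference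

variable {E Y : Type*} [NormedAddCommGroup E] [NormedSpace ℝ E] [MeasurableSpace Y] {Θ : Set E}
  {Ψ : E → Y → ℝ} {Ψ' : E → Y → E →L[ℝ] ℝ} {Ψ'' : E → Y → E →L[ℝ] E →L[ℝ] ℝ}

/-- On a small ball, a twice differentiable family is bounded, Lipschitz, and has second
differences of second order. -/
theorem DiffFamily.exists_ball (h : DiffFamily Θ Ψ Ψ') (h' : DiffFamily Θ Ψ' Ψ'') {θ₀ : E}
    (hθ₀ : θ₀ ∈ Θ) :
    ∃ r > 0, ∃ K ≥ 0, Metric.ball θ₀ r ⊆ Θ ∧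
      (∀ θ ∈ Metric.ball θ₀ r, ∀ y, |Ψ θ y| ≤ K) ∧
      (∀ θ ∈ Metric.ball θ₀ r, ∀ θ' ∈ Metric.ball θ₀ r, ∀ y, |Ψ θ' y - Ψ θ y| ≤ K * ‖θ' - θ‖) ∧
      ∀ u v, u ∈ Metric.ball 0 (r / 2) → v ∈ Metric.ball 0 (r / 2) → ∀ y,
        |Ψ (θ₀ + (u + v)) y - Ψ (θ₀ + u) y - Ψ (θ₀ + v) y + Ψ θ₀ y| ≤ K * ‖u‖ * ‖v‖ := by
  obtain ⟨K₁, hK₁⟩ := h.bdd θ₀ hθ₀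
  obtain ⟨K₂, hK₂⟩ := h'.bdd θ₀ hθ₀
  obtain ⟨r, hr, hball⟩ := Metric.eventually_nhds_iff_ball.1
    ((hK₁.and hK₂).and (h.isOpen.mem_nhds hθ₀))
  have hK : 0 ≤ max (max K₁ K₂) 0 := le_max_right _ _
  have k1 : K₁ ≤ max (max K₁ K₂) 0 := (le_max_left _ _).trans (le_max_left _ _)
  have k2 : K₂ ≤ max (max K₁ K₂) 0 := (le_max_right _ _).trans (le_max_left _ _)
  refine ⟨r, hr, max (max K₁ K₂) 0, hK, fun θ hθ => (hball θ hθ).2, ?_, ?_, ?_⟩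
  · exact fun θ hθ y => (((hball θ hθ).1.1 y).1).trans k1
  · intro θ hθ θ' hθ' y
    exact (convex_ball θ₀ r).norm_image_sub_le_of_norm_hasFDerivWithin_le
      (fun x hx => (h.deriv x (hball x hx).2 y).hasFDerivWithinAt)
      (fun x hx => (((hball x hx).1.1 y).2).trans k1) hθ hθ'
  · intro u v hu hv y
    have hmem : ∀ w ∈ Metric.ball (0 : E) (r / 2), θ₀ + w ∈ Metric.ball θ₀ r ∧
        θ₀ + (u + w) ∈ Metric.ball θ₀ r := fun w hw => by
      rw [mem_ball_zero_iff] at hu hw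
      simp only [mem_ball_iff_norm, add_sub_cancel_left]
      exact ⟨by linarith, (norm_add_le _ _).trans_lt (by linarith)⟩
    -- The mean value inequality is used twice: in `w`, for the increment of `Ψ` under the shift
    -- `u`, and for `Ψ'` between `θ₀ + w` and `θ₀ + (u + w)`. The radius `r / 2` keeps both points
    -- in the ball.
    have hd : ∀ c, θ₀ + c ∈ Θ → HasFDerivAt (fun w => Ψ (θ₀ + w) y) (Ψ' (θ₀ + c) y) c :=
      fun c hc => (hasFDerivAt_comp_add_left θ₀).2 (h.deriv _ hc y)
    have hd' : ∀ w ∈ Metric.ball (0 : E) (r / 2), HasFDerivAt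
        (fun w => Ψ (θ₀ + (u + w)) y - Ψ (θ₀ + w) y) (Ψ' (θ₀ + (u + w)) y - Ψ' (θ₀ + w) y) w :=
      fun w hw => ((hasFDerivAt_comp_add_left u).2 (hd _ (hball _ (hmem w hw).2).2)).sub
        (hd _ (hball _ (hmem w hw).1).2)
    have := (convex_ball (0 : E) (r / 2)).norm_image_sub_le_of_norm_hasFDerivWithin_le
      (C := max (max K₁ K₂) 0 * ‖u‖) (fun w hw => (hd' w hw).hasFDerivWithinAt) (fun w hw => ?_)
      (Metric.mem_ball_self (by positivity)) hv
    · simp only [add_zero, sub_zero, Real.norm_eq_abs] at this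
      convert this using 2
      ring
    · have := (convex_ball θ₀ r).norm_image_sub_le_of_norm_hasFDerivWithin_le
        (fun x hx => (h'.deriv x (hball x hx).2 y).hasFDerivWithinAt)
        (fun x hx => (((hball x hx).1.2 y).2).trans k2) (hmem w hw).1 (hmem w hw).2
      convert this using 3
      abel

end SecondDifference

section SchrodingerFamily

variable {E I J : Type*} [NormedAddCommGroup E] [NormedSpace ℝ E] [MeasurableSpace I]
  [MeasurableSpace J] {γ : ℝ} {μ : Measure I} {ν : Measure J} [IsProbabilityMeasure μ]
  [IsProbabilityMeasure ν] {Θ : Set E} {C : E → I × J → ℝ} {C' : E → I × J → E →L[ℝ] ℝ}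
  {C'' : E → I × J → E →L[ℝ] E →L[ℝ] ℝ} {φ : E → I → ℝ} {ψ : E → J → ℝ}

/-- The stability bounds with `s = B (‖u‖ + ‖v‖)` and `ε = B (‖u‖ + ‖v‖)²`, where `B` bounds the
cost, its Lipschitz constant and its second differences near `θ₀`. Uniformity in `i` and `j` is what
later yields derivatives in sup norm. -/
theorem Schrodinger.exists_ball (hγ : 0 < γ) (hC : DiffFamily Θ C C') (hC' : DiffFamily Θ C' C'')
    (S : ∀ θ ∈ Θ, Schrodinger γ μ ν (C θ) (φ θ) (ψ θ)) {i₀ : I} (h0 : ∀ θ ∈ Θ, φ θ i₀ = 0)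
    {θ₀ : E} (hθ₀ : θ₀ ∈ Θ) :
    ∃ r > 0, ∃ K ≥ 0, Metric.ball θ₀ r ⊆ Θ ∧
      (∀ θ ∈ Metric.ball θ₀ r, ∀ θ' ∈ Metric.ball θ₀ r,
        (∀ i, |φ θ' i - φ θ i| ≤ K * ‖θ' - θ‖) ∧ ∀ j, |ψ θ' j - ψ θ j| ≤ K * ‖θ' - θ‖) ∧
      ∀ u v, ‖u‖ < r → ‖v‖ < r →
        (∀ i, |φ (θ₀ + (u + v)) i - φ (θ₀ + u) i - φ (θ₀ + v) i + φ θ₀ i|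
          ≤ K * (‖u‖ + ‖v‖) ^ 2) ∧
        ∀ j, |ψ (θ₀ + (u + v)) j - ψ (θ₀ + u) j - ψ (θ₀ + v) j + ψ θ₀ j|
          ≤ K * (‖u‖ + ‖v‖) ^ 2 := by
  obtain ⟨r, hr, B, hB0, hΘ, hB, hlip, hsec⟩ := hC.exists_ball hC' hθ₀
  have hBM : ∀ θ ∈ Metric.ball θ₀ r, BddMeas (C θ) := fun θ hθ =>
    ⟨hC.meas θ (hΘ hθ), B, hB θ hθ⟩
  set L := Schrodinger.lipConst γ B with hL
  have hL0 : 0 < L := Schrodinger.lipConst_pos γ B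
  set K := max (L * B) (L * (B + 6 * (B + L * B) ^ 2 / γ))
  refine ⟨r / 2, by positivity, K, (by positivity : 0 ≤ L * B).trans (le_max_left _ _),
    (Metric.ball_subset_ball (by linarith)).trans hΘ, ?_, ?_⟩
  · intro θ hθ θ' hθ'
    have hθ := Metric.ball_subset_ball (by linarith : r / 2 ≤ r) hθ
    have hθ' := Metric.ball_subset_ball (by linarith : r / 2 ≤ r) hθ'
    obtain ⟨a, b⟩ := Schrodinger.abs_sub_le hγ (hBM θ hθ) (hBM θ' hθ') (hB θ hθ) (hB θ' hθ')
      (hlip θ hθ θ' hθ') (S θ (hΘ hθ)) (S θ' (hΘ hθ')) (h0 θ (hΘ hθ)) (h0 θ' (hΘ hθ'))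
    have e : L * (B * ‖θ' - θ‖) ≤ K * ‖θ' - θ‖ := by
      rw [← mul_assoc]
      gcongr
      exact le_max_left _ _
    exact ⟨fun i => (a i).trans e, fun j => (b j).trans e⟩
  · intro u v hu hv
    have m0 : θ₀ ∈ Metric.ball θ₀ r := Metric.mem_ball_self hr
    have m : ∀ w : E, ‖w‖ < r → θ₀ + w ∈ Metric.ball θ₀ r := fun w hw => by simpa using hw
    have mu := m u (by linarith)
    have mv := m v (by linarith)
    have mw := m (u + v) ((norm_add_le _ _).trans_lt (by linarith))
    have hn := norm_add_le u v
    have nu := norm_nonneg u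
    have nv := norm_nonneg v
    have hs : ∀ w : E, ‖w‖ ≤ ‖u‖ + ‖v‖ → θ₀ + w ∈ Metric.ball θ₀ r → ∀ p,
        |C (θ₀ + w) p - C θ₀ p| ≤ B * (‖u‖ + ‖v‖) := fun w hw mw p => by
      refine (hlip θ₀ m0 _ mw p).trans ?_
      rw [add_sub_cancel_left]
      gcongr
    have hε : ∀ p, |C (θ₀ + (u + v)) p - C (θ₀ + u) p - C (θ₀ + v) p + C θ₀ p|
        ≤ B * (‖u‖ + ‖v‖) ^ 2 := fun p => by
      refine (hsec u v (by simpa using hu) (by simpa using hv) p).trans ?_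
      rw [mul_assoc]
      gcongr
      nlinarith
    obtain ⟨a, b⟩ := Schrodinger.abs_second_difference_le hγ (hBM _ m0) (hBM _ mu) (hBM _ mv)
      (hBM _ mw) (hB _ m0) (hB _ mu) (hB _ mv) (hB _ mw) (hs u (by linarith) mu)
      (hs v (by linarith) mv) (hs (u + v) hn mw) hε (S _ (hΘ m0)) (S _ (hΘ mu)) (S _ (hΘ mv))
      (S _ (hΘ mw)) (h0 _ (hΘ m0)) (h0 _ (hΘ mu)) (h0 _ (hΘ mv)) (h0 _ (hΘ mw))
    have e : L * (B * (‖u‖ + ‖v‖) ^ 2 + 6 * (B * (‖u‖ + ‖v‖) + L * (B * (‖u‖ + ‖v‖))) ^ 2 / γ)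
        ≤ K * (‖u‖ + ‖v‖) ^ 2 := by
      have : L * (B * (‖u‖ + ‖v‖) ^ 2 + 6 * (B * (‖u‖ + ‖v‖) + L * (B * (‖u‖ + ‖v‖))) ^ 2 / γ)
          = L * (B + 6 * (B + L * B) ^ 2 / γ) * (‖u‖ + ‖v‖) ^ 2 := by
        field_simp
      rw [this]
      gcongr
      exact le_max_right _ _
    exact ⟨fun i => (a i).trans e, fun j => (b j).trans e⟩

/-- Functions with uniformly small second differences form a differentiable family. -/
theorem DiffFamily.of_second_difference {Y : Type*} [MeasurableSpace Y] (hΘ : IsOpen Θ)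
    {χ : E → Y → ℝ} (hm : ∀ θ ∈ Θ, BddMeas (χ θ))
    (h : ∀ θ₀ ∈ Θ, ∃ r > 0, ∃ K ≥ 0, Metric.ball θ₀ r ⊆ Θ ∧
      (∀ θ ∈ Metric.ball θ₀ r, ∀ θ' ∈ Metric.ball θ₀ r, ∀ i, |χ θ' i - χ θ i| ≤ K * ‖θ' - θ‖) ∧
      ∀ u v, ‖u‖ < r → ‖v‖ < r → ∀ i,
        |χ (θ₀ + (u + v)) i - χ (θ₀ + u) i - χ (θ₀ + v) i + χ θ₀ i| ≤ K * (‖u‖ + ‖v‖) ^ 2) :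
    ∃ χ', DiffFamily Θ χ χ' := by
  have hd : ∀ θ y, θ ∈ Θ → DifferentiableAt ℝ (fun θ' => χ θ' y) θ := by
    intro θ y hθ
    obtain ⟨r, hr, K, hK, -, h1, h2⟩ := h θ hθ
    obtain ⟨D, hD⟩ := exists_hasFDerivAt_of_second_difference (Q := fun θ' => χ θ' y) (θ := θ)
      (K := K) hr (fun u hu => by
        have := h1 θ (Metric.mem_ball_self hr) (θ + u) (by simpa using hu) y
        rwa [add_sub_cancel_left] at this) (fun u v hu hv => h2 u v hu hv y)
    exact hD.differentiableAt
  refine ⟨fun θ y => fderiv ℝ (fun θ' => χ θ' y) θ, hΘ, fun θ hθ => (hm θ hθ).meas,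
    fun θ hθ y => (hd θ y hθ).hasFDerivAt, fun θ₀ hθ₀ => ?_⟩
  obtain ⟨r, hr, K, hK, hΘ, h1, -⟩ := h θ₀ hθ₀
  obtain ⟨B, hB⟩ := (hm θ₀ hθ₀).bdd
  refine ⟨max (B + K * r) K, ?_⟩
  filter_upwards [Metric.ball_mem_nhds θ₀ hr] with θ hθ y
  constructor
  · refine le_trans ?_ (le_max_left _ _)
    have e := h1 θ₀ (Metric.mem_ball_self hr) θ hθ y
    rw [mem_ball_iff_norm] at hθ
    have e' : K * ‖θ - θ₀‖ ≤ K * r := by gcongr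
    rw [Real.norm_eq_abs]
    have := abs_sub_abs_le_abs_sub (χ θ y) (χ θ₀ y)
    linarith [hB y]
  · refine le_trans ?_ (le_max_right _ _)
    -- The Lipschitz constant, uniform in `y`, bounds the derivative.
    refine (hd θ y (hΘ hθ)).hasFDerivAt.le_of_lip' hK ?_
    filter_upwards [Metric.isOpen_ball.mem_nhds hθ] with θ' hθ'
    exact h1 θ hθ θ' hθ' y

/-- Normalized solutions of a twice differentiable family of Schrödinger systems are
differentiable families. -/
theorem Schrodinger.exists_diffFamily (hγ : 0 < γ) (hC : DiffFamily Θ C C')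
    (hC' : DiffFamily Θ C' C'') (S : ∀ θ ∈ Θ, Schrodinger γ μ ν (C θ) (φ θ) (ψ θ)) {i₀ : I}
    (h0 : ∀ θ ∈ Θ, φ θ i₀ = 0) :
    (∃ φ', DiffFamily Θ φ φ') ∧ ∃ ψ', DiffFamily Θ ψ ψ' := by
  constructor
  · refine DiffFamily.of_second_difference hC.isOpen (fun θ hθ => (S θ hθ).left) fun θ₀ hθ₀ => ?_
    obtain ⟨r, hr, K, hK, hΘ, h1, h2⟩ := Schrodinger.exists_ball hγ hC hC' S h0 hθ₀
    exact ⟨r, hr, K, hK, hΘ, fun θ hθ θ' hθ' => (h1 θ hθ θ' hθ').1,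
      fun u v hu hv => (h2 u v hu hv).1⟩
  · refine DiffFamily.of_second_difference hC.isOpen (fun θ hθ => (S θ hθ).right) fun θ₀ hθ₀ => ?_
    obtain ⟨r, hr, K, hK, hΘ, h1, h2⟩ := Schrodinger.exists_ball hγ hC hC' S h0 hθ₀
    exact ⟨r, hr, K, hK, hΘ, fun θ hθ θ' hθ' => (h1 θ hθ θ' hθ').2,
      fun u v hu hv => (h2 u v hu hv).2⟩

end SchrodingerFamily

end SiNG

namespace SiNG

/-! ### The optimal plan and the first two derivatives of the optimal value. -/

section DualValue

variable {E I J : Type*} [NormedAddCommGroup E] [NormedSpace ℝ E] [FiniteDimensional ℝ E]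
  [MeasurableSpace I] [MeasurableSpace J] {γ : ℝ} {μ : Measure I} {ν : Measure J}
  [IsProbabilityMeasure μ] [IsProbabilityMeasure ν] {Θ : Set E} {C : E → I × J → ℝ}
  {C' : E → I × J → E →L[ℝ] ℝ} {C'' : E → I × J → E →L[ℝ] E →L[ℝ] ℝ}
  {φ : E → I → ℝ} {ψ : E → J → ℝ} {φ' : E → I → E →L[ℝ] ℝ} {ψ' : E → J → E →L[ℝ] ℝ}

omit [FiniteDimensional ℝ E] in
theorem DiffFamily.bddMeas {Y : Type*} [MeasurableSpace Y] {Ψ : E → Y → ℝ}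
    {Ψ' : E → Y → E →L[ℝ] ℝ} (h : DiffFamily Θ Ψ Ψ') {θ : E} (hθ : θ ∈ Θ) : BddMeas (Ψ θ) := by
  obtain ⟨K, hK⟩ := h.exists_bound hθ
  exact ⟨h.meas θ hθ, K, fun y => (hK y).1⟩

theorem DiffFamily.bddMeas_deriv {Y : Type*} [MeasurableSpace Y] {Ψ : E → Y → ℝ}
    {Ψ' : E → Y → E →L[ℝ] ℝ} (h : DiffFamily Θ Ψ Ψ') {θ : E} (hθ : θ ∈ Θ) (v : E) :
    BddMeas fun y => Ψ' θ y v := by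
  obtain ⟨K, hK⟩ := h.exists_bound hθ
  refine ⟨(ContinuousLinearMap.apply ℝ ℝ v).continuous.comp_stronglyMeasurable (h.meas_deriv hθ), K * ‖v‖, fun y => ?_⟩
  exact ((Ψ' θ y).le_opNorm v).trans (by gcongr; exact (hK y).2)

theorem DiffFamily.bddMeas_deriv₂ {Y : Type*} [MeasurableSpace Y] {Ψ : E → Y → E →L[ℝ] ℝ}
    {Ψ' : E → Y → E →L[ℝ] E →L[ℝ] ℝ} (h : DiffFamily Θ Ψ Ψ') {θ : E} (hθ : θ ∈ Θ) (v w : E) :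
    BddMeas fun y => Ψ' θ y v w := by
  obtain ⟨K, hK⟩ := h.exists_bound hθ
  refine ⟨(ContinuousLinearMap.apply ℝ ℝ w).continuous.comp_stronglyMeasurable
    ((ContinuousLinearMap.apply ℝ (E →L[ℝ] ℝ) v).continuous.comp_stronglyMeasurable
      (h.meas_deriv hθ)),
    K * ‖v‖ * ‖w‖, fun y => ?_⟩
  exact ((Ψ' θ y).le_opNorm₂ v w).trans (by gcongr; exact (hK y).2)

/-- The density of the optimal plan. -/
noncomputable def planDensity (γ : ℝ) (C : I × J → ℝ) (φ : I → ℝ) (ψ : J → ℝ) (p : I × J) : ℝ :=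
  Real.exp (-(C p - φ p.1 - ψ p.2) / γ)

omit [IsProbabilityMeasure μ] [IsProbabilityMeasure ν] in
theorem Schrodinger.bddMeas_left {C : I × J → ℝ} {φ : I → ℝ} {ψ : J → ℝ} (hC : BddMeas C)
    (S : Schrodinger γ μ ν C φ ψ) (j : J) : BddMeas fun i => C (i, j) - φ i :=
  (hC.comp measurable_prodMk_right).sub S.left

omit [IsProbabilityMeasure μ] [IsProbabilityMeasure ν] in
theorem Schrodinger.bddMeas_planDensity {C : I × J → ℝ} {φ : I → ℝ} {ψ : J → ℝ} (hC : BddMeas C)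
    (S : Schrodinger γ μ ν C φ ψ) : BddMeas (planDensity γ C φ ψ) :=
  ((hC.sub (S.left.comp measurable_fst)).sub (S.right.comp measurable_snd)).gibbs γ

omit [IsProbabilityMeasure μ] in
theorem Schrodinger.integral_planDensity_right {C : I × J → ℝ} {φ : I → ℝ} {ψ : J → ℝ}
    (hγ : 0 < γ) (hC : BddMeas C) (S : Schrodinger γ μ ν C φ ψ) (i : I) :
    ∫ j, planDensity γ C φ ψ (i, j) ∂ν = 1 := by
  rw [← integral_exp_softmin (ρ := ν) hγ (bddMeas_right hC S i), ← S.left_eq]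
  congr 1
  funext j
  simp only [planDensity]
  congr 2
  ring

omit [IsProbabilityMeasure ν] in
theorem Schrodinger.gibbsMean_eq {C : I × J → ℝ} {φ : I → ℝ} {ψ : J → ℝ} (hγ : 0 < γ)
    (hC : BddMeas C) (S : Schrodinger γ μ ν C φ ψ) (j : J) (u : I → ℝ) :
    gibbsMean γ μ (fun i => C (i, j) - φ i) u = ∫ i, planDensity γ C φ ψ (i, j) * u i ∂μ := by
  rw [SiNG.gibbsMean_eq hγ (bddMeas_left hC S j), ← S.right_eq]
  congr 1
  funext i
  simp only [planDensity]
  congr 2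
  ring

omit [FiniteDimensional ℝ E] [IsProbabilityMeasure μ] [IsProbabilityMeasure ν] in
theorem DiffFamily.planDensity (hC : DiffFamily Θ C C') (hφ : DiffFamily Θ φ φ')
    (hψ : DiffFamily Θ ψ ψ') (γ : ℝ) :
    DiffFamily Θ (fun θ p => SiNG.planDensity γ (C θ) (φ θ) (ψ θ) p)
      (fun θ p => (-γ⁻¹ * SiNG.planDensity γ (C θ) (φ θ) (ψ θ) p) •
        (C' θ p - φ' θ p.1 - ψ' θ p.2)) :=
  ((hC.sub (hφ.comp_measurable measurable_fst)).sub (hψ.comp_measurable measurable_snd)).gibbs γ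

section Marginals

variable (hγ : 0 < γ) (hC : DiffFamily Θ C C') (hφ : DiffFamily Θ φ φ') (hψ : DiffFamily Θ ψ ψ')
  (S : ∀ θ ∈ Θ, Schrodinger γ μ ν (C θ) (φ θ) (ψ θ)) {θ : E} (hθ : θ ∈ Θ)

include hC hφ hψ hθ in
theorem bddMeas_reduced (v : E) : BddMeas fun p => C' θ p v - φ' θ p.1 v - ψ' θ p.2 v :=
  ((hC.bddMeas_deriv hθ v).sub ((hφ.bddMeas_deriv hθ v).comp measurable_fst)).sub
    ((hψ.bddMeas_deriv hθ v).comp measurable_snd)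

-- The conditional mass `∫ P(i, j) dν(j)` equals `1` for all parameters; its derivative is `-γ⁻¹`
-- times the integral shown here.
include hγ hC hφ hψ S hθ in
omit [IsProbabilityMeasure μ] in
theorem integral_planDensity_mul_reduced_right (v : E) (i : I) :
    ∫ j, planDensity γ (C θ) (φ θ) (ψ θ) (i, j) *
      (C' θ (i, j) v - φ' θ i v - ψ' θ j v) ∂ν = 0 := by
  have hP := ((hC.planDensity hφ hψ γ).comp_measurable (measurable_prodMk_left (x := i)))
  have h1 := hP.hasFDerivAt_integral hθ ν
  have h2 : HasFDerivAt (fun θ => ∫ j, planDensity γ (C θ) (φ θ) (ψ θ) (i, j) ∂ν)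
      (0 : E →L[ℝ] ℝ) θ := by
    refine (hasFDerivAt_const (1 : ℝ) θ).congr_of_eventuallyEq ?_
    filter_upwards [hC.isOpen.mem_nhds hθ] with θ' hθ'
    exact (S θ' hθ').integral_planDensity_right hγ (hC.bddMeas hθ') i
  have h3 := congrArg (fun L : E →L[ℝ] ℝ => L v) (h1.unique h2)
  simp only [zero_apply] at h3
  rw [ContinuousLinearMap.integral_apply (hP.integrable_deriv hθ ν)] at h3
  simp only [smul_apply, sub_apply, smul_eq_mul, mul_assoc] at h3
  rw [integral_const_mul] at h3
  exact (mul_eq_zero.1 h3).resolve_left (neg_ne_zero.2 (inv_ne_zero hγ.ne'))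

include hγ hC hφ hψ S hθ in
omit [IsProbabilityMeasure ν] in
theorem integral_planDensity_mul_reduced_left (v : E) (j : J) :
    ∫ i, planDensity γ (C θ) (φ θ) (ψ θ) (i, j) *
      (C' θ (i, j) v - φ' θ i v - ψ' θ j v) ∂μ = 0 := by
  have := integral_planDensity_mul_reduced_right (ν := μ) (μ := ν) hγ
    (hC.comp_measurable measurable_swap) hψ hφ (fun θ hθ => (S θ hθ).swap) hθ v j
  rw [← this]
  congr 1
  funext i
  simp only [planDensity, Prod.swap_prod_mk]
  congr 1
  · congr 2
    ring
  · ring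

-- Orthogonality of the reduced derivative `C' - φ' - ψ'` to all functions of one coordinate. It
-- removes the derivatives of the potentials from the first derivative and the cross terms from the
-- second.
include hγ hC hφ hψ S hθ in
theorem integral_reduced_mul_left (v : E) {u : I → ℝ} (hu : BddMeas u) :
    ∫ p, planDensity γ (C θ) (φ θ) (ψ θ) p * (C' θ p v - φ' θ p.1 v - ψ' θ p.2 v) * u p.1
      ∂(μ.prod ν) = 0 := by
  rw [integral_prod _ (((((S θ hθ).bddMeas_planDensity (hC.bddMeas hθ)).mul
    (bddMeas_reduced hC hφ hψ hθ v)).mul (hu.comp measurable_fst)).integrable _)]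
  simp only [integral_mul_const]
  simp [integral_planDensity_mul_reduced_right hγ hC hφ hψ S hθ v]

include hγ hC hφ hψ S hθ in
theorem integral_reduced_mul_right (v : E) {u : J → ℝ} (hu : BddMeas u) :
    ∫ p, planDensity γ (C θ) (φ θ) (ψ θ) p * (C' θ p v - φ' θ p.1 v - ψ' θ p.2 v) * u p.2
      ∂(μ.prod ν) = 0 := by
  rw [integral_prod_symm _ (((((S θ hθ).bddMeas_planDensity (hC.bddMeas hθ)).mul
    (bddMeas_reduced hC hφ hψ hθ v)).mul (hu.comp measurable_snd)).integrable _)]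
  simp only [integral_mul_const]
  simp [integral_planDensity_mul_reduced_left hγ hC hφ hψ S hθ v]

end Marginals

theorem Schrodinger.integral_planDensity_mul_fst {C : I × J → ℝ} {φ : I → ℝ} {ψ : J → ℝ}
    (hγ : 0 < γ) (hC : BddMeas C) (S : Schrodinger γ μ ν C φ ψ) {u : I → ℝ} (hu : BddMeas u) :
    ∫ p, planDensity γ C φ ψ p * u p.1 ∂(μ.prod ν) = ∫ i, u i ∂μ := by
  rw [integral_prod _ (((S.bddMeas_planDensity hC).mul (hu.comp measurable_fst)).integrable _)]
  simp only [integral_mul_const]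
  simp [S.integral_planDensity_right hγ hC]

theorem Schrodinger.integral_planDensity_mul_snd {C : I × J → ℝ} {φ : I → ℝ} {ψ : J → ℝ}
    (hγ : 0 < γ) (hC : BddMeas C) (S : Schrodinger γ μ ν C φ ψ) {u : J → ℝ} (hu : BddMeas u) :
    ∫ p, planDensity γ C φ ψ p * u p.2 ∂(μ.prod ν) = ∫ j, u j ∂ν := by
  rw [integral_prod_symm _ (((S.bddMeas_planDensity hC).mul (hu.comp measurable_snd)).integrable _)]
  simp only [integral_mul_const]
  have : ∀ j, ∫ i, planDensity γ C φ ψ (i, j) ∂μ = 1 := fun j => by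
    have := S.gibbsMean_eq hγ hC j fun _ => 1
    rw [gibbsMean_const (S.bddMeas_left hC j)] at this
    simpa using this.symm
  simp [this]

/-- First and second derivatives of the optimal value of a family of Schrödinger systems. -/
theorem Schrodinger.hasFDerivAt_value (hγ : 0 < γ) (hC : DiffFamily Θ C C')
    (hC' : DiffFamily Θ C' C'') (hφ : DiffFamily Θ φ φ') (hψ : DiffFamily Θ ψ ψ')
    (S : ∀ θ ∈ Θ, Schrodinger γ μ ν (C θ) (φ θ) (ψ θ)) :
    ∃ (D : E → E →L[ℝ] ℝ) (H : E → E →L[ℝ] E →L[ℝ] ℝ),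
      (∀ θ ∈ Θ, HasFDerivAt (fun θ => (∫ i, φ θ i ∂μ) + ∫ j, ψ θ j ∂ν) (D θ) θ) ∧
      (∀ θ ∈ Θ, HasFDerivAt D (H θ) θ) ∧
      ∀ θ ∈ Θ, ∀ v w, H θ v w =
        (∫ p, planDensity γ (C θ) (φ θ) (ψ θ) p * C'' θ p v w ∂(μ.prod ν))
        - (1 / γ) * ∫ p, planDensity γ (C θ) (φ θ) (ψ θ) p *
          ((C' θ p v - φ' θ p.1 v - ψ' θ p.2 v) * (C' θ p w - φ' θ p.1 w - ψ' θ p.2 w))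
          ∂(μ.prod ν) := by
  have hP := hC.planDensity hφ hψ γ
  have hPC := hP.smul hC'
  have hb : ∀ θ ∈ Θ, BddMeas (SiNG.planDensity γ (C θ) (φ θ) (ψ θ)) := fun θ hθ =>
    (S θ hθ).bddMeas_planDensity (hC.bddMeas hθ)
  -- Envelope formula: the candidate gradient contains `φ` and `ψ` but not their derivatives, so it
  -- can be differentiated once more.
  refine ⟨fun θ => ∫ p, planDensity γ (C θ) (φ θ) (ψ θ) p • C' θ p ∂(μ.prod ν), _, ?_,
    fun θ hθ => hPC.hasFDerivAt_integral hθ _, ?_⟩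
  · intro θ hθ
    have h1 := (hφ.hasFDerivAt_integral hθ μ).add (hψ.hasFDerivAt_integral hθ ν)
    refine h1.congr_fderiv ?_
    ext v
    have a1 := (S θ hθ).integral_planDensity_mul_fst hγ (hC.bddMeas hθ) (hφ.bddMeas_deriv hθ v)
    have a2 := (S θ hθ).integral_planDensity_mul_snd hγ (hC.bddMeas hθ) (hψ.bddMeas_deriv hθ v)
    have a3 := integral_reduced_mul_left hγ hC hφ hψ S hθ v (BddMeas.const 1)
    rw [add_apply, ContinuousLinearMap.integral_apply (hφ.integrable_deriv hθ μ),
      ContinuousLinearMap.integral_apply (hψ.integrable_deriv hθ ν),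
      ContinuousLinearMap.integral_apply (hPC.integrable hθ _), ← a1, ← a2,
      ← zero_add (∫ p, _ * _ ∂(μ.prod ν)), ← a3, ← integral_add, ← integral_add]
    · congr 1
      funext p
      simp only [smul_apply, smul_eq_mul]
      ring
    · exact ((((hb θ hθ).mul (bddMeas_reduced hC hφ hψ hθ v)).mul (BddMeas.const 1)).add
        ((hb θ hθ).mul ((hφ.bddMeas_deriv hθ v).comp measurable_fst))).integrable _
    · exact ((hb θ hθ).mul ((hψ.bddMeas_deriv hθ v).comp measurable_snd)).integrable _
    · exact (((hb θ hθ).mul (bddMeas_reduced hC hφ hψ hθ v)).mul (BddMeas.const 1)).integrable _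
    · exact ((hb θ hθ).mul ((hφ.bddMeas_deriv hθ v).comp measurable_fst)).integrable _
  · intro θ hθ v w
    have a1 := integral_reduced_mul_left hγ hC hφ hψ S hθ v (hφ.bddMeas_deriv hθ w)
    have a2 := integral_reduced_mul_right hγ hC hφ hψ S hθ v (hψ.bddMeas_deriv hθ w)
    have i0 := hPC.integrable_deriv hθ (μ.prod ν)
    have b1 := (hb θ hθ).mul (hC'.bddMeas_deriv₂ hθ v w)
    have be := bddMeas_reduced hC hφ hψ hθ
    have b2 := (hb θ hθ).mul ((be v).mul (be w))
    have b3 := ((hb θ hθ).mul (be v)).mul ((hφ.bddMeas_deriv hθ w).comp measurable_fst)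
    have b4 := ((hb θ hθ).mul (be v)).mul ((hψ.bddMeas_deriv hθ w).comp measurable_snd)
    rw [ContinuousLinearMap.integral_apply i0,
      ContinuousLinearMap.integral_apply (i0.apply_continuousLinearMap v)]
    -- The last factor `C'` is split as reduced derivative plus `φ'` plus `ψ'`; the last two
    -- contributions vanish by `a1` and `a2`.
    have e : ∀ p, (planDensity γ (C θ) (φ θ) (ψ θ) p • C'' θ p
        + ((-γ⁻¹ * planDensity γ (C θ) (φ θ) (ψ θ) p) •
          (C' θ p - φ' θ p.1 - ψ' θ p.2)).smulRight (C' θ p)) v w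
        = planDensity γ (C θ) (φ θ) (ψ θ) p * C'' θ p v w
          - (1 / γ) * (planDensity γ (C θ) (φ θ) (ψ θ) p *
            ((C' θ p v - φ' θ p.1 v - ψ' θ p.2 v) * (C' θ p w - φ' θ p.1 w - ψ' θ p.2 w)))
          - (1 / γ) * (planDensity γ (C θ) (φ θ) (ψ θ) p *
            (C' θ p v - φ' θ p.1 v - ψ' θ p.2 v) * φ' θ p.1 w)
          - (1 / γ) * (planDensity γ (C θ) (φ θ) (ψ θ) p *
            (C' θ p v - φ' θ p.1 v - ψ' θ p.2 v) * ψ' θ p.2 w) := fun p => by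
      simp only [add_apply, smul_apply, ContinuousLinearMap.smulRight_apply, sub_apply,
        smul_eq_mul]
      ring
    simp only [e]
    rw [integral_sub (((b1.sub (b2.const_mul _)).sub (b3.const_mul _)).integrable _)
        ((b4.const_mul _).integrable _),
      integral_sub ((b1.sub (b2.const_mul _)).integrable _) ((b3.const_mul _).integrable _),
      integral_sub (b1.integrable _) ((b2.const_mul _).integrable _), integral_const_mul,
      integral_const_mul, integral_const_mul, a1, a2]
    ring

end DualValue

end SiNG

namespace SiNG

/-! ### The semi-dual functional and the Hessian identity. -/

section Semidual

variable {E I J : Type*} [NormedAddCommGroup E] [NormedSpace ℝ E] [FiniteDimensional ℝ E]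
  [MeasurableSpace I] [MeasurableSpace J] {γ : ℝ} {μ : Measure I} {ν : Measure J}
  [IsProbabilityMeasure μ] [IsProbabilityMeasure ν] {Θ : Set E} {C : E → I × J → ℝ}
  {C' : E → I × J → E →L[ℝ] ℝ} {C'' : E → I × J → E →L[ℝ] E →L[ℝ] ℝ}
  {N : E → I → ℝ} {N' : E → I → E →L[ℝ] ℝ} {N'' : E → I → E →L[ℝ] E →L[ℝ] ℝ}
  {φ : E → I → ℝ} {ψ : E → J → ℝ} {φ' : E → I → E →L[ℝ] ℝ} {ψ' : E → J → E →L[ℝ] ℝ}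

/-- First and second derivatives of the semi-dual functional at a fixed smooth potential. -/
theorem hasFDerivAt_semidual (hγ : 0 < γ) (hC : DiffFamily Θ C C') (hC' : DiffFamily Θ C' C'')
    (hN : DiffFamily Θ N N') (hN' : DiffFamily Θ N' N'') :
    ∃ (D : E → E →L[ℝ] ℝ) (H : E → E →L[ℝ] E →L[ℝ] ℝ),
      (∀ θ ∈ Θ, HasFDerivAt (fun θ => (∫ i, N θ i ∂μ)
        + ∫ j, softmin γ μ (fun i => C θ (i, j) - N θ i) ∂ν) (D θ) θ) ∧
      (∀ θ ∈ Θ, HasFDerivAt D (H θ) θ) ∧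
      ∀ θ ∈ Θ, ∀ v w, H θ v w = (∫ i, N'' θ i v w ∂μ)
        + ∫ j, (gibbsMean γ μ (fun i => C θ (i, j) - N θ i)
            (fun i => C'' θ (i, j) v w - N'' θ i v w)
          - (1 / γ) * gibbsMean γ μ (fun i => C θ (i, j) - N θ i)
            (fun i => (C' θ (i, j) v - N' θ i v) * (C' θ (i, j) w - N' θ i w))
          + (1 / γ) * (gibbsMean γ μ (fun i => C θ (i, j) - N θ i)
              (fun i => C' θ (i, j) v - N' θ i v)
            * gibbsMean γ μ (fun i => C θ (i, j) - N θ i)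
              (fun i => C' θ (i, j) w - N' θ i w))) ∂ν := by
  have hb := hC.sub (hN.comp_measurable (measurable_fst (β := J)))
  have hb' := hC'.sub (hN'.comp_measurable (measurable_fst (β := J)))
  obtain ⟨M', M'', m1, m2, e1, e2⟩ := hb.exists_softmin₂ hb' hγ μ
  refine ⟨fun θ => (∫ i, N' θ i ∂μ) + ∫ j, M' θ j ∂ν,
    fun θ => (∫ i, N'' θ i ∂μ) + ∫ j, M'' θ j ∂ν,
    fun θ hθ => (hN.hasFDerivAt_integral hθ μ).add (m1.hasFDerivAt_integral hθ ν),
    fun θ hθ => (hN'.hasFDerivAt_integral hθ μ).add (m2.hasFDerivAt_integral hθ ν), ?_⟩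
  intro θ hθ v w
  have i1 := hN'.integrable_deriv hθ μ
  have i2 := m2.integrable_deriv hθ ν
  rw [add_apply, add_apply, ContinuousLinearMap.integral_apply i1,
    ContinuousLinearMap.integral_apply (i1.apply_continuousLinearMap v),
    ContinuousLinearMap.integral_apply i2,
    ContinuousLinearMap.integral_apply (i2.apply_continuousLinearMap v)]
  congr 2
  funext j
  rw [e2 θ hθ]
  simp only [sub_apply]

omit [IsProbabilityMeasure ν] in
omit [IsProbabilityMeasure μ] in
theorem gibbsMean_const_mul {a φ : I → ℝ} (k : ℝ) :
    gibbsMean γ μ a (fun x => k * φ x) = k * gibbsMean γ μ a φ := by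
  simp only [gibbsMean]
  rw [← mul_div_assoc, ← integral_const_mul]
  congr 2
  funext x
  ring

theorem BddMeas.gibbsMean {a u : I × J → ℝ} (ha : BddMeas a) (hu : BddMeas u) (γ : ℝ)
    (μ : Measure I) [IsProbabilityMeasure μ] :
    BddMeas fun j => gibbsMean γ μ (fun i => a (i, j)) (fun i => u (i, j)) := by
  obtain ⟨K, hK⟩ := hu.bdd
  refine ⟨?_, K, fun j => abs_gibbsMean_le (ha.comp measurable_prodMk_right)
    (hu.comp measurable_prodMk_right) fun i => hK (i, j)⟩
  exact (((ha.gibbs γ).mul hu).integral_left μ).meas.div ((ha.gibbs γ).integral_left μ).meas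

/-- At a solution, the Gibbs measure attached to `j` is the conditional law of the optimal plan
given `j`. -/
theorem Schrodinger.integral_gibbsMean {C : I × J → ℝ} {φ : I → ℝ} {ψ : J → ℝ} (hγ : 0 < γ)
    (hC : BddMeas C) (S : Schrodinger γ μ ν C φ ψ) {u : I × J → ℝ} (hu : BddMeas u) :
    ∫ j, SiNG.gibbsMean γ μ (fun i => C (i, j) - φ i) (fun i => u (i, j)) ∂ν
      = ∫ p, planDensity γ C φ ψ p * u p ∂(μ.prod ν) := by
  rw [integral_prod_symm _ (((S.bddMeas_planDensity hC).mul hu).integrable _)]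
  congr 1
  funext j
  rw [S.gibbsMean_eq hγ hC]

/-- Gibbs covariances are unchanged by constants, and centered parts split off. -/
theorem gibbsMean_cov_add_const {a e₁ e₂ z₁ z₂ : I → ℝ} (c₁ c₂ : ℝ) (ha : BddMeas a)
    (he₁ : BddMeas e₁) (he₂ : BddMeas e₂) (hz₁ : BddMeas z₁) (hz₂ : BddMeas z₂)
    (h₁ : gibbsMean γ μ a e₁ = 0) (h₂ : gibbsMean γ μ a e₂ = 0) :
    gibbsMean γ μ a (fun i => (e₁ i + z₁ i + c₁) * (e₂ i + z₂ i + c₂))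
      - gibbsMean γ μ a (fun i => e₁ i + z₁ i + c₁) * gibbsMean γ μ a (fun i => e₂ i + z₂ i + c₂)
      = gibbsMean γ μ a (fun i => e₁ i * e₂ i) + gibbsMean γ μ a (fun i => e₁ i * z₂ i)
        + gibbsMean γ μ a (fun i => e₂ i * z₁ i)
        + (gibbsMean γ μ a (fun i => z₁ i * z₂ i)
          - gibbsMean γ μ a z₁ * gibbsMean γ μ a z₂) := by
  have e : (fun i => (e₁ i + z₁ i + c₁) * (e₂ i + z₂ i + c₂)) = fun i =>
      (e₁ i * e₂ i + e₁ i * z₂ i + e₂ i * z₁ i + z₁ i * z₂ i)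
        + (c₂ * e₁ i + c₂ * z₁ i + c₁ * e₂ i + c₁ * z₂ i + c₁ * c₂) := by
    funext i
    ring
  have b12 := he₁.mul he₂
  have b3 := he₁.mul hz₂
  have b4 := he₂.mul hz₁
  have b5 := hz₁.mul hz₂
  have d1 := he₁.const_mul c₂
  have d2 := hz₁.const_mul c₂
  have d3 := he₂.const_mul c₁
  have d4 := hz₂.const_mul c₁
  have d5 : BddMeas fun _ : I => c₁ * c₂ := BddMeas.const _
  rw [e, gibbsMean_add ha (((b12.add b3).add b4).add b5) ((((d1.add d2).add d3).add d4).add d5),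
    gibbsMean_add ha ((b12.add b3).add b4) b5, gibbsMean_add ha (b12.add b3) b4,
    gibbsMean_add ha b12 b3, gibbsMean_add ha (((d1.add d2).add d3).add d4) d5,
    gibbsMean_add ha ((d1.add d2).add d3) d4, gibbsMean_add ha (d1.add d2) d3,
    gibbsMean_add ha d1 d2, gibbsMean_const_mul, gibbsMean_const_mul, gibbsMean_const_mul,
    gibbsMean_const_mul, gibbsMean_const ha, gibbsMean_add ha (he₁.add hz₁) (BddMeas.const c₁),
    gibbsMean_add ha (he₂.add hz₂) (BddMeas.const c₂), gibbsMean_add ha he₁ hz₁,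
    gibbsMean_add ha he₂ hz₂, gibbsMean_const ha, gibbsMean_const ha, h₁, h₂]
  ring

/-- The Hessian of the optimal value in terms of the second derivatives of the semi-dual
functional. -/
theorem Schrodinger.hessian_identity (hγ : 0 < γ) (hC : DiffFamily Θ C C')
    (hC' : DiffFamily Θ C' C'') (hN : DiffFamily Θ N N') (hN' : DiffFamily Θ N' N'')
    (hφ : DiffFamily Θ φ φ') (hψ : DiffFamily Θ ψ ψ')
    (S : ∀ θ ∈ Θ, Schrodinger γ μ ν (C θ) (φ θ) (ψ θ)) {θ : E} (hθ : θ ∈ Θ) {k : ℝ}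
    (hNφ : ∀ i, N θ i = φ θ i + k) {v w : E} {ζv ζw : I → ℝ} {κv κw : ℝ}
    (hζv : ∀ i, ζv i = φ' θ i v - N' θ i v + κv) (hζw : ∀ i, ζw i = φ' θ i w - N' θ i w + κw) :
    (∫ p, planDensity γ (C θ) (φ θ) (ψ θ) p * C'' θ p v w ∂(μ.prod ν))
        - (1 / γ) * ∫ p, planDensity γ (C θ) (φ θ) (ψ θ) p *
          ((C' θ p v - φ' θ p.1 v - ψ' θ p.2 v) * (C' θ p w - φ' θ p.1 w - ψ' θ p.2 w))
          ∂(μ.prod ν)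
      = -(∫ j, (-(1 / γ) * gibbsMean γ μ (fun i => C θ (i, j) - N θ i) (fun i => ζv i * ζw i)
          + (1 / γ) * (gibbsMean γ μ (fun i => C θ (i, j) - N θ i) ζv
            * gibbsMean γ μ (fun i => C θ (i, j) - N θ i) ζw)) ∂ν)
        + ((∫ i, N'' θ i v w ∂μ)
        + ∫ j, (gibbsMean γ μ (fun i => C θ (i, j) - N θ i)
            (fun i => C'' θ (i, j) v w - N'' θ i v w)
          - (1 / γ) * gibbsMean γ μ (fun i => C θ (i, j) - N θ i)
            (fun i => (C' θ (i, j) v - N' θ i v) * (C' θ (i, j) w - N' θ i w))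
          + (1 / γ) * (gibbsMean γ μ (fun i => C θ (i, j) - N θ i)
              (fun i => C' θ (i, j) v - N' θ i v)
            * gibbsMean γ μ (fun i => C θ (i, j) - N θ i)
              (fun i => C' θ (i, j) w - N' θ i w))) ∂ν) := by
  -- The constant `k` multiplies numerator and denominator by the same factor; potentials need not
  -- be normalized here.
  have gN : ∀ j u, gibbsMean γ μ (fun i => C θ (i, j) - N θ i) u
      = gibbsMean γ μ (fun i => C θ (i, j) - φ θ i) u := fun j u => by
    have : ∀ i, Real.exp (-(C θ (i, j) - N θ i) / γ)
        = Real.exp (k / γ) * Real.exp (-(C θ (i, j) - φ θ i) / γ) := fun i => by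
      rw [← Real.exp_add, ← add_div, hNφ]
      congr 2
      ring
    simp only [gibbsMean, this, mul_assoc]
    rw [integral_const_mul, integral_const_mul, mul_div_mul_left _ _ (Real.exp_pos _).ne']
  simp only [gN]
  have Sθ := S θ hθ
  have bC := hC.bddMeas hθ
  have ba : BddMeas fun p : I × J => C θ p - φ θ p.1 := bC.sub (Sθ.left.comp measurable_fst)
  have bv : BddMeas ζv := by
    rw [show ζv = _ from funext hζv]
    exact ((hφ.bddMeas_deriv hθ v).sub (hN.bddMeas_deriv hθ v)).add (BddMeas.const κv)
  have bw : BddMeas ζw := by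
    rw [show ζw = _ from funext hζw]
    exact ((hφ.bddMeas_deriv hθ w).sub (hN.bddMeas_deriv hθ w)).add (BddMeas.const κw)
  set e : E → I × J → ℝ := fun v p => C' θ p v - φ' θ p.1 v - ψ' θ p.2 v with he
  have be : ∀ v, BddMeas (e v) := bddMeas_reduced hC hφ hψ hθ
  have ge : ∀ v j, gibbsMean γ μ (fun i => C θ (i, j) - φ θ i) (fun i => e v (i, j)) = 0 :=
    fun v j => by
      rw [Sθ.gibbsMean_eq hγ bC]
      exact integral_planDensity_mul_reduced_left hγ hC hφ hψ S hθ v j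
  -- For fixed `j`, `C' - N' = e + ζ + (ψ' - κ)` with `e` of Gibbs mean zero and the last term
  -- constant in `i`, so the covariance of `C' - N'` splits.
  have cov : ∀ j, gibbsMean γ μ (fun i => C θ (i, j) - φ θ i)
            (fun i => C'' θ (i, j) v w - N'' θ i v w)
          - (1 / γ) * gibbsMean γ μ (fun i => C θ (i, j) - φ θ i)
            (fun i => (C' θ (i, j) v - N' θ i v) * (C' θ (i, j) w - N' θ i w))
          + (1 / γ) * (gibbsMean γ μ (fun i => C θ (i, j) - φ θ i)
              (fun i => C' θ (i, j) v - N' θ i v)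
            * gibbsMean γ μ (fun i => C θ (i, j) - φ θ i)
              (fun i => C' θ (i, j) w - N' θ i w))
      = gibbsMean γ μ (fun i => C θ (i, j) - φ θ i) (fun i => C'' θ (i, j) v w)
        - gibbsMean γ μ (fun i => C θ (i, j) - φ θ i) (fun i => N'' θ i v w)
        - (1 / γ) * gibbsMean γ μ (fun i => C θ (i, j) - φ θ i) (fun i => e v (i, j) * e w (i, j))
        - (1 / γ) * gibbsMean γ μ (fun i => C θ (i, j) - φ θ i) (fun i => e v (i, j) * ζw i)
        - (1 / γ) * gibbsMean γ μ (fun i => C θ (i, j) - φ θ i) (fun i => e w (i, j) * ζv i)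
        + (-(1 / γ) * gibbsMean γ μ (fun i => C θ (i, j) - φ θ i) (fun i => ζv i * ζw i)
          + (1 / γ) * (gibbsMean γ μ (fun i => C θ (i, j) - φ θ i) ζv
            * gibbsMean γ μ (fun i => C θ (i, j) - φ θ i) ζw)) := by
    intro j
    have m : ∀ {D : I × J → ℝ}, BddMeas D → BddMeas fun i => D (i, j) :=
      fun hD => hD.comp measurable_prodMk_right
    have h := gibbsMean_cov_add_const (ψ' θ j v - κv) (ψ' θ j w - κw) (γ := γ) (μ := μ) (m ba)
      (m (be v)) (m (be w)) bv bw (ge v j) (ge w j)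
    have r : ∀ {x : E} {ζ : I → ℝ} {κ : ℝ}, (∀ i, ζ i = φ' θ i x - N' θ i x + κ) →
        ∀ i, e x (i, j) + ζ i + (ψ' θ j x - κ) = C' θ (i, j) x - N' θ i x := fun hζ i => by
      rw [hζ]
      simp only [he]
      ring
    simp only [r hζv, r hζw] at h
    rw [gibbsMean_sub (m ba) (m (hC'.bddMeas_deriv₂ hθ v w)) (hN'.bddMeas_deriv₂ hθ v w)]
    linear_combination (-(1 / γ)) * h
  simp only [cov]
  have s1 := Sθ.integral_gibbsMean hγ bC (hC'.bddMeas_deriv₂ hθ v w)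
  have s2 := Sθ.integral_gibbsMean hγ bC
    ((hN'.bddMeas_deriv₂ hθ v w).comp (measurable_fst (β := J)))
  -- By the first marginal, the mean of `N''` under the plan is its `μ`-integral and cancels the
  -- separate term `∫ N'' dμ`.
  rw [Sθ.integral_planDensity_mul_fst hγ bC (hN'.bddMeas_deriv₂ hθ v w)] at s2
  have s3 := Sθ.integral_gibbsMean hγ bC ((be v).mul (be w))
  have s4 := Sθ.integral_gibbsMean hγ bC ((be v).mul (bw.comp measurable_fst))
  have s5 := Sθ.integral_gibbsMean hγ bC ((be w).mul (bv.comp measurable_fst))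
  simp only [← mul_assoc, he] at s4 s5
  -- The cross terms between `e` and `ζ` need not vanish for fixed `j`. They vanish after
  -- integration over `j`, by the other marginal constraint.
  rw [integral_reduced_mul_left hγ hC hφ hψ S hθ v bw] at s4
  rw [integral_reduced_mul_left hγ hC hφ hψ S hθ w bv] at s5
  have g1 := ba.gibbsMean (hC'.bddMeas_deriv₂ hθ v w) γ μ
  have g2 := ba.gibbsMean ((hN'.bddMeas_deriv₂ hθ v w).comp (measurable_fst (β := J))) γ μ
  have g3 := (ba.gibbsMean ((be v).mul (be w)) γ μ).const_mul (1 / γ)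
  have g4 := (ba.gibbsMean ((be v).mul (bw.comp measurable_fst)) γ μ).const_mul (1 / γ)
  have g5 := (ba.gibbsMean ((be w).mul (bv.comp measurable_fst)) γ μ).const_mul (1 / γ)
  have g6 := ((ba.gibbsMean ((bv.mul bw).comp (measurable_fst (β := J))) γ μ).const_mul
    (-(1 / γ))).add (((ba.gibbsMean (bv.comp (measurable_fst (β := J))) γ μ).mul
      (ba.gibbsMean (bw.comp (measurable_fst (β := J))) γ μ)).const_mul (1 / γ))
  rw [integral_add (((((g1.sub g2).sub g3).sub g4).sub g5).integrable ν) (g6.integrable ν),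
    integral_sub ((((g1.sub g2).sub g3).sub g4).integrable ν) (g5.integrable ν),
    integral_sub (((g1.sub g2).sub g3).integrable ν) (g4.integrable ν),
    integral_sub ((g1.sub g2).integrable ν) (g3.integrable ν),
    integral_sub (g1.integrable ν) (g2.integrable ν), integral_const_mul, integral_const_mul,
    integral_const_mul, s1, s2, s3, s4, s5]
  ring

end Semidual

end SiNG

namespace SiNG

/-! ### Entropic duality, uniqueness and existence of potentials. -/

section Duality

variable {I J : Type*} [MeasurableSpace I] [MeasurableSpace J] {γ : ℝ} {μ : Measure I}
  {ν : Measure J} [IsProbabilityMeasure μ] [IsProbabilityMeasure ν] {C : I × J → ℝ}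
  {φ φ₁ : I → ℝ} {ψ ψ₁ : J → ℝ}

/-- Solutions of the Schrödinger system maximize the dual functional. -/
theorem Schrodinger.dual_le (hγ : 0 < γ) (hC : BddMeas C) (S : Schrodinger γ μ ν C φ ψ)
    (hφ₁ : BddMeas φ₁) (hψ₁ : BddMeas ψ₁) :
    (∫ i, φ₁ i ∂μ) + (∫ j, ψ₁ j ∂ν)
        - γ * ∫ p, (Real.exp ((φ₁ p.1 + ψ₁ p.2 - C p) / γ) - 1) ∂(μ.prod ν)
      ≤ (∫ i, φ i ∂μ) + (∫ j, ψ j ∂ν)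
        - γ * ∫ p, (Real.exp ((φ p.1 + ψ p.2 - C p) / γ) - 1) ∂(μ.prod ν) := by
  have hP := S.bddMeas_planDensity hC
  have e : ∀ (φ : I → ℝ) (ψ : J → ℝ) p, Real.exp ((φ p.1 + ψ p.2 - C p) / γ)
      = planDensity γ C φ ψ p := fun φ ψ p => by
    simp only [planDensity]
    congr 2
    ring
  have hP₁ : BddMeas (planDensity γ C φ₁ ψ₁) :=
    ((hC.sub (hφ₁.comp measurable_fst)).sub (hψ₁.comp measurable_snd)).gibbs γ
  simp only [e]
  have b1 := hP.mul ((hφ₁.sub S.left).comp (measurable_fst (β := J)))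
  have b2 := hP.mul ((hψ₁.sub S.right).comp (measurable_snd (α := I)))
  have h1 := S.integral_planDensity_mul_fst hγ hC (hφ₁.sub S.left)
  have h2 := S.integral_planDensity_mul_snd hγ hC (hψ₁.sub S.right)
  rw [integral_sub (hφ₁.integrable μ) (S.left.integrable μ)] at h1
  rw [integral_sub (hψ₁.integrable ν) (S.right.integrable ν)] at h2
  -- Concavity of the dual: the tangent inequality `exp x ≥ 1 + x` is used at the solution, and the
  -- marginals turn its linear terms into the differences of the integrals.
  have h3 : ∫ p, ((planDensity γ C φ ψ p - 1) + (γ⁻¹ * (planDensity γ C φ ψ p *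
      (φ₁ p.1 - φ p.1)) + γ⁻¹ * (planDensity γ C φ ψ p * (ψ₁ p.2 - ψ p.2)))) ∂(μ.prod ν)
      ≤ ∫ p, (planDensity γ C φ₁ ψ₁ p - 1) ∂(μ.prod ν) := by
    refine integral_mono (((hP.sub (BddMeas.const 1)).add
      ((b1.const_mul _).add (b2.const_mul _))).integrable _)
      ((hP₁.sub (BddMeas.const 1)).integrable _) fun p => ?_
    have e1 : planDensity γ C φ₁ ψ₁ p = planDensity γ C φ ψ p *
        Real.exp (γ⁻¹ * (φ₁ p.1 - φ p.1) + γ⁻¹ * (ψ₁ p.2 - ψ p.2)) := by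
      simp only [planDensity]
      rw [← Real.exp_add]
      congr 1
      field_simp
      ring
    have h4 := mul_le_mul_of_nonneg_left
      (Real.add_one_le_exp (γ⁻¹ * (φ₁ p.1 - φ p.1) + γ⁻¹ * (ψ₁ p.2 - ψ p.2)))
      (Real.exp_pos (-(C p - φ p.1 - ψ p.2) / γ)).le
    rw [e1]
    simp only [planDensity] at h4 ⊢
    linarith
  rw [integral_add ((hP.sub (BddMeas.const 1)).integrable _)
    (((b1.const_mul _).add (b2.const_mul _)).integrable _),
    integral_add ((b1.const_mul _).integrable _) ((b2.const_mul _).integrable _),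
    integral_const_mul, integral_const_mul, h1, h2] at h3
  have h5 := mul_le_mul_of_nonneg_left h3 hγ.le
  rw [mul_add, mul_add, ← mul_assoc, ← mul_assoc, mul_inv_cancel₀ hγ.ne', one_mul, one_mul] at h5
  linarith

/-- The optimal plan attached to a solution of the Schrödinger system. -/
noncomputable def optimalPlan (γ : ℝ) (μ : Measure I) (ν : Measure J) (C : I × J → ℝ) (φ : I → ℝ)
    (ψ : J → ℝ) : Measure (I × J) :=
  (μ.prod ν).tilted fun p => -(C p - φ p.1 - ψ p.2) / γ

theorem Schrodinger.integral_planDensity (hγ : 0 < γ) (hC : BddMeas C)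
    (S : Schrodinger γ μ ν C φ ψ) :
    ∫ p, Real.exp (-(C p - φ p.1 - ψ p.2) / γ) ∂(μ.prod ν) = 1 := by
  have := S.integral_planDensity_mul_fst hγ hC (BddMeas.const 1)
  simpa [planDensity] using this

omit [IsProbabilityMeasure μ] in
theorem Schrodinger.lintegral_planDensity_right (hγ : 0 < γ) (hC : BddMeas C)
    (S : Schrodinger γ μ ν C φ ψ) (i : I) :
    ∫⁻ j, ENNReal.ofReal (Real.exp (-(C (i, j) - φ i - ψ j) / γ)) ∂ν = 1 := by
  rw [← ofReal_integral_eq_lintegral_ofReal]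
  · rw [show (∫ j, Real.exp (-(C (i, j) - φ i - ψ j) / γ) ∂ν) = 1 from
      S.integral_planDensity_right hγ hC i, ENNReal.ofReal_one]
  · exact ((S.bddMeas_planDensity hC).comp measurable_prodMk_left).integrable ν
  · exact ae_of_all _ fun j => (Real.exp_pos _).le

theorem Schrodinger.fst_optimalPlan (hγ : 0 < γ) (hC : BddMeas C)
    (S : Schrodinger γ μ ν C φ ψ) : (optimalPlan γ μ ν C φ ψ).fst = μ := by
  ext s hs
  rw [Measure.fst_apply hs, optimalPlan, tilted_apply' _ _ (measurable_fst hs)]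
  simp only [S.integral_planDensity hγ hC, div_one]
  rw [← Set.prod_univ, ← Measure.prod_restrict, Measure.restrict_univ, lintegral_prod]
  · simp only [S.lintegral_planDensity_right hγ hC, lintegral_one, Measure.restrict_apply_univ]
  · exact (S.bddMeas_planDensity hC).meas.measurable.ennreal_ofReal.aemeasurable

theorem Schrodinger.snd_optimalPlan (hγ : 0 < γ) (hC : BddMeas C)
    (S : Schrodinger γ μ ν C φ ψ) : (optimalPlan γ μ ν C φ ψ).snd = ν := by
  have h : ∀ j, ∫⁻ i, ENNReal.ofReal (Real.exp (-(C (i, j) - φ i - ψ j) / γ)) ∂μ = 1 := fun j => by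
    have := S.swap.lintegral_planDensity_right hγ (hC.comp measurable_swap) j
    rw [← this]
    congr 1
    funext i
    rw [Prod.swap_prod_mk, sub_right_comm]
  ext s hs
  rw [Measure.snd_apply hs, optimalPlan, tilted_apply' _ _ (measurable_snd hs)]
  simp only [S.integral_planDensity hγ hC, div_one]
  rw [← Set.univ_prod, ← Measure.prod_restrict, Measure.restrict_univ, lintegral_prod_symm]
  · simp only [h, lintegral_one, Measure.restrict_apply_univ]
  · exact (S.bddMeas_planDensity hC).meas.measurable.ennreal_ofReal.aemeasurable

omit [IsProbabilityMeasure μ] [IsProbabilityMeasure ν] in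
theorem integral_add_of_marginals {π : Measure (I × J)} [IsProbabilityMeasure π] (h1 : π.fst = μ)
    (h2 : π.snd = ν) (hφ : BddMeas φ) (hψ : BddMeas ψ) :
    ∫ p, (φ p.1 + ψ p.2) ∂π = (∫ i, φ i ∂μ) + ∫ j, ψ j ∂ν := by
  rw [integral_add ((hφ.comp measurable_fst).integrable π) ((hψ.comp measurable_snd).integrable π),
    ← h1, ← h2, Measure.fst, Measure.snd, integral_map measurable_fst.aemeasurable
      hφ.meas.aestronglyMeasurable, integral_map measurable_snd.aemeasurable
      hψ.meas.aestronglyMeasurable]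

/-- The entropic transport cost is the sum of the integrals of the potentials. -/
theorem Schrodinger.isLeast (hγ : 0 < γ) (hC : BddMeas C) (S : Schrodinger γ μ ν C φ ψ) :
    IsLeast {r : ℝ | ∃ π : Measure (I × J), π.fst = μ ∧ π.snd = ν ∧
      InformationTheory.klDiv π (μ.prod ν) ≠ ⊤ ∧
      r = (∫ p, C p ∂π) + γ * (InformationTheory.klDiv π (μ.prod ν)).toReal}
      ((∫ i, φ i ∂μ) + ∫ j, ψ j ∂ν) := by
  have bh : BddMeas fun p : I × J => -(C p - φ p.1 - ψ p.2) / γ := by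
    have := ((hC.sub (S.left.comp measurable_fst)).sub (S.right.comp measurable_snd)).const_mul
      (-γ⁻¹)
    convert this using 2
    ring
  have hexp : Integrable (fun p : I × J => Real.exp (-(C p - φ p.1 - ψ p.2) / γ)) (μ.prod ν) :=
    bh.exp.integrable _
  -- The log-density of the optimal plan absorbs the cost: for every admissible plan, `C + γ log P =
  -- φ + ψ` integrates to the same number.
  have split : ∀ (π : Measure (I × J)) [IsProbabilityMeasure π], π.fst = μ → π.snd = ν →
      (∫ p, C p ∂π) + γ * ∫ p, -(C p - φ p.1 - ψ p.2) / γ ∂π = (∫ i, φ i ∂μ) + ∫ j, ψ j ∂ν := by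
    intro π _ h1 h2
    rw [← integral_add_of_marginals h1 h2 S.left S.right, ← integral_const_mul,
      ← integral_add (hC.integrable π) ((bh.const_mul γ).integrable π)]
    congr 1
    funext p
    field_simp
    ring
  have : IsProbabilityMeasure (optimalPlan γ μ ν C φ ψ) := isProbabilityMeasure_tilted hexp
  constructor
  · have f1 := S.fst_optimalPlan hγ hC
    have f2 := S.snd_optimalPlan hγ hC
    have hac : optimalPlan γ μ ν C φ ψ ≪ μ.prod ν := tilted_absolutelyContinuous _ _
    have hllr : llr (optimalPlan γ μ ν C φ ψ) (μ.prod ν)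
        =ᵐ[optimalPlan γ μ ν C φ ψ] fun p => -(C p - φ p.1 - ψ p.2) / γ := by
      refine hac.ae_le ?_
      filter_upwards [log_rnDeriv_tilted_left_self hexp] with p hp
      rw [llr, optimalPlan, hp, S.integral_planDensity hγ hC]
      simp
    have hint : Integrable (llr (optimalPlan γ μ ν C φ ψ) (μ.prod ν))
        (optimalPlan γ μ ν C φ ψ) := (bh.integrable _).congr hllr.symm
    refine ⟨_, f1, f2, InformationTheory.klDiv_ne_top hac hint, ?_⟩
    rw [InformationTheory.toReal_klDiv_of_measure_eq hac (by simp), integral_congr_ae hllr,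
      split _ f1 f2]
  · rintro r ⟨π, h1, h2, hkl, rfl⟩
    have hπ : IsProbabilityMeasure π := by
      constructor
      have : π.fst Set.univ = 1 := by rw [h1, measure_univ]
      rwa [Measure.fst_univ] at this
    obtain ⟨hac, hint⟩ := InformationTheory.klDiv_ne_top_iff.1 hkl
    -- The excess cost of `π` over the value is `γ` times its relative entropy with respect to the
    -- optimal plan, which is nonnegative.
    have hac' : π ≪ optimalPlan γ μ ν C φ ψ := hac.trans (absolutelyContinuous_tilted hexp)
    have hint' := integrable_llr_tilted_right hac (bh.integrable π) hint hexp
    have h3 := InformationTheory.integral_llr_add_sub_measure_univ_nonneg hac' hint'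
    have h4 := integral_llr_tilted_right hac (bh.integrable π) hexp hint
    rw [S.integral_planDensity hγ hC, Real.log_one] at h4
    simp only [probReal_univ] at h3
    rw [optimalPlan, h4] at h3
    rw [InformationTheory.toReal_klDiv_of_measure_eq hac (by simp), ← split π h1 h2]
    have h5 : ∫ p, -(C p - φ p.1 - ψ p.2) / γ ∂π ≤ ∫ p, llr π (μ.prod ν) p ∂π := by linarith
    have := mul_le_mul_of_nonneg_left h5 hγ.le
    linarith

/-- The oscillation estimate with equal costs, that is with `s = 0`. -/
theorem Schrodinger.eq_of_normalized {C : I × J → ℝ} (hγ : 0 < γ) (hC : BddMeas C)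
    (S : Schrodinger γ μ ν C φ ψ) (S₁ : Schrodinger γ μ ν C φ₁ ψ₁) {i₀ : I} (h : φ₁ i₀ = φ i₀)
    (i : I) : φ₁ i = φ i := by
  obtain ⟨B, hB⟩ := hC.bdd
  have := oscillation_sub_le hγ hC hC hB (s := 0) (fun p => by simp) S S₁ i i₀
  rw [h, sub_self, sub_zero, mul_zero, zero_div] at this
  exact sub_eq_zero.1 (abs_nonpos_iff.1 this)

end Duality

section Existence

variable {X Y : Type*} [TopologicalSpace X] [CompactSpace X] [SecondCountableTopology X]
  [MeasurableSpace X] [BorelSpace X] [TopologicalSpace Y] [CompactSpace Y]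
  [SecondCountableTopology Y] [MeasurableSpace Y] [BorelSpace Y] {γ : ℝ} {C : X × Y → ℝ}

omit [SecondCountableTopology X] in
theorem _root_.Continuous.bddMeas {f : X → ℝ} (hf : Continuous f) : BddMeas f := by
  refine ⟨hf.stronglyMeasurable, ?_⟩
  obtain ⟨K, hK⟩ := isCompact_univ.exists_bound_of_continuousOn hf.continuousOn
  exact ⟨K, fun x => hK x (Set.mem_univ x)⟩

omit [SecondCountableTopology X] in
theorem continuous_softmin (hC : Continuous C) (γ : ℝ) (α : Measure X) [IsProbabilityMeasure α]
    {f : X → ℝ} (hf : Continuous f) : Continuous fun y => softmin γ α fun x => C (x, y) - f x := by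
  have hb : BddMeas fun p : X × Y => Real.exp (-(C p - f p.1) / γ) :=
    ((hC.bddMeas).sub ((hf.comp continuous_fst).bddMeas)).gibbs γ
  obtain ⟨K, hK⟩ := hb.bdd
  have h1 : Continuous fun y => ∫ x, Real.exp (-(C (x, y) - f x) / γ) ∂α := by
    refine continuous_of_dominated (bound := fun _ => K) (fun y => ?_) (fun y => ?_)
      (integrable_const K) (ae_of_all _ fun x => ?_)
    · exact (hb.comp (measurable_prodMk_right (y := y))).meas.aestronglyMeasurable
    · exact ae_of_all _ fun x => hK (x, y)
    · fun_prop
  refine continuous_const.mul (h1.log fun y => (partition_pos ?_).ne')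
  exact (Continuous.bddMeas (by fun_prop) : BddMeas fun x => C (x, y) - f x)

/-- The soft minimum of `C(·, y) - f` as a continuous function of `y`. -/
noncomputable def softminMap (hC : Continuous C) (γ : ℝ) (α : Measure X) [IsProbabilityMeasure α]
    (f : C(X, ℝ)) : C(Y, ℝ) :=
  ⟨fun y => softmin γ α fun x => C (x, y) - f x, continuous_softmin hC γ α f.continuous⟩

omit [SecondCountableTopology X] in
theorem softminMap_contract (hγ : 0 < γ) (hC : Continuous C) {B : ℝ} (hB : ∀ p, |C p| ≤ B)
    (α : Measure X) [IsProbabilityMeasure α] {f g : C(X, ℝ)} {M : ℝ}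
    (hM : ∀ x x', |(f x - g x) - (f x' - g x')| ≤ M) (y y' : Y) :
    |(softminMap hC γ α f y - softminMap hC γ α g y)
      - (softminMap hC γ α f y' - softminMap hC γ α g y')|
      ≤ (1 - Real.exp (-2 * (2 * B) / γ)) * M := by
  have hb : ∀ y, BddMeas fun x => C (x, y) - g x := fun y => Continuous.bddMeas (by fun_prop)
  have := abs_softmin_increment_sub_le (ρ := α) (D := 2 * B) (R := M) hγ (hb y) (hb y')
    (φ := fun x => -(f x - g x)) (Continuous.bddMeas (by fun_prop))
    (fun x => by
      rw [sub_sub_sub_cancel_right]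
      refine (abs_sub _ _).trans ?_
      linarith [hB (x, y), hB (x, y')])
    (fun x x' => by
      rw [← abs_neg]
      convert hM x x' using 2
      ring)
  have e : ∀ y, softmin γ α (fun x => C (x, y) - g x + -(f x - g x))
      = softmin γ α fun x => C (x, y) - f x := fun y => by
    congr 1
    funext x
    ring
  simp only [e] at this
  exact this

/-- Sinkhorn's iteration contracts oscillations, so after renormalization at `x₀` a high iterate
contracts the sup norm. This solves the system up to an additive constant `k`, which a mass
computation shows to be zero. -/
theorem exists_schrodinger (hγ : 0 < γ) (hC : Continuous C) (α : Measure X) (β : Measure Y)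
    [IsProbabilityMeasure α] [IsProbabilityMeasure β] (x₀ : X) :
    ∃ f : C(X, ℝ), f x₀ = 0 ∧ Schrodinger γ α β C f (softminMap hC γ α f) := by
  obtain ⟨B, hB⟩ := hC.bddMeas.bdd
  have hC' : Continuous fun p : Y × X => C (p.2, p.1) := by fun_prop
  set q := 1 - Real.exp (-2 * (2 * B) / γ) with hq
  obtain ⟨y₀⟩ := β.nonempty_of_neZero
  have hB0 : 0 ≤ B := (abs_nonneg _).trans (hB (x₀, y₀))
  have hq1 : q < 1 := by
    have := Real.exp_pos (-2 * (2 * B) / γ)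
    linarith
  have hq0 : 0 ≤ q := by
    have : Real.exp (-2 * (2 * B) / γ) ≤ 1 := by
      rw [Real.exp_le_one_iff]
      exact div_nonpos_of_nonpos_of_nonneg (by linarith) hγ.le
    linarith
  let G : C(X, ℝ) → C(X, ℝ) := fun f => softminMap hC' γ β (softminMap hC γ α f)
  let N : C(X, ℝ) → C(X, ℝ) := fun f => G f - ContinuousMap.const X (G f x₀)
  have hG : ∀ (f g : C(X, ℝ)) (M : ℝ), (∀ x x', |(f x - g x) - (f x' - g x')| ≤ M) →
      ∀ x x', |(G f x - G g x) - (G f x' - G g x')| ≤ q * M := by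
    intro f g M hM x x'
    have h1 := softminMap_contract hγ hC' (fun p => hB (p.2, p.1)) β
      (softminMap_contract hγ hC hB α hM) x x'
    refine h1.trans ?_
    rw [← hq]
    have hM0 : 0 ≤ M := (abs_nonneg _).trans (hM x x')
    exact mul_le_of_le_one_left (mul_nonneg hq0 hM0) hq1.le
  have hN : ∀ (f g : C(X, ℝ)) (M : ℝ), (∀ x x', |(f x - g x) - (f x' - g x')| ≤ M) →
      ∀ n : ℕ, ∀ x x', |(N^[n] f x - N^[n] g x) - (N^[n] f x' - N^[n] g x')| ≤ q ^ n * M := by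
    intro f g M hM n
    induction n with
    | zero => simpa using hM
    | succ n ih =>
      intro x x'
      rw [Function.iterate_succ_apply', Function.iterate_succ_apply', pow_succ', mul_assoc]
      have := hG _ _ _ ih x x'
      convert this using 2
      simp only [N, ContinuousMap.sub_apply, ContinuousMap.const_apply]
      ring
  have hN0 : ∀ (f : C(X, ℝ)) (n : ℕ), N^[n + 1] f x₀ = 0 := fun f n => by
    rw [Function.iterate_succ_apply']
    simp [N]
  -- The factor `2` converts a sup distance into an oscillation bound; the return is free, since the
  -- iterates vanish at `x₀`. At least one iteration is needed for that, hence `n + 1`.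
  obtain ⟨n, hn⟩ : ∃ n : ℕ, q ^ (n + 1) * 2 ≤ 2⁻¹ := by
    obtain ⟨n, hn⟩ := exists_pow_lt_of_lt_one (show (0 : ℝ) < 4⁻¹ by norm_num) hq1
    refine ⟨n, ?_⟩
    have : q ^ (n + 1) ≤ q ^ n := pow_le_pow_of_le_one hq0 hq1.le (Nat.le_succ n)
    linarith
  have hcontr : ContractingWith (2⁻¹ : NNReal) N^[n + 1] := by
    refine ⟨by rw [← NNReal.coe_lt_coe]; norm_num, LipschitzWith.of_dist_le_mul fun f g => ?_⟩
    rw [ContinuousMap.dist_le (by positivity)]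
    intro x
    have hfg : ∀ x, |f x - g x| ≤ dist f g := fun x => by
      rw [← Real.dist_eq]
      exact ContinuousMap.dist_apply_le_dist x
    have h1 := hN f g (2 * dist f g) (fun x x' => (abs_sub _ _).trans (by
      linarith [hfg x, hfg x'])) (n + 1) x x₀
    rw [hN0, hN0, sub_self, sub_zero] at h1
    rw [Real.dist_eq]
    refine h1.trans ?_
    rw [← mul_assoc]
    have : ((2⁻¹ : NNReal) : ℝ) = 2⁻¹ := by simp
    rw [this]
    exact mul_le_mul_of_nonneg_right hn dist_nonneg
  -- The unique fixed point of an iterate of `N` is fixed by `N` itself.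
  obtain ⟨f, hf⟩ : ∃ f, N f = f := ⟨_, hcontr.isFixedPt_fixedPoint_iterate⟩
  have hf0 : f x₀ = 0 := by
    rw [← hf]
    simp [N]
  set g := softminMap hC γ α f with hg
  set k := G f x₀ with hk
  have hfk : ∀ x, G f x = f x + k := fun x => by
    have := congrArg (fun u : C(X, ℝ) => u x) hf
    simp only [N, ContinuousMap.sub_apply, ContinuousMap.const_apply] at this
    linarith
  have hC1 : BddMeas C := hC.bddMeas
  -- The total mass of this density, computed in the two orders of integration, is `1` and
  -- `exp(-k/γ)`.
  have e1 : ∀ y, ∫ x, Real.exp (-(C (x, y) - f x - g y) / γ) ∂α = 1 := fun y => by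
    rw [← integral_exp_softmin (ρ := α) (a := fun x => C (x, y) - f x) hγ
      (Continuous.bddMeas (by fun_prop))]
    congr 1
    funext x
    rw [hg]
    simp only [softminMap, ContinuousMap.coe_mk]
    congr 2
    ring
  have e2 : ∀ x, ∫ y, Real.exp (-(C (x, y) - f x - g y) / γ) ∂β = Real.exp (-k / γ) := fun x => by
    rw [← mul_one (Real.exp (-k / γ)), ← integral_exp_softmin (ρ := β)
      (a := fun y => C (x, y) - g y) hγ (Continuous.bddMeas (by fun_prop)), ← integral_const_mul]
    congr 1
    funext y
    rw [← Real.exp_add, ← add_div]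
    congr 2
    have : softmin γ β (fun y => C (x, y) - g y) = f x + k := hfk x
    rw [this]
    ring
  have hb : BddMeas fun p : X × Y => Real.exp (-(C p - f p.1 - g p.2) / γ) :=
    BddMeas.gibbs (Continuous.bddMeas (by fun_prop)) γ
  have e3 := integral_prod _ (hb.integrable (α.prod β))
  rw [integral_prod_symm _ (hb.integrable (α.prod β))] at e3
  simp only [e1, e2, integral_const, probReal_univ, smul_eq_mul, mul_one, one_mul] at e3
  have hk0 : k = 0 := by
    have := Real.exp_eq_one_iff (-k / γ) |>.1 e3.symm
    rw [div_eq_zero_iff] at this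
    simpa using this.resolve_right hγ.ne'
  refine ⟨f, hf0, f.continuous.bddMeas, g.continuous.bddMeas, fun x => ?_, fun y => rfl⟩
  have := hfk x
  rw [hk0, add_zero] at this
  exact this.symm

end Existence

end SiNG

namespace SiNG

/-! ### Derivatives of the semi-dual functional in the potential. -/

section PotentialDerivatives

variable {X Y : Type*} [TopologicalSpace X] [CompactSpace X]
  [MeasurableSpace X] [BorelSpace X] [TopologicalSpace Y] [CompactSpace Y]
  [SecondCountableTopology Y] [MeasurableSpace Y] [BorelSpace Y] {γ : ℝ} {C : X × Y → ℝ}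

/-- Integration as a continuous linear functional on continuous functions. -/
noncomputable def integralMap (α : Measure X) [IsProbabilityMeasure α] : C(X, ℝ) →L[ℝ] ℝ :=
  LinearMap.mkContinuous
    { toFun := fun f => ∫ x, f x ∂α
      map_add' := fun f g => integral_add (f.continuous.bddMeas.integrable α)
        (g.continuous.bddMeas.integrable α)
      map_smul' := fun k f => integral_const_mul k fun x => f x } 1 fun f => by
    rw [one_mul]
    simpa using norm_integral_le_of_norm_le_const (μ := α) (f := f) (C := ‖f‖)
      (ae_of_all _ fun x => f.norm_coe_le_norm x)

theorem integralMap_apply (α : Measure X) [IsProbabilityMeasure α] (f : C(X, ℝ)) :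
    integralMap α f = ∫ x, f x ∂α := rfl

theorem continuous_gibbs_integral (hC : Continuous C) (γ : ℝ) (α : Measure X)
    [IsProbabilityMeasure α] (u : C(X, ℝ)) :
    Continuous fun y => ∫ x, Real.exp (-C (x, y) / γ) * u x ∂α := by
  have hb : BddMeas fun p : X × Y => Real.exp (-C p / γ) * u p.1 :=
    ((hC.bddMeas).gibbs γ).mul ((u.continuous.bddMeas).comp measurable_fst)
  obtain ⟨K, hK⟩ := hb.bdd
  refine continuous_of_dominated (bound := fun _ => K) (fun y => ?_) (fun y => ?_)
    (integrable_const K) (ae_of_all _ fun x => ?_)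
  · exact (hb.comp (measurable_prodMk_right (y := y))).meas.aestronglyMeasurable
  · exact ae_of_all _ fun x => hK (x, y)
  · fun_prop

/-- The Gibbs kernel operator `u ↦ ∫ exp(-C(x, ·)/γ) u(x) dα(x)`. -/
noncomputable def kernelMap (hC : Continuous C) (γ : ℝ) (α : Measure X) [IsProbabilityMeasure α] :
    C(X, ℝ) →L[ℝ] C(Y, ℝ) :=
  LinearMap.mkContinuous
    { toFun := fun u => ⟨_, continuous_gibbs_integral hC γ α u⟩
      map_add' := fun f g => by
        ext y
        have hb : BddMeas fun x => Real.exp (-C (x, y) / γ) := Continuous.bddMeas (by fun_prop)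
        simp only [ContinuousMap.coe_mk, ContinuousMap.add_apply, mul_add]
        exact integral_add ((hb.mul f.continuous.bddMeas).integrable α)
          ((hb.mul g.continuous.bddMeas).integrable α)
      map_smul' := fun k f => by
        ext y
        simp only [ContinuousMap.coe_mk, ContinuousMap.smul_apply, smul_eq_mul, RingHom.id_apply]
        rw [← integral_const_mul]
        congr 1
        funext x
        ring } ‖(⟨fun p => Real.exp (-C p / γ), by fun_prop⟩ : C(X × Y, ℝ))‖ fun f => by
    rw [ContinuousMap.norm_le _ (by positivity)]
    intro y
    refine (norm_integral_le_of_norm_le_const (μ := α)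
      (C := ‖(⟨fun p => Real.exp (-C p / γ), by fun_prop⟩ : C(X × Y, ℝ))‖ * ‖f‖)
      (ae_of_all _ fun x => ?_)).trans (by simp)
    rw [norm_mul]
    gcongr
    · exact ContinuousMap.norm_coe_le_norm
        (⟨fun p => Real.exp (-C p / γ), by fun_prop⟩ : C(X × Y, ℝ)) (x, y)
    · exact f.norm_coe_le_norm x

theorem kernelMap_apply (hC : Continuous C) (γ : ℝ) (α : Measure X) [IsProbabilityMeasure α]
    (u : C(X, ℝ)) (y : Y) :
    kernelMap hC γ α u y = ∫ x, Real.exp (-C (x, y) / γ) * u x ∂α := rfl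

/-- The continuous function `exp(f/γ)`. -/
noncomputable def expMap (γ : ℝ) (f : C(X, ℝ)) : C(X, ℝ) := NormedSpace.exp (γ⁻¹ • f)

omit [MeasurableSpace X] [BorelSpace X] in
theorem expMap_apply (γ : ℝ) (f : C(X, ℝ)) (x : X) : expMap γ f x = Real.exp (f x / γ) := by
  have := NormedSpace.map_exp_of_mem_ball (𝕂 := ℝ) (ContinuousMap.evalAlgHom ℝ ℝ x)
    (by exact continuous_eval_const x) (γ⁻¹ • f)
    ((NormedSpace.expSeries_radius_eq_top ℝ C(X, ℝ)).symm ▸ edist_lt_top _ _)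
  rw [expMap]
  refine this.trans ?_
  rw [← Real.exp_eq_exp_ℝ]
  congr 1
  simp [div_eq_inv_mul]

omit [MeasurableSpace X] [BorelSpace X] in
theorem hasFDerivAt_expMap (γ : ℝ) (f : C(X, ℝ)) :
    HasFDerivAt (expMap γ) ((γ⁻¹ • ContinuousLinearMap.mul ℝ C(X, ℝ)) (expMap γ f)) f := by
  have h1 : HasFDerivAt (fun f : C(X, ℝ) => γ⁻¹ • f) (γ⁻¹ • ContinuousLinearMap.id ℝ C(X, ℝ)) f :=
    (ContinuousLinearMap.id ℝ C(X, ℝ)).hasFDerivAt.const_smul γ⁻¹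
  refine ((hasFDerivAt_exp (𝕂 := ℝ) (x := γ⁻¹ • f)).comp f h1).congr_fderiv ?_
  ext g x
  simp [expMap]

/-- The partition function `∫ exp((f(x) - C(x, ·))/γ) dα(x)`. -/
noncomputable def partitionMap (hC : Continuous C) (γ : ℝ) (α : Measure X)
    [IsProbabilityMeasure α] (f : C(X, ℝ)) : C(Y, ℝ) :=
  kernelMap hC γ α (expMap γ f)

theorem kernelMap_mul_expMap (hC : Continuous C) (γ : ℝ) (α : Measure X) [IsProbabilityMeasure α]
    (f u : C(X, ℝ)) (y : Y) : kernelMap hC γ α (expMap γ f * u) y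
      = ∫ x, Real.exp (-(C (x, y) - f x) / γ) * u x ∂α := by
  rw [kernelMap_apply]
  congr 1
  funext x
  rw [ContinuousMap.mul_apply, expMap_apply, ← mul_assoc, ← Real.exp_add]
  ring_nf

theorem partitionMap_apply (hC : Continuous C) (γ : ℝ) (α : Measure X) [IsProbabilityMeasure α]
    (f : C(X, ℝ)) (y : Y) :
    partitionMap hC γ α f y = ∫ x, Real.exp (-(C (x, y) - f x) / γ) ∂α := by
  have := kernelMap_mul_expMap hC γ α f 1 y
  simpa [partitionMap] using this

theorem isUnit_partitionMap (hC : Continuous C) (γ : ℝ) (α : Measure X) [IsProbabilityMeasure α]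
    (f : C(X, ℝ)) : IsUnit (partitionMap hC γ α f) := by
  rw [ContinuousMap.isUnit_iff_forall_ne_zero]
  intro y
  rw [partitionMap_apply]
  exact (partition_pos (a := fun x => C (x, y) - f x) (Continuous.bddMeas (by fun_prop))).ne'

omit [SecondCountableTopology Y] [MeasurableSpace Y] [BorelSpace Y] [CompactSpace Y] in
theorem ringInverse_apply {u : C(Y, ℝ)} (hu : IsUnit u) (y : Y) : Ring.inverse u y = (u y)⁻¹ := by
  have := congrArg (fun v : C(Y, ℝ) => v y) (Ring.mul_inverse_cancel u hu)
  simp only [ContinuousMap.mul_apply, ContinuousMap.one_apply] at this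
  exact eq_inv_of_mul_eq_one_right this

/-- The Gibbs means of a continuous function, as an operator. -/
noncomputable def gibbsMap (hC : Continuous C) (γ : ℝ) (α : Measure X) [IsProbabilityMeasure α]
    (f : C(X, ℝ)) : C(X, ℝ) →L[ℝ] C(Y, ℝ) :=
  (ContinuousLinearMap.mul ℝ C(Y, ℝ) (Ring.inverse (partitionMap hC γ α f))).comp
    ((kernelMap hC γ α).comp (ContinuousLinearMap.mul ℝ C(X, ℝ) (expMap γ f)))

theorem gibbsMap_apply (hC : Continuous C) (γ : ℝ) (α : Measure X) [IsProbabilityMeasure α]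
    (f u : C(X, ℝ)) (y : Y) :
    gibbsMap hC γ α f u y = gibbsMean γ α (fun x => C (x, y) - f x) u := by
  simp only [gibbsMap, ContinuousLinearMap.comp_apply, ContinuousLinearMap.mul_apply',
    ContinuousMap.mul_apply]
  rw [ringInverse_apply (isUnit_partitionMap hC γ α f), kernelMap_mul_expMap, partitionMap_apply,
    gibbsMean, div_eq_inv_mul]

/-- In the Banach algebras `C(X)` and `C(Y)`, `gibbsMap` is built from a fixed kernel operator, the
exponential, products and the ring inverse, all of them differentiable. -/
theorem exists_hasFDerivAt_gibbsMap (hC : Continuous C) (γ : ℝ) (α : Measure X)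
    [IsProbabilityMeasure α] (f : C(X, ℝ)) :
    ∃ W : C(X, ℝ) →L[ℝ] C(X, ℝ) →L[ℝ] C(Y, ℝ), HasFDerivAt (gibbsMap hC γ α) W f ∧
      ∀ g₁ g₂ y, W g₁ g₂ y =
        (1 / γ) * gibbsMean γ α (fun x => C (x, y) - f x) (fun x => g₁ x * g₂ x)
        - (1 / γ) * (gibbsMean γ α (fun x => C (x, y) - f x) g₁
          * gibbsMean γ α (fun x => C (x, y) - f x) g₂) := by
  have hE := hasFDerivAt_expMap γ f
  have hZ : HasFDerivAt (partitionMap hC γ α) _ f :=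
    (kernelMap hC γ α).hasFDerivAt.comp f hE
  obtain ⟨u, hu⟩ := isUnit_partitionMap hC γ α f
  have hR := hasFDerivAt_ringInverse (𝕜 := ℝ) u
  rw [hu] at hR
  have hRZ := hR.comp f hZ
  have h1 := (ContinuousLinearMap.mul ℝ C(Y, ℝ)).hasFDerivAt.comp f hRZ
  have h2 := (ContinuousLinearMap.mul ℝ C(X, ℝ)).hasFDerivAt.comp f hE
  have h3 := (hasFDerivAt_const (kernelMap hC γ α) f).clm_comp h2
  refine ⟨_, h1.clm_comp h3, fun g₁ g₂ y => ?_⟩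
  have hinv : ((u⁻¹ : C(Y, ℝ)ˣ) : C(Y, ℝ)) = Ring.inverse (partitionMap hC γ α f) := by
    rw [← hu, Ring.inverse_unit]
  have e1 := kernelMap_mul_expMap hC γ α f g₁ y
  have e2 := kernelMap_mul_expMap hC γ α f g₂ y
  have e3 := kernelMap_mul_expMap hC γ α f (g₁ * g₂) y
  have e4 : Ring.inverse (partitionMap hC γ α f) y
      = (∫ x, Real.exp (-(C (x, y) - f x) / γ) ∂α)⁻¹ := by
    rw [ringInverse_apply (isUnit_partitionMap hC γ α f), partitionMap_apply]
  simp only [ContinuousMap.mul_apply] at e3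
  simp [-neg_sub, hinv, e4, mul_assoc, e1, e2]
  rw [e3]
  unfold gibbsMean
  ring

/-- Derivatives of the semi-dual functional in the potential. -/
theorem exists_hasFDerivAt_semidual_potential (hγ : 0 < γ) (hC : Continuous C) (α : Measure X)
    [IsProbabilityMeasure α] (β : Measure Y) [IsProbabilityMeasure β] :
    ∃ (D : C(X, ℝ) → C(X, ℝ) →L[ℝ] ℝ) (H : C(X, ℝ) → C(X, ℝ) →L[ℝ] C(X, ℝ) →L[ℝ] ℝ),
      (∀ f, HasFDerivAt (fun f : C(X, ℝ) => (∫ x, f x ∂α)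
        + ∫ y, softmin γ α (fun x => C (x, y) - f x) ∂β) (D f) f) ∧
      (∀ f, HasFDerivAt D (H f) f) ∧
      ∀ f g₁ g₂, H f g₁ g₂ = ∫ y,
        (-(1 / γ) * gibbsMean γ α (fun x => C (x, y) - f x) (fun x => g₁ x * g₂ x)
        + (1 / γ) * (gibbsMean γ α (fun x => C (x, y) - f x) g₁
          * gibbsMean γ α (fun x => C (x, y) - f x) g₂)) ∂β := by
  have key := exists_hasFDerivAt_gibbsMap hC γ α
  choose W hW hWe using key
  refine ⟨fun f => integralMap α - (integralMap β).comp (gibbsMap hC γ α f),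
    fun f => -((ContinuousLinearMap.compL ℝ C(X, ℝ) C(Y, ℝ) ℝ (integralMap β)).comp (W f)),
    fun f => ?_, fun f => ?_, fun f g₁ g₂ => ?_⟩
  -- The Taylor remainder of the soft minimum is at most `2 ‖h‖² / γ` for every `y`, hence also
  -- after integration against `β`.
  · rw [hasFDerivAt_iff_isLittleO_nhds_zero]
    have : (fun h : C(X, ℝ) => ‖h‖ ^ 2) =o[𝓝 0] fun h => h := by
      exact Asymptotics.isLittleO_norm_pow_id one_lt_two
    refine Asymptotics.IsBigO.trans_isLittleO (Asymptotics.IsBigO.of_bound (2 / γ)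
      (Eventually.of_forall fun h => ?_)) this
    have hb : ∀ (f : C(X, ℝ)) y, BddMeas fun x => C (x, y) - f x :=
      fun f y => Continuous.bddMeas (by fun_prop)
    have hs : ∀ f : C(X, ℝ), Integrable (fun y => softmin γ α fun x => C (x, y) - f x) β :=
      fun f => (continuous_softmin hC γ α f.continuous).bddMeas.integrable β
    have e : (∫ x, (f + h) x ∂α) + ∫ y, softmin γ α (fun x => C (x, y) - (f + h) x) ∂β
        - ((∫ x, f x ∂α) + ∫ y, softmin γ α (fun x => C (x, y) - f x) ∂β)
        - (integralMap α - (integralMap β).comp (gibbsMap hC γ α f)) h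
        = ∫ y, (softmin γ α (fun x => C (x, y) - (f + h) x)
          - softmin γ α (fun x => C (x, y) - f x)
          + gibbsMean γ α (fun x => C (x, y) - f x) h) ∂β := by
      have i1 : Integrable (fun y => gibbsMean γ α (fun x => C (x, y) - f x) h) β := by
        simp_rw [← gibbsMap_apply hC γ α f h]
        exact (gibbsMap hC γ α f h).continuous.bddMeas.integrable β
      have i2 : Integrable (fun y => softmin γ α (fun x => C (x, y) - (f + h) x)
          - softmin γ α (fun x => C (x, y) - f x)) β := (hs (f + h)).sub (hs f)
      rw [integral_add i2 i1, integral_sub (hs (f + h)) (hs f)]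
      simp only [sub_apply, ContinuousLinearMap.comp_apply, integralMap_apply, gibbsMap_apply,
        ContinuousMap.add_apply]
      rw [integral_add (f.continuous.bddMeas.integrable α) (h.continuous.bddMeas.integrable α)]
      ring
    rw [e]
    refine (norm_integral_le_of_norm_le_const (μ := β) (C := 2 * ‖h‖ ^ 2 / γ)
      (ae_of_all _ fun y => ?_)).trans ?_
    · have := abs_softmin_taylor (ρ := α) (φ := fun x => -h x) hγ (hb f y)
        (Continuous.bddMeas (by fun_prop)) (s := ‖h‖)
        (fun x => by simpa using h.norm_coe_le_norm x)
      have e2 : gibbsMean γ α (fun x => C (x, y) - f x) (fun x => -h x)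
          = -gibbsMean γ α (fun x => C (x, y) - f x) h := by
        have := gibbsMean_const_mul (γ := γ) (μ := α) (a := fun x => C (x, y) - f x) (φ := h) (-1)
        simpa using this
      rw [e2, sub_neg_eq_add] at this
      have e3 : (fun x => C (x, y) - (f + h) x) = fun x => C (x, y) - f x + -h x := by
        funext x
        simp only [ContinuousMap.add_apply]
        ring
      rw [e3]
      exact this
    · simp
      ring_nf
      rfl
  · have h1 := ((ContinuousLinearMap.compL ℝ C(X, ℝ) C(Y, ℝ) ℝ
      (integralMap β)).hasFDerivAt.comp f (hW f)).const_sub (integralMap α)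
    exact h1
  · simp only [neg_apply, ContinuousLinearMap.comp_apply, ContinuousLinearMap.compL_apply,
      integralMap_apply, hWe]
    rw [← integral_neg]
    congr 1
    funext y
    ring

end PotentialDerivatives

end SiNG

namespace SiNG

/-! ### `C²` extension of Sinkhorn potentials. -/

section ParametricIntegral

variable {W Y F : Type*} [TopologicalSpace W] [TopologicalSpace Y] [CompactSpace Y]
  [NormedAddCommGroup F] {U : Set W}

/-- Currying gives a continuous map from `U` to `C(Y, F)`, whose norm is locally bounded. -/
theorem eventually_norm_le_of_continuous (hU : IsOpen U) {f : W → Y → F}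
    (hf : Continuous fun p : U × Y => f p.1 p.2) {x₀ : W} (hx₀ : x₀ ∈ U) :
    ∃ K : ℝ, ∀ᶠ x in 𝓝 x₀, ∀ y, ‖f x y‖ ≤ K := by
  let φ : C(U, C(Y, F)) := ContinuousMap.curry ⟨_, hf⟩
  refine ⟨‖φ ⟨x₀, hx₀⟩‖ + 1, ?_⟩
  have h1 : ∀ᶠ x : U in 𝓝 ⟨x₀, hx₀⟩, ‖φ x‖ < ‖φ ⟨x₀, hx₀⟩‖ + 1 :=
    φ.continuous.norm.continuousAt.eventually_lt_const (lt_add_one _)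
  rw [nhds_subtype_eq_comap, eventually_comap] at h1
  filter_upwards [h1, hU.mem_nhds hx₀] with x hx hxU y
  exact ((φ ⟨x, hxU⟩).norm_coe_le_norm y).trans (hx ⟨x, hxU⟩ rfl).le

theorem continuousOn_integral_of_continuous [MeasurableSpace Y] [BorelSpace Y]
    (β : Measure Y) [IsProbabilityMeasure β] {f : W → Y → ℝ}
    (hf : Continuous fun p : U × Y => f p.1 p.2) : ContinuousOn (fun x => ∫ y, f x y ∂β) U := by
  rw [continuousOn_iff_continuous_domRestrict]
  exact (integralMap β).continuous.comp (ContinuousMap.curry ⟨_, hf⟩ : C(U, C(Y, ℝ))).continuous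

theorem continuousOn_gibbsMean [MeasurableSpace Y] [BorelSpace Y]
    (γ : ℝ) (β : Measure Y) [IsProbabilityMeasure β] {a φ : W → Y → ℝ}
    (ha : Continuous fun p : U × Y => a p.1 p.2) (hφ : Continuous fun p : U × Y => φ p.1 p.2) :
    ContinuousOn (fun x => gibbsMean γ β (a x) (φ x)) U := by
  refine (continuousOn_integral_of_continuous β (f := fun x y => Real.exp (-a x y / γ) * φ x y)
    ((Real.continuous_exp.comp (ha.neg.div_const γ)).mul hφ)).div (continuousOn_integral_of_continuous β
      (f := fun x y => Real.exp (-a x y / γ)) (Real.continuous_exp.comp (ha.neg.div_const γ))) fun x hx => ?_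
  have : Continuous (a x) := ha.comp (Continuous.prodMk_right (⟨x, hx⟩ : U))
  exact (partition_pos (ρ := β) this.bddMeas).ne'

end ParametricIntegral

theorem contDiffOn_two_of_hasFDerivAt {E F : Type*} [NormedAddCommGroup E] [NormedSpace ℝ E]
    [NormedAddCommGroup F] [NormedSpace ℝ F] {U : Set E} (hU : IsOpen U) {f : E → F}
    {f' : E → E →L[ℝ] F} {f'' : E → E →L[ℝ] E →L[ℝ] F} (h : ∀ x ∈ U, HasFDerivAt f (f' x) x)
    (h' : ∀ x ∈ U, HasFDerivAt f' (f'' x) x) (hc : ContinuousOn f'' U) : ContDiffOn ℝ 2 f U := by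
  rw [show (2 : WithTop ℕ∞) = 1 + 1 from rfl, contDiffOn_succ_iff_fderiv_of_isOpen hU]
  refine ⟨fun x hx => (h x hx).differentiableAt.differentiableWithinAt, by simp, ?_⟩
  rw [show (1 : WithTop ℕ∞) = 0 + 1 from rfl, contDiffOn_succ_iff_fderiv_of_isOpen hU]
  have e1 : ∀ x ∈ U, fderiv ℝ f x = f' x := fun x hx => (h x hx).fderiv
  have e2 : ∀ x ∈ U, HasFDerivAt (fderiv ℝ f) (f'' x) x := fun x hx =>
    (h' x hx).congr_of_eventuallyEq (by filter_upwards [hU.mem_nhds hx] with y hy using e1 y hy)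
  refine ⟨fun x hx => (e2 x hx).differentiableAt.differentiableWithinAt, by simp, ?_⟩
  rw [contDiffOn_zero]
  exact hc.congr fun x hx => (e2 x hx).fderiv

/-- A function of class `C²` on an open set has a second derivative there. -/
theorem _root_.ContDiffOn.hasFDerivAt_two {E F : Type*} [NormedAddCommGroup E] [NormedSpace ℝ E]
    [NormedAddCommGroup F] [NormedSpace ℝ F] {U : Set E} {f : E → F} (h : ContDiffOn ℝ 2 f U)
    (hU : IsOpen U) {x : E} (hx : x ∈ U) :
    HasFDerivAt f (fderiv ℝ f x) x ∧ HasFDerivAt (fderiv ℝ f) (D2 f x) x := by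
  refine ⟨((h.differentiableOn (by norm_num)).differentiableAt (hU.mem_nhds hx)).hasFDerivAt, ?_⟩
  have := (contDiffOn_succ_iff_fderiv_of_isOpen (n := 1) hU).1 h
  exact ((this.2.2.differentiableOn (by norm_num)).differentiableAt (hU.mem_nhds hx)).hasFDerivAt

theorem _root_.ContDiffOn.continuousOn_two {E F : Type*} [NormedAddCommGroup E] [NormedSpace ℝ E]
    [NormedAddCommGroup F] [NormedSpace ℝ F] {U : Set E} {f : E → F} (h : ContDiffOn ℝ 2 f U)
    (hU : IsOpen U) : ContinuousOn (fderiv ℝ f) U ∧ ContinuousOn (D2 f) U := by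
  have := ((contDiffOn_succ_iff_fderiv_of_isOpen (n := 1) hU).1 h).2.2
  exact ⟨this.continuousOn, this.continuousOn_fderiv_of_isOpen hU (by norm_num)⟩

theorem DiffFamily.const {E Y F : Type*} [NormedAddCommGroup E] [NormedSpace ℝ E]
    [NormedAddCommGroup F] [NormedSpace ℝ F] [MeasurableSpace Y] {Θ : Set E} (hΘ : IsOpen Θ)
    {g : Y → F} (hg : StronglyMeasurable g) {K : ℝ} (hK : ∀ y, ‖g y‖ ≤ K) :
    DiffFamily Θ (fun _ => g) (fun _ _ => 0) where
  isOpen := hΘ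
  meas _ _ := hg
  deriv θ _ y := hasFDerivAt_const (g y) θ
  bdd _ _ := ⟨K, Eventually.of_forall fun θ y =>
    ⟨hK y, by simpa using (norm_nonneg _).trans (hK y)⟩⟩

section SmoothCost

variable {q : ℕ} {X U : Set (EuclideanSpace ℝ (Fin q))} [CompactSpace X]
  {c : EuclideanSpace ℝ (Fin q) → EuclideanSpace ℝ (Fin q) → ℝ}

omit [CompactSpace X] in
theorem continuous_restrict_prod {F : Type*} [TopologicalSpace F]
    {G : EuclideanSpace ℝ (Fin q) × EuclideanSpace ℝ (Fin q) → F} (hG : ContinuousOn G (U ×ˢ X)) :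
    Continuous fun p : U × X => G (p.1, p.2) :=
  hG.comp_continuous (by fun_prop) fun p => ⟨p.1.2, p.2.2⟩

omit [CompactSpace X] in
theorem IsC2Cost.continuous (hc : IsC2Cost X U c) (hXU : X ⊆ U) :
    Continuous fun p : X × X => c p.1 p.2 :=
  hc.1.comp_continuous (f := fun p : X × X => ((p.1 : EuclideanSpace ℝ (Fin q)),
    (p.2 : EuclideanSpace ℝ (Fin q)))) (by fun_prop) fun p => ⟨hXU p.1.2, p.2.2⟩

theorem IsC2Cost.diffFamily (hc : IsC2Cost X U c) (hU : IsOpen U) :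
    DiffFamily U (fun x (y : X) => c x y) (fun x y => fderiv ℝ (fun x => c x y) x) ∧
      DiffFamily U (fun x (y : X) => fderiv ℝ (fun x => c x y) x)
        (fun x y => D2 (fun x => c x y) x) := by
  obtain ⟨h0, hd, h1, h2⟩ := hc
  have c0 := continuous_restrict_prod h0
  have c1 := continuous_restrict_prod h1
  have c2 := continuous_restrict_prod h2
  have b0 := fun x₀ hx₀ => eventually_norm_le_of_continuous hU (f := fun x (y : X) => c x y) c0
    (x₀ := x₀) hx₀
  have b1 := fun x₀ hx₀ => eventually_norm_le_of_continuous hU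
    (f := fun x (y : X) => fderiv ℝ (fun x => c x y) x) c1 (x₀ := x₀) hx₀
  have b2 := fun x₀ hx₀ => eventually_norm_le_of_continuous hU
    (f := fun x (y : X) => D2 (fun x => c x y) x) c2 (x₀ := x₀) hx₀
  refine ⟨⟨hU, fun x hx => ?_, fun x hx y => ((hd y y.2).hasFDerivAt_two hU hx).1, fun x hx => ?_⟩,
    ⟨hU, fun x hx => ?_, fun x hx y => ((hd y y.2).hasFDerivAt_two hU hx).2, fun x hx => ?_⟩⟩
  · exact (c0.comp (Continuous.prodMk_right (⟨x, hx⟩ : U))).stronglyMeasurable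
  · obtain ⟨K, hK⟩ := b0 x hx
    obtain ⟨K', hK'⟩ := b1 x hx
    exact ⟨max K K', (hK.and hK').mono fun x' h y =>
      ⟨(h.1 y).trans (le_max_left _ _), (h.2 y).trans (le_max_right _ _)⟩⟩
  · exact (c1.comp (Continuous.prodMk_right (⟨x, hx⟩ : U))).stronglyMeasurable
  · obtain ⟨K, hK⟩ := b1 x hx
    obtain ⟨K', hK'⟩ := b2 x hx
    exact ⟨max K K', (hK.and hK').mono fun x' h y =>
      ⟨(h.1 y).trans (le_max_left _ _), (h.2 y).trans (le_max_right _ _)⟩⟩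

/-- Soft minima of a smooth cost are smooth. -/
theorem IsC2Cost.contDiffOn_softmin (hc : IsC2Cost X U c) (hU : IsOpen U) {γ : ℝ} (hγ : 0 < γ)
    (β : Measure X) [IsProbabilityMeasure β] (g : C(X, ℝ)) :
    ContDiffOn ℝ 2 (fun x => softmin γ β fun y : X => c x y - g y) U := by
  obtain ⟨d0, d1⟩ := hc.diffFamily hU
  -- The point `x ∈ U` plays the role of the parameter and `y` is integrated out; `Unit` is the
  -- trivial leftover coordinate.
  have e0 := (d0.sub (DiffFamily.const hU g.continuous.stronglyMeasurable
    fun y => g.norm_coe_le_norm y)).comp_measurable (Y' := X × Unit) measurable_fst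
  have e1 := d1.comp_measurable (Y' := X × Unit) measurable_fst
  have e0' := e0.of_eventually (Ψ₁' := fun x (y : X × Unit) => fderiv ℝ (fun x => c x y.1) x)
    (fun θ _ => rfl) fun θ _ => by
      funext y
      simp
  obtain ⟨M', M'', hM, hM', -, hM''⟩ := e0'.exists_softmin₂ e1 hγ β
  refine contDiffOn_two_of_hasFDerivAt hU (fun x hx => hM.deriv x hx ())
    (fun x hx => hM'.deriv x hx ()) ?_
  have c0 := continuous_restrict_prod hc.1
  have c1 := continuous_restrict_prod hc.2.2.1
  have c2 := continuous_restrict_prod hc.2.2.2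
  have ca : Continuous fun p : U × X => c p.1 p.2 - g p.2 := c0.sub (by fun_prop)
  have c1' : ∀ v, Continuous fun p : U × X => fderiv ℝ (fun x => c x p.2) (p.1 : _) v :=
    fun v => c1.clm_apply continuous_const
  have c2' : ∀ v w, Continuous fun p : U × X => D2 (fun x => c x p.2) (p.1 : _) v w :=
    fun v w => (c2.clm_apply continuous_const).clm_apply continuous_const
  -- Differentiable families carry no continuity of the second derivative. It is read off the
  -- explicit formula `hM''`, direction by direction.
  rw [continuousOn_clm_apply]
  intro v
  rw [continuousOn_clm_apply]
  intro w
  refine ContinuousOn.congr ?_ fun x hx => hM'' x hx () v w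
  exact ((continuousOn_gibbsMean γ β (a := fun x (y : X) => c x y - g y)
      (φ := fun x (y : X) => D2 (fun x => c x y) x v w) ca (c2' v w)).sub
    (continuousOn_const.mul (continuousOn_gibbsMean γ β (a := fun x (y : X) => c x y - g y)
      (φ := fun x (y : X) => fderiv ℝ (fun x => c x y) x v * fderiv ℝ (fun x => c x y) x w) ca
      ((c1' v).mul (c1' w))))).add
    (continuousOn_const.mul ((continuousOn_gibbsMean γ β (a := fun x (y : X) => c x y - g y)
      (φ := fun x (y : X) => fderiv ℝ (fun x => c x y) x v) ca (c1' v)).mul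
      (continuousOn_gibbsMean γ β (a := fun x (y : X) => c x y - g y)
      (φ := fun x (y : X) => fderiv ℝ (fun x => c x y) x w) ca (c1' w))))

end SmoothCost

end SiNG

namespace SiNG

/-! ### Composition of costs and potentials with the parametrized maps. -/

section ParametrizedMaps

variable {q d : ℕ} {X U : Set (EuclideanSpace ℝ (Fin q))} [CompactSpace X] {Z : Type*}
  [MeasurableSpace Z] {Θ : Set (EuclideanSpace ℝ (Fin d))}
  {T : EuclideanSpace ℝ (Fin d) → Z → X}
  {c : EuclideanSpace ℝ (Fin q) → EuclideanSpace ℝ (Fin q) → ℝ}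

theorem IsC2Param.diffFamily (hT : IsC2Param Θ T) (hΘ : IsOpen Θ) :
    DiffFamily Θ (fun θ z => (T θ z : EuclideanSpace ℝ (Fin q))) (jac T) ∧
      DiffFamily Θ (jac T) (jac2 T) := by
  have hX : IsCompact X := isCompact_iff_compactSpace.2 inferInstance
  obtain ⟨K, hK⟩ := hX.exists_bound_of_continuousOn continuousOn_id
  have h1 : DiffFamily Θ (fun θ z => (T θ z : EuclideanSpace ℝ (Fin q))) (jac T) := by
    refine ⟨hΘ, fun θ hθ => (measurable_subtype_coe.comp (hT.1 θ hθ)).stronglyMeasurable,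
      fun θ hθ z => ((hT.2.1 z).hasFDerivAt_two hΘ hθ).1, fun θ hθ => ?_⟩
    obtain ⟨G, hG⟩ := hT.2.2 θ hθ
    exact ⟨max K G, hG.mono fun θ' h z => ⟨(hK _ (T θ' z).2).trans (le_max_left _ _),
      (h z).1.trans (le_max_right _ _)⟩⟩
  exact ⟨h1, hΘ, fun θ hθ => h1.meas_deriv hθ, fun θ hθ z =>
    ((hT.2.1 z).hasFDerivAt_two hΘ hθ).2, hT.2.2⟩

omit [CompactSpace X] in
theorem stronglyMeasurable_comp_map {F : Type*} [TopologicalSpace F] {G : X → F}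
    (hG : Continuous G) {θ : EuclideanSpace ℝ (Fin d)} (hT : Measurable (T θ)) :
    StronglyMeasurable fun z => G (T θ z) :=
  hG.comp_stronglyMeasurable hT.stronglyMeasurable

theorem IsC2Param.exists_comp (hT : IsC2Param Θ T) (hΘ : IsOpen Θ)
    {F : EuclideanSpace ℝ (Fin q) → ℝ} {V : Set (EuclideanSpace ℝ (Fin q))} (hV : IsOpen V)
    (hXV : X ⊆ V) (hF : ContDiffOn ℝ 2 F V) :
    ∃ N'', DiffFamily Θ (fun θ z => F (T θ z))
        (fun θ z => (fderiv ℝ F (T θ z)).comp (jac T θ z)) ∧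
      DiffFamily Θ (fun θ z => (fderiv ℝ F (T θ z)).comp (jac T θ z)) N'' ∧
      ∀ θ z v w, N'' θ z v w = D2 F (T θ z) (jac T θ z v) (jac T θ z w)
        + fderiv ℝ F (T θ z) (jac2 T θ z v w) := by
  obtain ⟨hS, hS'⟩ := hT.diffFamily hΘ
  have hX : IsCompact X := isCompact_iff_compactSpace.2 inferInstance
  obtain ⟨c1, c2⟩ := hF.continuousOn_two hV
  obtain ⟨K₀, hK₀⟩ := hX.exists_bound_of_continuousOn (hF.continuousOn.mono hXV)
  obtain ⟨K₁, hK₁⟩ := hX.exists_bound_of_continuousOn (c1.mono hXV)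
  obtain ⟨K₂, hK₂⟩ := hX.exists_bound_of_continuousOn (c2.mono hXV)
  obtain ⟨N'', hN'', e⟩ := hS.chain₂ hS' (G' := fun _ => fderiv ℝ F) (G'' := fun _ => D2 F) (K := X)
    (fun θ _ z => (T θ z).2) (fun _ x hx => (hF.hasFDerivAt_two hV (hXV hx)).2)
    (fun θ hθ => stronglyMeasurable_comp_map (G := fun x : X => fderiv ℝ F x)
      ((c1.mono hXV).domRestrict) (hT.1 θ hθ)) (C := max K₁ K₂)
    (fun _ x hx => ⟨(hK₁ x hx).trans (le_max_left _ _), (hK₂ x hx).trans (le_max_right _ _)⟩)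
  exact ⟨N'', hS.chain (G := fun _ => F) (K := X) (C := max K₀ K₁)
    (fun θ _ z => (T θ z).2) (fun _ x hx => (hF.hasFDerivAt_two hV (hXV hx)).1)
    (fun θ hθ => stronglyMeasurable_comp_map (G := fun x : X => F x)
      ((hF.continuousOn.mono hXV).domRestrict) (hT.1 θ hθ))
    (fun _ x hx => ⟨(hK₀ x hx).trans (le_max_left _ _), (hK₁ x hx).trans (le_max_right _ _)⟩),
    hN'', e⟩

/-- The cost between a moving point and a fixed point. -/
theorem IsC2Cost.exists_comp_left (hc : IsC2Cost X U c) (hU : IsOpen U) (hXU : X ⊆ U)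
    (hT : IsC2Param Θ T) (hΘ : IsOpen Θ) :
    ∃ C'', DiffFamily Θ (fun θ (p : Z × X) => c (T θ p.1) p.2)
        (fun θ p => (fderiv ℝ (fun x => c x p.2) (T θ p.1)).comp (jac T θ p.1)) ∧
      DiffFamily Θ (fun θ (p : Z × X) =>
        (fderiv ℝ (fun x => c x p.2) (T θ p.1)).comp (jac T θ p.1)) C'' ∧
      ∀ θ p v w, C'' θ p v w = D2 (fun x => c x p.2) (T θ p.1) (jac T θ p.1 v) (jac T θ p.1 w)
        + fderiv ℝ (fun x => c x p.2) (T θ p.1) (jac2 T θ p.1 v w) := by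
  obtain ⟨hS, hS'⟩ := hT.diffFamily hΘ
  have hX : IsCompact X := isCompact_iff_compactSpace.2 inferInstance
  have hs : X ×ˢ X ⊆ U ×ˢ X := Set.prod_mono hXU le_rfl
  obtain ⟨k0, hd, k1, k2⟩ := hc
  obtain ⟨K₀, hK₀⟩ := (hX.prod hX).exists_bound_of_continuousOn (k0.mono hs)
  obtain ⟨K₁, hK₁⟩ := (hX.prod hX).exists_bound_of_continuousOn (k1.mono hs)
  obtain ⟨K₂, hK₂⟩ := (hX.prod hX).exists_bound_of_continuousOn (k2.mono hs)
  have hm : ∀ θ ∈ Θ, StronglyMeasurable fun p : Z × X => (T θ p.1, p.2) := fun θ hθ =>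
    (((hT.1 θ hθ).comp measurable_fst).prodMk measurable_snd).stronglyMeasurable
  have hr : Continuous fun p : X × X =>
      ((p.1 : EuclideanSpace ℝ (Fin q)), (p.2 : EuclideanSpace ℝ (Fin q))) := by fun_prop
  have q0 := k0.comp_continuous hr fun p => ⟨hXU p.1.2, p.2.2⟩
  have q1 := k1.comp_continuous hr fun p => ⟨hXU p.1.2, p.2.2⟩
  obtain ⟨C'', hC'', e⟩ := (hS.comp_measurable (Y' := Z × X) measurable_fst).chain₂
    (hS'.comp_measurable measurable_fst)
    (G' := fun p => fderiv ℝ fun x => c x p.2) (G'' := fun p => D2 fun x => c x p.2) (K := X)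
    (fun θ _ p => (T θ p.1).2) (fun p x hx => ((hd p.2 p.2.2).hasFDerivAt_two hU (hXU hx)).2)
    (fun θ hθ => q1.comp_stronglyMeasurable (hm θ hθ)) (C := max K₁ K₂)
    (fun p x hx => ⟨(hK₁ (x, p.2) ⟨hx, p.2.2⟩).trans (le_max_left _ _),
      (hK₂ (x, p.2) ⟨hx, p.2.2⟩).trans (le_max_right _ _)⟩)
  exact ⟨C'', (hS.comp_measurable (Y' := Z × X) measurable_fst).chain
    (G := fun p x => c x p.2) (G' := fun p => fderiv ℝ fun x => c x p.2) (K := X)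
    (C := max K₀ K₁) (fun θ _ p => (T θ p.1).2)
    (fun p x hx => ((hd p.2 p.2.2).hasFDerivAt_two hU (hXU hx)).1)
    (fun θ hθ => q0.comp_stronglyMeasurable (hm θ hθ))
    (fun p x hx => ⟨(hK₀ (x, p.2) ⟨hx, p.2.2⟩).trans (le_max_left _ _),
      (hK₁ (x, p.2) ⟨hx, p.2.2⟩).trans (le_max_right _ _)⟩), hC'', e⟩

theorem IsC2Param.exists_prod (hT : IsC2Param Θ T) (hΘ : IsOpen Θ) :
    ∃ S'', DiffFamily Θ (fun θ (p : Z × Z) =>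
        ((T θ p.1 : EuclideanSpace ℝ (Fin q)), (T θ p.2 : EuclideanSpace ℝ (Fin q))))
        (fun θ p => (jac T θ p.1).prod (jac T θ p.2)) ∧
      DiffFamily Θ (fun θ (p : Z × Z) => (jac T θ p.1).prod (jac T θ p.2)) S'' ∧
      ∀ θ p v w, S'' θ p v w = (jac2 T θ p.1 v w, jac2 T θ p.2 v w) := by
  obtain ⟨hS, hS'⟩ := hT.diffFamily hΘ
  let L := ContinuousLinearMap.inl ℝ (EuclideanSpace ℝ (Fin q)) (EuclideanSpace ℝ (Fin q))
  let R := ContinuousLinearMap.inr ℝ (EuclideanSpace ℝ (Fin q)) (EuclideanSpace ℝ (Fin q))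
  have h1 := ((hS.comp_measurable (Y' := Z × Z) measurable_fst).clm L).add
    ((hS.comp_measurable (Y' := Z × Z) measurable_snd).clm R)
  have h2 := ((hS'.comp_measurable (Y' := Z × Z) measurable_fst).clm
      (ContinuousLinearMap.compL ℝ (EuclideanSpace ℝ (Fin d)) _ _ L)).add
    ((hS'.comp_measurable (Y' := Z × Z) measurable_snd).clm
      (ContinuousLinearMap.compL ℝ (EuclideanSpace ℝ (Fin d)) _ _ R))
  have e : ∀ θ ∈ Θ, (fun p : Z × Z => L.comp (jac T θ p.1) + R.comp (jac T θ p.2))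
      = fun p => (jac T θ p.1).prod (jac T θ p.2) := fun θ _ => by
    funext p
    ext v <;> simp [L, R]
  refine ⟨_, h1.of_eventually (fun θ _ => ?_) e, h2.of_eventually e (fun θ _ => rfl), ?_⟩
  · funext p
    simp [L, R]
  · intro θ p v w
    simp [L, R]

/-- The cost between two moving points. -/
theorem IsC2Param.exists_comp_prod (hT : IsC2Param Θ T) (hΘ : IsOpen Θ) (hU : IsOpen U)
    (hXU : X ⊆ U) {G : EuclideanSpace ℝ (Fin q) × EuclideanSpace ℝ (Fin q) → ℝ}
    (hG : ContDiffOn ℝ 2 G (U ×ˢ U)) :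
    ∃ C'', DiffFamily Θ (fun θ (p : Z × Z) => G (T θ p.1, T θ p.2))
        (fun θ p => (fderiv ℝ G (T θ p.1, T θ p.2)).comp ((jac T θ p.1).prod (jac T θ p.2))) ∧
      DiffFamily Θ (fun θ (p : Z × Z) =>
        (fderiv ℝ G (T θ p.1, T θ p.2)).comp ((jac T θ p.1).prod (jac T θ p.2))) C'' ∧
      ∀ θ p v w, C'' θ p v w = D2 G (T θ p.1, T θ p.2) (jac T θ p.1 v, jac T θ p.2 v)
          (jac T θ p.1 w, jac T θ p.2 w)
        + fderiv ℝ G (T θ p.1, T θ p.2) (jac2 T θ p.1 v w, jac2 T θ p.2 v w) := by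
  obtain ⟨S'', hS, hS', eS⟩ := hT.exists_prod hΘ
  have hX : IsCompact X := isCompact_iff_compactSpace.2 inferInstance
  have hs : X ×ˢ X ⊆ U ×ˢ U := Set.prod_mono hXU hXU
  have hUU : IsOpen (U ×ˢ U) := hU.prod hU
  obtain ⟨k1, k2⟩ := hG.continuousOn_two hUU
  have k0 := hG.continuousOn
  obtain ⟨K₀, hK₀⟩ := (hX.prod hX).exists_bound_of_continuousOn (k0.mono hs)
  obtain ⟨K₁, hK₁⟩ := (hX.prod hX).exists_bound_of_continuousOn (k1.mono hs)
  obtain ⟨K₂, hK₂⟩ := (hX.prod hX).exists_bound_of_continuousOn (k2.mono hs)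
  have hm : ∀ θ ∈ Θ, StronglyMeasurable fun p : Z × Z => (T θ p.1, T θ p.2) := fun θ hθ =>
    (((hT.1 θ hθ).comp measurable_fst).prodMk ((hT.1 θ hθ).comp measurable_snd)).stronglyMeasurable
  have hr : Continuous fun p : X × X =>
      ((p.1 : EuclideanSpace ℝ (Fin q)), (p.2 : EuclideanSpace ℝ (Fin q))) := by fun_prop
  have q0 := k0.comp_continuous hr fun p => ⟨hXU p.1.2, hXU p.2.2⟩
  have q1 := k1.comp_continuous hr fun p => ⟨hXU p.1.2, hXU p.2.2⟩
  obtain ⟨C'', hC'', e⟩ := hS.chain₂ hS' (G' := fun _ => fderiv ℝ G) (G'' := fun _ => D2 G)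
    (K := X ×ˢ X) (fun θ _ p => ⟨(T θ p.1).2, (T θ p.2).2⟩)
    (fun p x hx => (hG.hasFDerivAt_two hUU (hs hx)).2)
    (fun θ hθ => q1.comp_stronglyMeasurable (hm θ hθ)) (C := max K₁ K₂)
    (fun p x hx => ⟨(hK₁ x hx).trans (le_max_left _ _), (hK₂ x hx).trans (le_max_right _ _)⟩)
  refine ⟨C'', hS.chain (G := fun _ => G) (K := X ×ˢ X) (C := max K₀ K₁)
    (fun θ _ p => ⟨(T θ p.1).2, (T θ p.2).2⟩)
    (fun p x hx => (hG.hasFDerivAt_two hUU (hs hx)).1)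
    (fun θ hθ => q0.comp_stronglyMeasurable (hm θ hθ))
    (fun p x hx => ⟨(hK₀ x hx).trans (le_max_left _ _), (hK₁ x hx).trans (le_max_right _ _)⟩),
    hC'', fun θ p v w => ?_⟩
  rw [e, eS]
  rfl

/-- The parametrized map extended by the identity on `X`; the resulting maps are onto `X`. -/
def augment (T : EuclideanSpace ℝ (Fin d) → Z → X) (θ : EuclideanSpace ℝ (Fin d)) : Z ⊕ X → X :=
  Sum.elim (T θ) id

omit [CompactSpace X] in
theorem IsC2Param.augment (hT : IsC2Param Θ T) : IsC2Param Θ (augment T) := by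
  have h0 : ∀ (x : X), (fun θ => (SiNG.augment T θ (Sum.inr x) : EuclideanSpace ℝ (Fin q)))
      = fun _ => (x : EuclideanSpace ℝ (Fin q)) := fun x => rfl
  have j0 : ∀ θ (x : X), jac (SiNG.augment T) θ (Sum.inr x) = 0 := fun θ x => by
    rw [jac, h0]
    simp
  have j1 : ∀ θ (x : X), jac2 (SiNG.augment T) θ (Sum.inr x) = 0 := fun θ x => by
    rw [jac2, D2, h0]
    simp
  refine ⟨fun θ hθ => (hT.1 θ hθ).sumElim measurable_id, ?_, fun θ hθ => ?_⟩
  · rintro (z | x)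
    · exact hT.2.1 z
    · rw [h0]
      exact contDiffOn_const
  · obtain ⟨G, hG⟩ := hT.2.2 θ hθ
    refine ⟨max G 0, hG.mono fun θ' h => ?_⟩
    rintro (z | x)
    · exact ⟨(h z).1.trans (le_max_left _ _), (h z).2.trans (le_max_left _ _)⟩
    · rw [j0, j1]
      simp

-- The added copy of `X` has no mass, so the marginal is unchanged; it only lets estimates uniform
-- in the index reach every point of `X`, on and off the support.
omit [CompactSpace X] in
theorem pushα_augment {θ : EuclideanSpace ℝ (Fin d)} (hT : Measurable (T θ)) (μ : Measure Z) :
    pushα (augment T) (μ.map Sum.inl) θ = pushα T μ θ :=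
  Measure.map_map (g := augment T θ) (hT.sumElim measurable_id) measurable_inl

end ParametrizedMaps

end SiNG

namespace SiNG

/-! ### Second derivatives, and Sinkhorn potentials as Schrödinger systems. -/

section SecondDerivative

variable {V W : Type*} [NormedAddCommGroup V] [NormedSpace ℝ V] [NormedAddCommGroup W]
  [NormedSpace ℝ W]

/-- `F` is twice differentiable at `x` with second derivative `H`. -/
def HasD2At (F : V → W) (H : V →L[ℝ] V →L[ℝ] W) (x : V) : Prop :=
  ∃ D : V → V →L[ℝ] W, (∀ᶠ y in 𝓝 x, HasFDerivAt F (D y) y) ∧ HasFDerivAt D H x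

namespace HasD2At

variable {F G : V → W} {H K : V →L[ℝ] V →L[ℝ] W} {x : V}

theorem hasFDerivAt_fderiv (h : HasD2At F H x) : HasFDerivAt (fderiv ℝ F) H x := by
  obtain ⟨D, h1, h2⟩ := h
  exact h2.congr_of_eventuallyEq (h1.mono fun y hy => hy.fderiv)

theorem twiceDifferentiableAt (h : HasD2At F H x) : TwiceDifferentiableAt F x :=
  ⟨h.choose_spec.1.mono fun _ hy => hy.differentiableAt, h.hasFDerivAt_fderiv.differentiableAt⟩

theorem D2_eq (h : HasD2At F H x) : D2 F x = H :=
  h.hasFDerivAt_fderiv.fderiv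

theorem congr_of_eventuallyEq (h : HasD2At F H x) (hFG : G =ᶠ[𝓝 x] F) : HasD2At G H x := by
  obtain ⟨D, h1, h2⟩ := h
  refine ⟨D, ?_, h2⟩
  filter_upwards [h1, hFG.eventuallyEq_nhds] with y hy hy'
  exact hy.congr_of_eventuallyEq hy'

theorem sub (h : HasD2At F H x) (k : HasD2At G K x) :
    HasD2At (fun y => F y - G y) (H - K) x := by
  obtain ⟨D, h1, h2⟩ := h
  obtain ⟨D', k1, k2⟩ := k
  exact ⟨fun y => D y - D' y, (h1.and k1).mono fun y hy => hy.1.sub hy.2, h2.sub k2⟩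

theorem const_smul (h : HasD2At F H x) (a : ℝ) : HasD2At (fun y => a • F y) (a • H) x := by
  obtain ⟨D, h1, h2⟩ := h
  exact ⟨fun y => a • D y, h1.mono fun y hy => hy.const_smul a, h2.const_smul a⟩

theorem sub_const (h : HasD2At F H x) (b : W) : HasD2At (fun y => F y - b) H x := by
  obtain ⟨D, h1, h2⟩ := h
  exact ⟨D, h1.mono fun y hy => hy.sub_const b, h2⟩

theorem of_isOpen {U : Set V} (hU : IsOpen U) (hx : x ∈ U) {D : V → V →L[ℝ] W}
    (h1 : ∀ y ∈ U, HasFDerivAt F (D y) y) (h2 : HasFDerivAt D H x) : HasD2At F H x :=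
  ⟨D, by filter_upwards [hU.mem_nhds hx] with y hy using h1 y hy, h2⟩

end HasD2At

end SecondDerivative

section PushForwardSystem

variable {A B I J : Type*} [MeasurableSpace A] [MeasurableSpace B] [MeasurableSpace I]
  [MeasurableSpace J] {γ : ℝ} {μ : Measure I} {ν : Measure J}

theorem softmin_map {S : I → A} (hS : Measurable S) {a : A → ℝ} (ha : BddMeas a) :
    softmin γ (μ.map S) a = softmin γ μ fun i => a (S i) := by
  rw [softmin, integral_map hS.aemeasurable (ha.gibbs γ).meas.aestronglyMeasurable]
  rfl

theorem gibbsMean_map {S : I → A} (hS : Measurable S) {a φ : A → ℝ} (ha : BddMeas a)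
    (hφ : BddMeas φ) :
    gibbsMean γ (μ.map S) a φ = gibbsMean γ μ (fun i => a (S i)) fun i => φ (S i) := by
  rw [gibbsMean, integral_map hS.aemeasurable ((ha.gibbs γ).mul hφ).meas.aestronglyMeasurable,
    integral_map hS.aemeasurable (ha.gibbs γ).meas.aestronglyMeasurable]
  rfl

theorem Schrodinger.of_map {S : I → A} {R : J → B} (hS : Measurable S) (hR : Measurable R)
    {C : A × B → ℝ} {f : A → ℝ} {g : B → ℝ} (hC : BddMeas C)
    (h : Schrodinger γ (μ.map S) (ν.map R) C f g) :
    Schrodinger γ μ ν (fun p => C (S p.1, R p.2)) (fun i => f (S i)) (fun j => g (R j)) where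
  left := h.left.comp hS
  right := h.right.comp hR
  left_eq i := (h.left_eq (S i)).trans (softmin_map hR (Schrodinger.bddMeas_right hC h (S i)))
  right_eq j := (h.right_eq (R j)).trans (softmin_map hS (Schrodinger.bddMeas_left hC h (R j)))

end PushForwardSystem

section SinkhornPotentials

variable {q : ℕ} {X : Set (EuclideanSpace ℝ (Fin q))} {γ : ℝ}
  {c : EuclideanSpace ℝ (Fin q) → EuclideanSpace ℝ (Fin q) → ℝ} {α β : Measure X}

theorem sinkhornMap_eq (f : X → ℝ) (y : EuclideanSpace ℝ (Fin q)) :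
    sinkhornMap γ c f α y = softmin γ α fun x : X => c x y - f x := by
  unfold sinkhornMap softmin
  congr 3
  funext x
  ring_nf

theorem H1_eq (f : X → ℝ) : H1 γ c f α β
    = (∫ x, f x ∂α) + ∫ y : X, softmin γ α (fun x : X => c x y - f x) ∂β := by
  unfold H1
  simp_rw [sinkhornMap_eq]

variable [CompactSpace X] (hγ : 0 < γ) (hc : Continuous fun p : X × X => c p.1 p.2)
  [IsProbabilityMeasure α] [IsProbabilityMeasure β]

-- Only the fixed-point half of the definition enters; it gives the equations on all of `X`.
include hc in
omit [IsProbabilityMeasure α] [IsProbabilityMeasure β] in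
theorem IsSinkhornPotential.schrodinger [IsProbabilityMeasure α] {f : C(X, ℝ)}
    (hf : IsSinkhornPotential γ c f α β) :
    Schrodinger γ α β (fun p : X × X => c p.1 p.2) f (fun y => sinkhornMap γ c f α y) where
  left := f.continuous.bddMeas
  right := by
    simp_rw [sinkhornMap_eq]
    exact (continuous_softmin hc γ α f.continuous).bddMeas
  left_eq x := by
    rw [← hf.2 x, sinkhornB, sinkhornMap_eq]
  right_eq y := sinkhornMap_eq f y

-- Conversely, maximality is automatic for solutions of the system, by concavity of the dual.
include hγ hc in
theorem Schrodinger.isSinkhornPotential {f : C(X, ℝ)}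
    (S : Schrodinger γ α β (fun p : X × X => c p.1 p.2) f (softminMap hc γ α f)) :
    IsSinkhornPotential γ c f α β := by
  have e : ∀ y : X, sinkhornMap γ c f α y = softminMap hc γ α f y := fun y => sinkhornMap_eq f y
  refine ⟨fun f' g' => ?_, fun x => ?_⟩
  · simp_rw [e]
    exact S.dual_le hγ hc.bddMeas f'.continuous.bddMeas g'.continuous.bddMeas
  · rw [sinkhornB, sinkhornMap_eq, S.left_eq]
    simp_rw [e]

include hγ hc in
theorem IsSinkhornPotential.OT_eq_H1 {f : C(X, ℝ)} (hf : IsSinkhornPotential γ c f α β) :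
    OT γ c α β = H1 γ c f α β :=
  ((hf.schrodinger hc).isLeast hγ hc.bddMeas).csInf_eq

include hγ hc in
theorem existsUnique_sinkhornPotential (x₀ : X) :
    ∃! f : C(X, ℝ), IsSinkhornPotential γ c f α β ∧ f x₀ = 0 := by
  obtain ⟨f, h0, S⟩ := exists_schrodinger hγ hc α β x₀
  refine ⟨f, ⟨S.isSinkhornPotential hγ hc, h0⟩, fun f' hf' => ?_⟩
  ext x
  exact S.eq_of_normalized hγ hc.bddMeas (hf'.1.schrodinger hc) (hf'.2.trans h0.symm) x

omit [CompactSpace X] [IsProbabilityMeasure α] [IsProbabilityMeasure β] in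
theorem closedD11_eq (f g₁ g₂ : X → ℝ) : closedD11 γ c α β f g₁ g₂ = ∫ y : X,
    (-(1 / γ) * gibbsMean γ α (fun x : X => c x y - f x) (fun x => g₁ x * g₂ x)
      + (1 / γ) * (gibbsMean γ α (fun x : X => c x y - f x) g₁
        * gibbsMean γ α (fun x : X => c x y - f x) g₂)) ∂β := by
  have e : ∀ x y : X, Real.exp (-c x y / γ) * Real.exp (f x / γ)
      = Real.exp (-(c x y - f x) / γ) := fun x y => by
    rw [← Real.exp_add]
    ring_nf
  simp only [closedD11, gibbsMean, e, mul_assoc]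
  congr 1
  funext y
  simp only [div_eq_mul_inv, mul_inv]
  ring

include hγ hc in
theorem exists_hasD2At_H1 (f : C(X, ℝ)) :
    ∃ H : C(X, ℝ) →L[ℝ] C(X, ℝ) →L[ℝ] ℝ, HasD2At (fun k : C(X, ℝ) => H1 γ c k α β) H f ∧
      ∀ g₁ g₂ : C(X, ℝ), H g₁ g₂ = closedD11 γ c α β f g₁ g₂ := by
  obtain ⟨D, H, h1, h2, h3⟩ := exists_hasFDerivAt_semidual_potential hγ hc α β
  simp_rw [H1_eq]
  exact ⟨H f, ⟨D, Eventually.of_forall h1, h2 f⟩, fun g₁ g₂ => by rw [h3, closedD11_eq]⟩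

theorem IsSinkhornPotential.isC2Extension {U : Set (EuclideanSpace ℝ (Fin q))} (hU : IsOpen U)
    (hXU : X ⊆ U) (hγ : 0 < γ) (hc : IsC2Cost X U c) {f : C(X, ℝ)}
    (hf : IsSinkhornPotential γ c f α β) : IsC2Extension f (sinkhornB γ c f α β) := by
  refine ⟨hf.2, U, hU, hXU, ?_⟩
  refine (hc.contDiffOn_softmin hU hγ β (softminMap (hc.continuous hXU) γ α f)).congr fun x _ => ?_
  rw [sinkhornB, sinkhornMap_eq]
  simp_rw [sinkhornMap_eq]
  rfl

end SinkhornPotentials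

end SiNG

namespace SiNG

theorem Schrodinger.add_const {I J : Type*} [MeasurableSpace I] [MeasurableSpace J] {γ : ℝ}
    {μ : Measure I} {ν : Measure J} [IsProbabilityMeasure μ] [IsProbabilityMeasure ν]
    {C : I × J → ℝ} {φ : I → ℝ} {ψ : J → ℝ} (hγ : 0 < γ) (hC : BddMeas C)
    (S : Schrodinger γ μ ν C φ ψ) (k : ℝ) :
    Schrodinger γ μ ν C (fun i => φ i + k) (fun j => ψ j + -k) where
  left := S.left.add (BddMeas.const k)
  right := S.right.add (BddMeas.const (-k))
  left_eq i := by
    rw [S.left_eq, ← softmin_add_const hγ (Schrodinger.bddMeas_right hC S i)]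
    congr 1
    funext j
    ring
  right_eq j := by
    rw [S.right_eq, ← softmin_add_const hγ (Schrodinger.bddMeas_left hC S j)]
    congr 1
    funext i
    ring

/-! ### Moving measures: differentiability of potentials and the Hessian of the transport cost. -/

section Derivative

variable {E : Type*} [NormedAddCommGroup E] [NormedSpace ℝ E] [FiniteDimensional ℝ E]
  {X : Type*} [TopologicalSpace X] [CompactSpace X]

/-- Derivative of the increment of a differentiable family of functions along a moving point. -/
theorem hasFDerivAt_increment {f : E → C(X, ℝ)} {Df : E →L[ℝ] C(X, ℝ)} {θ : E}
    (hf : HasFDerivAt f Df θ) {x : E → X} (hx : ContinuousAt x θ) :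
    HasFDerivAt (fun θ' => f θ' (x θ') - f θ (x θ'))
      ((ContinuousMap.evalCLM ℝ (x θ)).comp Df) θ := by
  -- Since `E` is finite-dimensional, continuity of each `Df v` along the moving point makes `A`
  -- norm continuous. Thus the point of evaluation may move without any smoothness of the functions
  -- in space.
  set A : E → E →L[ℝ] ℝ := fun θ' => (ContinuousMap.evalCLM ℝ (x θ')).comp Df
  have hA : ContinuousAt A θ := by
    rw [continuousAt_clm_apply]
    intro v
    exact (Df v).continuous.continuousAt.comp hx
  rw [hasFDerivAt_iff_isLittleO] at hf ⊢
  have h2 : (fun θ' => (A θ' - A θ) (θ' - θ)) =o[𝓝 θ] fun θ' => θ' - θ := by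
    have h0 : Tendsto (fun θ' => A θ' - A θ) (𝓝 θ) (𝓝 0) := by
      simpa using hA.tendsto.sub_const (A θ)
    rw [Asymptotics.isLittleO_iff]
    intro ε hε
    filter_upwards [h0.norm.eventually_lt_const (by simpa using hε)] with θ' hθ'
    exact ((A θ' - A θ).le_opNorm _).trans (by gcongr)
  have h1 : (fun θ' => f θ' (x θ') - f θ (x θ') - A θ' (θ' - θ)) =o[𝓝 θ] fun θ' => θ' - θ := by
    refine Asymptotics.IsBigO.trans_isLittleO (Asymptotics.IsBigO.of_bound 1
      (Eventually.of_forall fun θ' => ?_)) hf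
    rw [one_mul]
    exact (f θ' - f θ - Df (θ' - θ)).norm_coe_le_norm (x θ')
  refine (h1.add h2).congr_left fun θ' => ?_
  simp only [sub_apply, sub_self]
  ring

end Derivative

section MovingMeasures

variable {q d : ℕ} {X : Set (EuclideanSpace ℝ (Fin q))} [CompactSpace X] {I J : Type*}
  [MeasurableSpace I] [MeasurableSpace J] {γ : ℝ} {μ : Measure I} {ν : Measure J}
  [IsProbabilityMeasure μ] [IsProbabilityMeasure ν] {Θ : Set (EuclideanSpace ℝ (Fin d))}
  {c : EuclideanSpace ℝ (Fin q) → EuclideanSpace ℝ (Fin q) → ℝ}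
  {T : EuclideanSpace ℝ (Fin d) → I → X} {R : EuclideanSpace ℝ (Fin d) → J → X}
  {C' : EuclideanSpace ℝ (Fin d) → I × J → EuclideanSpace ℝ (Fin d) →L[ℝ] ℝ}
  {C'' : EuclideanSpace ℝ (Fin d) → I × J →
    EuclideanSpace ℝ (Fin d) →L[ℝ] EuclideanSpace ℝ (Fin d) →L[ℝ] ℝ}
  {f : EuclideanSpace ℝ (Fin d) → C(X, ℝ)}
  (hγ : 0 < γ) (hc : Continuous fun p : X × X => c p.1 p.2)
  (hT : ∀ θ ∈ Θ, Measurable (T θ)) (hR : ∀ θ ∈ Θ, Measurable (R θ))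
  (hC : DiffFamily Θ (fun θ (p : I × J) => c (T θ p.1) (R θ p.2)) C') (hC' : DiffFamily Θ C' C'')
  (hf : ∀ θ ∈ Θ, IsSinkhornPotential γ c (f θ) (pushα T μ θ) (pushα R ν θ))

include hc hT in
omit [IsProbabilityMeasure ν] in
theorem H1_push (f : C(X, ℝ)) {θ θ' : EuclideanSpace ℝ (Fin d)} (hθ : θ ∈ Θ)
    (hR : Measurable (R θ')) :
    H1 γ c f (pushα T μ θ) (pushα R ν θ') = (∫ i, f (T θ i) ∂μ)
      + ∫ j, softmin γ μ (fun i => c (T θ i) (R θ' j) - f (T θ i)) ∂ν := by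
  have : IsProbabilityMeasure (pushα T μ θ) :=
    Measure.isProbabilityMeasure_map (hT θ hθ).aemeasurable
  rw [H1_eq]
  congr 1
  · exact integral_map (hT θ hθ).aemeasurable f.continuous.bddMeas.meas.aestronglyMeasurable
  · rw [pushα, integral_map hR.aemeasurable
      (continuous_softmin hc γ (pushα T μ θ) f.continuous).bddMeas.meas.aestronglyMeasurable]
    congr 1
    funext j
    exact softmin_map (hT θ hθ) (a := fun x : X => c x (R θ' j) - f x)
      ((hc.bddMeas.comp (measurable_prodMk_right (y := R θ' j))).sub f.continuous.bddMeas)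

include hc hT hR hf in
omit [IsProbabilityMeasure ν] in
theorem schrodinger_push {θ : EuclideanSpace ℝ (Fin d)} (hθ : θ ∈ Θ) :
    Schrodinger γ μ ν (fun p : I × J => c (T θ p.1) (R θ p.2)) (fun i => f θ (T θ i))
      (fun j => sinkhornMap γ c (f θ) (pushα T μ θ) (R θ j)) := by
  have : IsProbabilityMeasure (pushα T μ θ) :=
    Measure.isProbabilityMeasure_map (hT θ hθ).aemeasurable
  exact Schrodinger.of_map (hT θ hθ) (hR θ hθ) hc.bddMeas ((hf θ hθ).schrodinger hc)

include hγ hc hT hR hC hC' hf in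
/-- Normalized Sinkhorn potentials are differentiable in the parameter, in the space of continuous
functions. -/
theorem differentiableAt_potential {σ : X → I} (hσ : ∀ θ ∈ Θ, ∀ x, T θ (σ x) = x) {x₀ : X}
    (h0 : ∀ θ ∈ Θ, f θ x₀ = 0) {θ : EuclideanSpace ℝ (Fin d)} (hθ : θ ∈ Θ) :
    DifferentiableAt ℝ f θ := by
  obtain ⟨r, hr, K, hK, hΘ, h1, h2⟩ := Schrodinger.exists_ball hγ hC hC'
    (fun θ hθ => schrodinger_push hc hT hR hf hθ) (i₀ := σ x₀)
    (fun θ hθ => by rw [hσ θ hθ, h0 θ hθ]) hθ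
  have hm : ∀ h : EuclideanSpace ℝ (Fin d), ‖h‖ < r → θ + h ∈ Metric.ball θ r := fun h hh => by
    simpa using hh
  have hθr : θ ∈ Metric.ball θ r := Metric.mem_ball_self hr
  suffices h : ∃ D : EuclideanSpace ℝ (Fin d) →L[ℝ] C(X, ℝ), HasFDerivAt f D θ from
    h.choose_spec.differentiableAt
  -- The section `σ` has the same value `x` under every `T θ`, so the bounds uniform over `I` become
  -- sup-norm bounds over `X`.
  refine exists_hasFDerivAt_of_second_difference (r := r / 2) (K := K) (by positivity)
    (fun h hh => ?_) fun h k hh hk => ?_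
  · rw [ContinuousMap.norm_le _ (by positivity)]
    intro x
    have hh' := hm h (by linarith)
    have := (h1 θ hθr (θ + h) hh').1 (σ x)
    rwa [hσ _ (hΘ hh'), hσ _ hθ, add_sub_cancel_left] at this
  · rw [ContinuousMap.norm_le _ (by positivity)]
    intro x
    have e1 := hm h (by linarith)
    have e2 := hm k (by linarith)
    have e3 := hm (h + k) (by linarith [norm_add_le h k])
    have := (h2 h k (by linarith) (by linarith)).1 (σ x)
    rwa [hσ _ (hΘ e1), hσ _ (hΘ e2), hσ _ (hΘ e3), hσ _ hθ] at this

include hc hT in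
omit [IsProbabilityMeasure ν] in
theorem closedD11_push (f g₁ g₂ : C(X, ℝ)) {θ : EuclideanSpace ℝ (Fin d)} (hθ : θ ∈ Θ)
    (hR : Measurable (R θ)) :
    closedD11 γ c (pushα T μ θ) (pushα R ν θ) f g₁ g₂ = ∫ j,
      (-(1 / γ) * gibbsMean γ μ (fun i => c (T θ i) (R θ j) - f (T θ i))
          (fun i => g₁ (T θ i) * g₂ (T θ i))
        + (1 / γ) * (gibbsMean γ μ (fun i => c (T θ i) (R θ j) - f (T θ i)) (fun i => g₁ (T θ i))
          * gibbsMean γ μ (fun i => c (T θ i) (R θ j) - f (T θ i)) (fun i => g₂ (T θ i)))) ∂ν := by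
  have : IsProbabilityMeasure (pushα T μ θ) :=
    Measure.isProbabilityMeasure_map (hT θ hθ).aemeasurable
  have ha : BddMeas fun p : X × X => c p.1 p.2 - f p.1 :=
    hc.bddMeas.sub (f.continuous.bddMeas.comp measurable_fst)
  have hg : ∀ {g : X → ℝ}, BddMeas g → BddMeas fun y : X =>
      gibbsMean γ (pushα T μ θ) (fun x : X => c x y - f x) g := fun hg =>
    ha.gibbsMean (hg.comp measurable_fst) γ (pushα T μ θ)
  have b1 := g₁.continuous.bddMeas
  have b2 := g₂.continuous.bddMeas
  rw [closedD11_eq, show pushα R ν θ = ν.map (R θ) from rfl, integral_map hR.aemeasurable (((hg (b1.mul b2)).const_mul _).add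
    (((hg b1).mul (hg b2)).const_mul _)).meas.aestronglyMeasurable]
  congr 1
  funext j
  have ha' : BddMeas fun x : X => c x (R θ j) - f x :=
    ha.comp (measurable_prodMk_right (y := R θ j))
  rw [pushα, gibbsMean_map (hT θ hθ) ha' (b1.mul b2), gibbsMean_map (hT θ hθ) ha' b1,
    gibbsMean_map (hT θ hθ) ha' b2]

include hγ hc hT hR hC hC' hf in
/-- The optimal transport cost is twice differentiable in the parameter, and its Hessian is
expressed by the second derivatives of the semi-dual functional. -/
theorem exists_hasD2At_OT {σ : X → I} (hσ : ∀ θ ∈ Θ, ∀ x, T θ (σ x) = x) (x₀ : X)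
    {θ : EuclideanSpace ℝ (Fin d)} (hθ : θ ∈ Θ) (hTc : ∀ i, ContinuousAt (fun θ => T θ i) θ)
    {F : EuclideanSpace ℝ (Fin q) → ℝ} (hF : ∀ x : X, F x = f θ x)
    {N' : EuclideanSpace ℝ (Fin d) → I → EuclideanSpace ℝ (Fin d) →L[ℝ] ℝ}
    {N'' : EuclideanSpace ℝ (Fin d) → I →
      EuclideanSpace ℝ (Fin d) →L[ℝ] EuclideanSpace ℝ (Fin d) →L[ℝ] ℝ}
    (hN : DiffFamily Θ (fun θ i => F (T θ i)) N') (hN' : DiffFamily Θ N' N'') :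
    ∃ H H₂, HasD2At (fun θ' => OT γ c (pushα T μ θ') (pushα R ν θ')) H θ ∧
      HasD2At (fun θ' => H1 γ c (f θ) (pushα T μ θ') (pushα R ν θ')) H₂ θ ∧
      (DifferentiableAt ℝ f θ → ∀ v w, H v w
        = -closedD11 γ c (pushα T μ θ) (pushα R ν θ) (f θ) (fderiv ℝ f θ v) (fderiv ℝ f θ w)
          + H₂ v w) := by
  have hb : ∀ θ ∈ Θ, BddMeas fun p : I × J => c (T θ p.1) (R θ p.2) := fun θ hθ => hC.bddMeas hθ
  -- The given potentials may depend on the parameter through arbitrary constants. These are moved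
  -- from `φ` to `ψ`, so that the normalized pair is differentiable and the value is unchanged.
  have S : ∀ θ ∈ Θ, Schrodinger γ μ ν (fun p : I × J => c (T θ p.1) (R θ p.2))
      (fun i => f θ (T θ i) + -f θ x₀)
      (fun j => sinkhornMap γ c (f θ) (pushα T μ θ) (R θ j) + - -f θ x₀) := fun θ hθ =>
    (schrodinger_push hc hT hR hf hθ).add_const hγ (hb θ hθ) (-f θ x₀)
  obtain ⟨⟨φ', hφ⟩, ψ', hψ⟩ := Schrodinger.exists_diffFamily hγ hC hC' S (i₀ := σ x₀)
    (fun θ hθ => by rw [hσ θ hθ, add_neg_cancel])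
  obtain ⟨D, H, d1, d2, d3⟩ := Schrodinger.hasFDerivAt_value hγ hC hC' hφ hψ S
  obtain ⟨D₂, H₂, s1, s2, s3⟩ := hasFDerivAt_semidual (μ := μ) (ν := ν) hγ hC hC' hN hN'
  refine ⟨H θ, H₂ θ, ?_, ?_, fun hd v w => ?_⟩
  · refine (HasD2At.of_isOpen hC.isOpen hθ d1 (d2 θ hθ)).congr_of_eventuallyEq ?_
    filter_upwards [hC.isOpen.mem_nhds hθ] with θ' hθ'
    have : IsProbabilityMeasure (pushα T μ θ') :=
      Measure.isProbabilityMeasure_map (hT θ' hθ').aemeasurable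
    have : IsProbabilityMeasure (pushα R ν θ') :=
      Measure.isProbabilityMeasure_map (hR θ' hθ').aemeasurable
    have S' := schrodinger_push hc hT hR hf hθ'
    rw [(hf θ' hθ').OT_eq_H1 hγ hc, H1_push hc hT _ hθ' (hR θ' hθ'),
      integral_add (S'.left.integrable μ) (integrable_const _),
      integral_add (S'.right.integrable ν) (integrable_const _)]
    simp_rw [S'.right_eq]
    simp only [integral_const, probReal_univ, one_smul]
    ring
  · refine (HasD2At.of_isOpen hC.isOpen hθ s1 (s2 θ hθ)).congr_of_eventuallyEq ?_
    filter_upwards [hC.isOpen.mem_nhds hθ] with θ' hθ'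
    rw [H1_push hc hT _ hθ' (hR θ' hθ')]
    simp_rw [hF]
  -- Subtracting the frozen extension `F` leaves the increment of `f` at the moving point, with
  -- derivative `fderiv ℝ f θ` evaluated at `T θ i`. The value at `x₀` restores the constant removed
  -- by normalization.
  · have key : ∀ u i, (fderiv ℝ f θ u) (T θ i)
        = φ' θ i u - N' θ i u + (fderiv ℝ f θ u) x₀ := fun u i => by
      have a1 := hasFDerivAt_increment hd.hasFDerivAt (hTc i)
      have a2 := (ContinuousMap.evalCLM ℝ x₀).hasFDerivAt.comp θ hd.hasFDerivAt
      have a3 := ((hφ.deriv θ hθ i).add a2).sub (hN.deriv θ hθ i)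
      have e := a3.unique (a1.congr_of_eventuallyEq (Eventually.of_forall fun θ' => by
        simp [hF]))
      have := congrArg (fun L : EuclideanSpace ℝ (Fin d) →L[ℝ] ℝ => L u) e
      simp at this
      linarith
    have := Schrodinger.hessian_identity hγ hC hC' hN hN' hφ hψ S hθ (k := f θ x₀)
      (fun i => by simp [hF]) (v := v) (w := w) (key v) (key w)
    rw [d3 θ hθ, s3 θ hθ, closedD11_push hc hT (f θ) _ _ hθ (hR θ hθ), this]
    simp_rw [hF]

end MovingMeasures

end SiNG

namespace SiNG

theorem bddMeas_clm_apply {A Y V : Type*} [TopologicalSpace A] [CompactSpace A]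
    [MeasurableSpace Y] [NormedAddCommGroup V] [NormedSpace ℝ V] {G : A → V →L[ℝ] ℝ}
    (hG : Continuous G) {s : Y → A} (hs : StronglyMeasurable s) {x : Y → V}
    (hx : StronglyMeasurable x) {K : ℝ} (hK : ∀ y, ‖x y‖ ≤ K) : BddMeas fun y => G (s y) (x y) := by
  refine ⟨(isBoundedBilinearMap_apply (𝕜 := ℝ) (E := V) (F := ℝ)).continuous.comp_stronglyMeasurable
    ((hG.comp_stronglyMeasurable hs).prodMk hx), ?_⟩
  refine ⟨‖(⟨G, hG⟩ : C(A, V →L[ℝ] ℝ))‖ * K, fun y => ?_⟩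
  refine ((G (s y)).le_opNorm _).trans ?_
  have := (⟨G, hG⟩ : C(A, V →L[ℝ] ℝ)).norm_coe_le_norm (s y)
  exact mul_le_mul this (hK y) (norm_nonneg _) (norm_nonneg _)

theorem integral_gibbsMean_hessian {I J : Type*} [MeasurableSpace I] [MeasurableSpace J] {γ : ℝ}
    {μ : Measure I} {ν : Measure J} [IsProbabilityMeasure μ] [IsProbabilityMeasure ν]
    {a s m₁ m₂ : I × J → ℝ} (ha : BddMeas a) (hs : BddMeas s) (h₁ : BddMeas m₁)
    (h₂ : BddMeas m₂) (k : ℝ) :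
    ∫ j, (gibbsMean γ μ (fun i => a (i, j)) (fun i => s (i, j))
        - k * gibbsMean γ μ (fun i => a (i, j)) (fun i => m₁ (i, j) * m₂ (i, j))
        + k * (gibbsMean γ μ (fun i => a (i, j)) (fun i => m₁ (i, j))
          * gibbsMean γ μ (fun i => a (i, j)) (fun i => m₂ (i, j)))) ∂ν
      = (∫ j, gibbsMean γ μ (fun i => a (i, j)) (fun i => s (i, j)) ∂ν)
        - k * (∫ j, gibbsMean γ μ (fun i => a (i, j)) (fun i => m₁ (i, j) * m₂ (i, j)) ∂ν)
        + k * ∫ j, gibbsMean γ μ (fun i => a (i, j)) (fun i => m₁ (i, j))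
          * gibbsMean γ μ (fun i => a (i, j)) (fun i => m₂ (i, j)) ∂ν := by
  have b0 := ha.gibbsMean hs γ μ
  have b1 := (ha.gibbsMean (h₁.mul h₂) γ μ).const_mul k
  have b2 := ((ha.gibbsMean h₁ γ μ).mul (ha.gibbsMean h₂ γ μ)).const_mul k
  rw [integral_add ((b0.sub b1).integrable ν) (b2.integrable ν),
    integral_sub (b0.integrable ν) (b1.integrable ν), integral_const_mul, integral_const_mul]

/-! ### Closed forms of the Hessians in the parameter, and the augmented system. -/

section ClosedForms

variable {q d : ℕ} {X U : Set (EuclideanSpace ℝ (Fin q))} [CompactSpace X] {Z : Type*}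
  [MeasurableSpace Z] {μ : Measure Z} [IsProbabilityMeasure μ]
  {Θ : Set (EuclideanSpace ℝ (Fin d))} {T : EuclideanSpace ℝ (Fin d) → Z → X} {γ : ℝ}
  {c : EuclideanSpace ℝ (Fin q) → EuclideanSpace ℝ (Fin q) → ℝ}

omit [CompactSpace X] in
theorem kernelT_eq (f : EuclideanSpace ℝ (Fin q) → ℝ) (y x : EuclideanSpace ℝ (Fin q)) :
    kernelT γ c f y x = Real.exp (-(c x y - f x) / γ) := by
  rw [kernelT, ← Real.exp_add]
  ring_nf

omit [CompactSpace X] in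
theorem pushα_id (β : Measure X) (θ : EuclideanSpace ℝ (Fin d)) :
    pushα (fun _ => (id : X → X)) β θ = β :=
  Measure.map_id

theorem exists_hasD2At_H1_left (hγ : 0 < γ) (hc : IsC2Cost X U c) (hU : IsOpen U) (hXU : X ⊆ U)
    (hΘ : IsOpen Θ) (hT : IsC2Param Θ T) (β : Measure X) [IsProbabilityMeasure β] {f : C(X, ℝ)}
    {F : EuclideanSpace ℝ (Fin q) → ℝ} (hF : IsC2Extension f F) {θ : EuclideanSpace ℝ (Fin d)}
    (hθ : θ ∈ Θ) :
    ∃ H, HasD2At (fun θ' => H1 γ c f (pushα T μ θ') β) H θ ∧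
      ∀ v w, H v w = closedD22 γ c T μ β F θ v w := by
  obtain ⟨hFf, V, hV, hXV, hF2⟩ := hF
  obtain ⟨C'', hC, hC', eC⟩ := hc.exists_comp_left hU hXU hT hΘ
  obtain ⟨N'', hN, hN', eN⟩ := hT.exists_comp hΘ hV hXV hF2
  obtain ⟨hS, hS'⟩ := hT.diffFamily hΘ
  obtain ⟨D, H, h1, h2, h3⟩ := hasFDerivAt_semidual (μ := μ) (ν := β) hγ hC hC' hN hN'
  refine ⟨H θ, ?_, fun v w => ?_⟩
  · refine (HasD2At.of_isOpen hΘ hθ h1 (h2 θ hθ)).congr_of_eventuallyEq ?_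
    filter_upwards [hΘ.mem_nhds hθ] with θ' hθ'
    have := H1_push (γ := γ) (μ := μ) (ν := β) (R := fun _ => (id : X → X))
      (hc.continuous hXU) hT.1 f hθ' (θ' := θ') measurable_id
    rw [pushα_id] at this
    rw [this]
    simp_rw [hFf]
    rfl
  · have ba : BddMeas fun p : Z × X => c (T θ p.1) p.2 - F (T θ p.1) :=
      (hC.bddMeas hθ).sub ((hN.bddMeas hθ).comp measurable_fst)
    have bm : ∀ v, BddMeas fun p : Z × X => ((fderiv ℝ (fun x => c x p.2) (T θ p.1)).comp
        (jac T θ p.1)) v - ((fderiv ℝ F (T θ p.1)).comp (jac T θ p.1)) v := fun v =>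
      (hC.bddMeas_deriv hθ v).sub ((hN.bddMeas_deriv hθ v).comp measurable_fst)
    have bs : BddMeas fun p : Z × X => C'' θ p v w - N'' θ p.1 v w :=
      (hC'.bddMeas_deriv₂ hθ v w).sub ((hN'.bddMeas_deriv₂ hθ v w).comp measurable_fst)
    have bj : ∃ K, ∀ z, ‖jac2 T θ z v w‖ ≤ K := by
      obtain ⟨K, hK⟩ := hS'.exists_bound hθ
      exact ⟨K * ‖v‖ * ‖w‖, fun z => (ContinuousLinearMap.le_opNorm₂ _ _ _).trans (by
        gcongr
        exact (hK z).2)⟩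
    obtain ⟨K, hK⟩ := bj
    have hj : StronglyMeasurable fun z => jac2 T θ z v w :=
      (ContinuousLinearMap.apply ℝ _ w).continuous.comp_stronglyMeasurable
        ((ContinuousLinearMap.apply ℝ _ v).continuous.comp_stronglyMeasurable (hS'.meas_deriv hθ))
    have bF : BddMeas fun z => fderiv ℝ F (T θ z) (jac2 T θ z v w) :=
      bddMeas_clm_apply (G := fun x : X => fderiv ℝ F x)
        (((hF2.continuousOn_two hV).1.mono hXV).domRestrict) (hT.1 θ hθ).stronglyMeasurable hj hK
    have hr : Continuous fun p : X × X =>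
      ((p.1 : EuclideanSpace ℝ (Fin q)), (p.2 : EuclideanSpace ℝ (Fin q))) := by fun_prop
    have bc : BddMeas fun p : Z × X =>
        fderiv ℝ (fun x => c x p.2) (T θ p.1) (jac2 T θ p.1 v w) :=
      bddMeas_clm_apply (G := fun p : X × X => fderiv ℝ (fun x => c x p.2) p.1)
        (hc.2.2.1.comp_continuous hr fun p => ⟨hXU p.1.2, p.2.2⟩)
        (((hT.1 θ hθ).comp measurable_fst).prodMk measurable_snd).stronglyMeasurable
        (hj.comp_measurable measurable_fst) fun p => hK p.1
    have b1 : BddMeas fun p : Z × X => (fderiv ℝ (fun x => c x p.2) (T θ p.1)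
        - fderiv ℝ F (T θ p.1)) (jac2 T θ p.1 v w) := bc.sub (bF.comp measurable_fst)
    -- This is the full second derivative minus the part carrying `jac2`, both already known to be
    -- bounded and measurable.
    have b2 : BddMeas fun p : Z × X => D2 (fun x => c x p.2) (T θ p.1) (jac T θ p.1 v)
        (jac T θ p.1 w) - D2 F (T θ p.1) (jac T θ p.1 v) (jac T θ p.1 w) := by
      have := bs.sub b1
      refine ⟨?_, ?_⟩
      · convert this.meas using 2 with p
        simp only [eC, eN, sub_apply]
        ring
      · convert this.bdd using 5 with K p
        simp only [eC, eN, sub_apply]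
        ring
    have es : ∀ y : X, gibbsMean γ μ (fun z => c (T θ z) y - F (T θ z))
        (fun z => C'' θ (z, y) v w - N'' θ z v w)
        = gibbsMean γ μ (fun z => c (T θ z) y - F (T θ z))
          (fun z => (fderiv ℝ (fun x => c x y) (T θ z) - fderiv ℝ F (T θ z)) (jac2 T θ z v w))
        + gibbsMean γ μ (fun z => c (T θ z) y - F (T θ z))
          (fun z => D2 (fun x => c x y) (T θ z) (jac T θ z v) (jac T θ z w)
            - D2 F (T θ z) (jac T θ z v) (jac T θ z w)) := fun y => by
      have my : Measurable fun z : Z => (z, y) := measurable_prodMk_right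
      refine Eq.trans ?_ (gibbsMean_add (ba.comp my) (b1.comp my) (b2.comp my))
      congr 1
      funext z
      simp only [eC, eN, sub_apply]
      ring
    rw [h3 θ hθ, integral_gibbsMean_hessian ba bs (bm v) (bm w) (1 / γ)]
    simp_rw [es]
    rw [integral_add ((ba.gibbsMean b1 γ μ).integrable β) ((ba.gibbsMean b2 γ μ).integrable β)]
    simp only [closedD22, kernelT_eq, gibbsMean, eN, sub_apply, ContinuousLinearMap.comp_apply,
      div_mul_div_comm, ← pow_two, add_comm (D2 F _ _ _)]
    ring

theorem exists_hasD2At_H1_self (hγ : 0 < γ) (hc : IsC2Cost X U c) (hU : IsOpen U) (hXU : X ⊆ U)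
    (hc2 : ContDiffOn ℝ 2 (fun p : EuclideanSpace ℝ (Fin q) × EuclideanSpace ℝ (Fin q) =>
      c p.1 p.2) (U ×ˢ U))
    (hΘ : IsOpen Θ) (hT : IsC2Param Θ T) {f : C(X, ℝ)}
    {F : EuclideanSpace ℝ (Fin q) → ℝ} (hF : IsC2Extension f F) {θ : EuclideanSpace ℝ (Fin d)}
    (hθ : θ ∈ Θ) :
    ∃ H, HasD2At (fun θ' => H1 γ c f (pushα T μ θ') (pushα T μ θ')) H θ ∧
      ∀ v w, H v w = closedD22Self γ c T μ F θ v w := by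
  obtain ⟨hFf, V, hV, hXV, hF2⟩ := hF
  obtain ⟨C'', hC, hC', eC⟩ := hT.exists_comp_prod hΘ hU hXU hc2
  obtain ⟨N'', hN, hN', eN⟩ := hT.exists_comp hΘ hV hXV hF2
  obtain ⟨D, H, h1, h2, h3⟩ := hasFDerivAt_semidual (μ := μ) (ν := μ) hγ hC hC' hN hN'
  refine ⟨H θ, ?_, fun v w => ?_⟩
  · refine (HasD2At.of_isOpen hΘ hθ h1 (h2 θ hθ)).congr_of_eventuallyEq ?_
    filter_upwards [hΘ.mem_nhds hθ] with θ' hθ'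
    rw [H1_push (hc.continuous hXU) hT.1 f hθ' (hT.1 θ' hθ')]
    simp_rw [hFf]
  · have ba : BddMeas fun p : Z × Z => c (T θ p.1) (T θ p.2) - F (T θ p.1) :=
      (hC.bddMeas hθ).sub ((hN.bddMeas hθ).comp measurable_fst)
    have bm := fun v => (hC.bddMeas_deriv hθ v).sub
      ((hN.bddMeas_deriv hθ v).comp (measurable_fst (α := Z) (β := Z)))
    have bs := (hC'.bddMeas_deriv₂ hθ v w).sub
      ((hN'.bddMeas_deriv₂ hθ v w).comp (measurable_fst (α := Z) (β := Z)))
    rw [h3 θ hθ, integral_gibbsMean_hessian ba bs (bm v) (bm w) (1 / γ)]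
    simp only [closedD22Self, kernelT_eq, gibbsMean, eC, eN, ContinuousLinearMap.comp_apply,
      ContinuousLinearMap.prod_apply, div_mul_div_comm, ← pow_two, sub_sub,
      add_comm (D2 F _ _ _)]
    simp only [add_comm (fderiv ℝ F _ _)]
    ring

end ClosedForms

section AugmentedSystem

variable {q d : ℕ} {X U : Set (EuclideanSpace ℝ (Fin q))} [CompactSpace X] {Z J : Type*}
  [MeasurableSpace Z] [MeasurableSpace J] {μ : Measure Z} [IsProbabilityMeasure μ]
  {ν : Measure J} [IsProbabilityMeasure ν]
  {Θ : Set (EuclideanSpace ℝ (Fin d))} {T : EuclideanSpace ℝ (Fin d) → Z → X}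
  {R : EuclideanSpace ℝ (Fin d) → J → X} {γ : ℝ}
  {c : EuclideanSpace ℝ (Fin q) → EuclideanSpace ℝ (Fin q) → ℝ}
  {C' : EuclideanSpace ℝ (Fin d) → (Z ⊕ X) × J → EuclideanSpace ℝ (Fin d) →L[ℝ] ℝ}
  {C'' : EuclideanSpace ℝ (Fin d) → (Z ⊕ X) × J →
    EuclideanSpace ℝ (Fin d) →L[ℝ] EuclideanSpace ℝ (Fin d) →L[ℝ] ℝ}
  {f : EuclideanSpace ℝ (Fin d) → C(X, ℝ)} {β : EuclideanSpace ℝ (Fin d) → Measure X}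

omit [CompactSpace X] in
theorem IsC2Param.continuousAt (hT : IsC2Param Θ T) (hΘ : IsOpen Θ)
    {θ : EuclideanSpace ℝ (Fin d)} (hθ : θ ∈ Θ) (z : Z) : ContinuousAt (fun θ => T θ z) θ := by
  rw [Topology.IsInducing.subtypeVal.continuousAt_iff]
  exact (hT.2.1 z).continuousOn.continuousAt (hΘ.mem_nhds hθ)

/-- Regularity of Sinkhorn potentials and of the optimal transport cost, for a second marginal
that is the image of a fixed probability measure. -/
theorem sinkhorn_regularity (hγ : 0 < γ) (hc : IsC2Cost X U c) (hU : IsOpen U) (hXU : X ⊆ U)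
    (hΘ : IsOpen Θ) (hT : IsC2Param Θ T) (x₀ : X) (hR : ∀ θ ∈ Θ, Measurable (R θ))
    (hβ : ∀ θ ∈ Θ, pushα R ν θ = β θ)
    (hC : DiffFamily Θ (fun θ (p : (Z ⊕ X) × J) => c (augment T θ p.1) (R θ p.2)) C')
    (hC' : DiffFamily Θ C' C'')
    (hf : ∀ θ ∈ Θ, IsSinkhornPotential γ c (f θ) (pushα T μ θ) (β θ)) :
    ((∀ θ ∈ Θ, f θ x₀ = 0) → DifferentiableOn ℝ f Θ) ∧
    ∀ θ ∈ Θ, IsC2Extension (f θ) (sinkhornB γ c (f θ) (pushα T μ θ) (β θ)) ∧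
      ∃ H H₂, HasD2At (fun θ' => OT γ c (pushα T μ θ') (β θ')) H θ ∧
      HasD2At (fun θ' => H1 γ c (f θ) (pushα T μ θ') (β θ')) H₂ θ ∧
      (DifferentiableAt ℝ f θ → ∀ v w, H v w
        = -closedD11 γ c (pushα T μ θ) (β θ) (f θ) (fderiv ℝ f θ v) (fderiv ℝ f θ w)
          + H₂ v w) := by
  have : IsProbabilityMeasure (μ.map (Sum.inl : Z → Z ⊕ X)) :=
    Measure.isProbabilityMeasure_map measurable_inl.aemeasurable
  have hA := hT.augment
  have hα : ∀ θ ∈ Θ, pushα (augment T) (μ.map Sum.inl) θ = pushα T μ θ := fun θ hθ =>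
    pushα_augment (hT.1 θ hθ) μ
  -- The potentials are unaffected by the augmentation, since the two marginals are the same
  -- measures.
  have hf' : ∀ θ ∈ Θ, IsSinkhornPotential γ c (f θ) (pushα (augment T) (μ.map Sum.inl) θ)
      (pushα R ν θ) := fun θ hθ => by
    rw [hα θ hθ, hβ θ hθ]
    exact hf θ hθ
  have hcc := hc.continuous hXU
  refine ⟨fun h0 θ hθ => (differentiableAt_potential hγ hcc hA.1 hR hC hC' hf' (σ := Sum.inr)
    (fun _ _ _ => rfl) h0 hθ).differentiableWithinAt, fun θ hθ => ?_⟩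
  have : IsProbabilityMeasure (pushα T μ θ) :=
    Measure.isProbabilityMeasure_map (hT.1 θ hθ).aemeasurable
  have : IsProbabilityMeasure (β θ) :=
    hβ θ hθ ▸ Measure.isProbabilityMeasure_map (hR θ hθ).aemeasurable
  have hext := (hf θ hθ).isC2Extension hU hXU hγ hc
  refine ⟨hext, ?_⟩
  obtain ⟨hF, V, hV, hXV, hF2⟩ := hext
  obtain ⟨N'', hN, hN', -⟩ := hA.exists_comp hΘ hV hXV hF2
  obtain ⟨H, H₂, k1, k2, k3⟩ := exists_hasD2At_OT hγ hcc hA.1 hR hC hC' hf' (σ := Sum.inr)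
    (fun _ _ _ => rfl) x₀ hθ (fun i => hA.continuousAt hΘ hθ i) hF hN hN'
  have hev : ∀ᶠ θ' in 𝓝 θ, θ' ∈ Θ := hΘ.mem_nhds hθ
  refine ⟨H, H₂, k1.congr_of_eventuallyEq ?_, k2.congr_of_eventuallyEq ?_, ?_⟩
  · filter_upwards [hev] with θ' hθ'
    rw [hα θ' hθ', hβ θ' hθ']
  · filter_upwards [hev] with θ' hθ'
    rw [hα θ' hθ', hβ θ' hθ']
  · rwa [hα θ hθ, hβ θ hθ] at k3

theorem sinkhorn_regularity_left (hγ : 0 < γ) (hc : IsC2Cost X U c) (hU : IsOpen U)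
    (hXU : X ⊆ U) (hΘ : IsOpen Θ) (hT : IsC2Param Θ T) (x₀ : X) (β : Measure X)
    [IsProbabilityMeasure β]
    (hf : ∀ θ ∈ Θ, IsSinkhornPotential γ c (f θ) (pushα T μ θ) β) :
    ((∀ θ ∈ Θ, f θ x₀ = 0) → DifferentiableOn ℝ f Θ) ∧
    ∀ θ ∈ Θ, IsC2Extension (f θ) (sinkhornB γ c (f θ) (pushα T μ θ) β) ∧
      ∃ H H₂, HasD2At (fun θ' => OT γ c (pushα T μ θ') β) H θ ∧
      HasD2At (fun θ' => H1 γ c (f θ) (pushα T μ θ') β) H₂ θ ∧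
      (DifferentiableAt ℝ f θ → ∀ v w, H v w
        = -closedD11 γ c (pushα T μ θ) β (f θ) (fderiv ℝ f θ v) (fderiv ℝ f θ w)
          + H₂ v w) := by
  obtain ⟨C'', hC, hC', -⟩ := hc.exists_comp_left hU hXU hT.augment hΘ
  exact sinkhorn_regularity (R := fun _ => (id : X → X)) (ν := β) (β := fun _ => β) hγ hc hU hXU hΘ
    hT x₀ (fun _ _ => measurable_id) (fun θ _ => pushα_id β θ) hC hC' hf

/-- Both marginals move with the augmented map, so both arguments of the cost vary; this is where
joint `C²` regularity enters. -/
theorem sinkhorn_regularity_self (hγ : 0 < γ) (hc : IsC2Cost X U c) (hU : IsOpen U)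
    (hXU : X ⊆ U)
    (hc2 : ContDiffOn ℝ 2 (fun p : EuclideanSpace ℝ (Fin q) × EuclideanSpace ℝ (Fin q) =>
      c p.1 p.2) (U ×ˢ U)) (hΘ : IsOpen Θ) (hT : IsC2Param Θ T) (x₀ : X)
    (hf : ∀ θ ∈ Θ, IsSinkhornPotential γ c (f θ) (pushα T μ θ) (pushα T μ θ)) :
    ((∀ θ ∈ Θ, f θ x₀ = 0) → DifferentiableOn ℝ f Θ) ∧
    ∀ θ ∈ Θ, IsC2Extension (f θ) (sinkhornB γ c (f θ) (pushα T μ θ) (pushα T μ θ)) ∧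
      ∃ H H₂, HasD2At (fun θ' => OT γ c (pushα T μ θ') (pushα T μ θ')) H θ ∧
      HasD2At (fun θ' => H1 γ c (f θ) (pushα T μ θ') (pushα T μ θ')) H₂ θ ∧
      (DifferentiableAt ℝ f θ → ∀ v w, H v w
        = -closedD11 γ c (pushα T μ θ) (pushα T μ θ) (f θ) (fderiv ℝ f θ v) (fderiv ℝ f θ w)
          + H₂ v w) := by
  obtain ⟨C'', hC, hC', -⟩ := hT.augment.exists_comp_prod hΘ hU hXU hc2
  have : IsProbabilityMeasure (μ.map (Sum.inl : Z → Z ⊕ X)) :=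
    Measure.isProbabilityMeasure_map measurable_inl.aemeasurable
  exact sinkhorn_regularity (ν := μ.map Sum.inl) (β := pushα T μ) hγ hc hU hXU hΘ hT x₀
    hT.augment.1 (fun θ hθ => pushα_augment (hT.1 θ hθ) μ) hC hC' hf

end AugmentedSystem

end SiNG

theorem mainTheorem4 {q d : ℕ} (X : Set (EuclideanSpace ℝ (Fin q))) [CompactSpace X]
    {Z : Type*} [MeasurableSpace Z] (μ : Measure Z) [IsProbabilityMeasure μ]
    (γ : ℝ) (hγ : 0 < γ)
    (U : Set (EuclideanSpace ℝ (Fin q))) (hU : IsOpen U) (hXU : X ⊆ U)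
    (c : EuclideanSpace ℝ (Fin q) → EuclideanSpace ℝ (Fin q) → ℝ) (hc : SiNG.IsC2Cost X U c)
    (Θ : Set (EuclideanSpace ℝ (Fin d))) (hΘ : IsOpen Θ)
    (T : EuclideanSpace ℝ (Fin d) → Z → X) (hT : SiNG.IsC2Param Θ T) (x₀ : X) :
    -- Sinkhorn potentials exist, are unique once normalized, and give the value of `OT`
    (∀ (α β : Measure X) [IsProbabilityMeasure α] [IsProbabilityMeasure β],
      (∃! f : C(X, ℝ), SiNG.IsSinkhornPotential γ c f α β ∧ f x₀ = 0) ∧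
      ∀ f : C(X, ℝ), SiNG.IsSinkhornPotential γ c f α β →
        SiNG.OT γ c α β = SiNG.H1 γ c f α β) ∧
    -- closed form of the second derivative of `H₁` in `f`
    (∀ (α β : Measure X) [IsProbabilityMeasure α] [IsProbabilityMeasure β] (f : C(X, ℝ)),
      SiNG.TwiceDifferentiableAt (fun k : C(X, ℝ) => SiNG.H1 γ c k α β) f ∧
      ∀ g₁ g₂ : C(X, ℝ),
        SiNG.D2 (fun k : C(X, ℝ) => SiNG.H1 γ c k α β) f g₁ g₂
          = SiNG.closedD11 γ c α β f g₁ g₂) ∧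
    -- the Hessian of `OT(α_θ, β)` for a fixed `β`
    (∀ (β : Measure X) [IsProbabilityMeasure β],
      -- closed form of the second derivative of `H₁` in `θ`
      (∀ (f : C(X, ℝ)) (F : EuclideanSpace ℝ (Fin q) → ℝ), SiNG.IsC2Extension f F →
        ∀ θ ∈ Θ,
          SiNG.TwiceDifferentiableAt (fun θ' => SiNG.H1 γ c f (SiNG.pushα T μ θ') β) θ ∧
          ∀ h₁ h₂ : EuclideanSpace ℝ (Fin d),
            SiNG.D2 (fun θ' => SiNG.H1 γ c f (SiNG.pushα T μ θ') β) θ h₁ h₂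
              = SiNG.closedD22 γ c T μ β F θ h₁ h₂) ∧
      -- for every family of Sinkhorn potentials `f_θ` of `OT(α_θ, β)`
      (∀ f : EuclideanSpace ℝ (Fin d) → C(X, ℝ),
        (∀ θ ∈ Θ, SiNG.IsSinkhornPotential γ c (f θ) (SiNG.pushα T μ θ) β) →
        ((∀ θ ∈ Θ, f θ x₀ = 0) → DifferentiableOn ℝ f Θ) ∧
        ∀ θ ∈ Θ,
          SiNG.IsC2Extension (f θ) (SiNG.sinkhornB γ c (f θ) (SiNG.pushα T μ θ) β) ∧
          SiNG.TwiceDifferentiableAt (fun θ' => SiNG.OT γ c (SiNG.pushα T μ θ') β) θ ∧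
          (DifferentiableAt ℝ f θ → ∀ h₁ h₂ : EuclideanSpace ℝ (Fin d),
            SiNG.D2 (fun θ' => SiNG.OT γ c (SiNG.pushα T μ θ') β) θ h₁ h₂
              = -(SiNG.D2 (fun k : C(X, ℝ) => SiNG.H1 γ c k (SiNG.pushα T μ θ) β) (f θ)
                    (fderiv ℝ f θ h₁) (fderiv ℝ f θ h₂))
                + SiNG.D2 (fun θ' => SiNG.H1 γ c (f θ) (SiNG.pushα T μ θ') β) θ h₁ h₂))) ∧
    -- the Sinkhorn information matrix, for a cost that is jointly `C²`
    (ContDiffOn ℝ 2 (fun p : EuclideanSpace ℝ (Fin q) × EuclideanSpace ℝ (Fin q) => c p.1 p.2)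
        (U ×ˢ U) →
      (∀ (f : C(X, ℝ)) (F : EuclideanSpace ℝ (Fin q) → ℝ), SiNG.IsC2Extension f F →
        ∀ θ ∈ Θ,
          SiNG.TwiceDifferentiableAt
            (fun θ' => SiNG.H1 γ c f (SiNG.pushα T μ θ') (SiNG.pushα T μ θ')) θ ∧
          ∀ h₁ h₂ : EuclideanSpace ℝ (Fin d),
            SiNG.D2 (fun θ' => SiNG.H1 γ c f (SiNG.pushα T μ θ') (SiNG.pushα T μ θ')) θ h₁ h₂
              = SiNG.closedD22Self γ c T μ F θ h₁ h₂) ∧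
      -- for every family of Sinkhorn potentials `k_θ` of `OT(α_θ, α_θ)`
      (∀ k : EuclideanSpace ℝ (Fin d) → C(X, ℝ),
        (∀ θ ∈ Θ, SiNG.IsSinkhornPotential γ c (k θ) (SiNG.pushα T μ θ) (SiNG.pushα T μ θ)) →
        ((∀ θ ∈ Θ, k θ x₀ = 0) → DifferentiableOn ℝ k Θ) ∧
        ∀ θ ∈ Θ,
          SiNG.IsC2Extension (k θ)
            (SiNG.sinkhornB γ c (k θ) (SiNG.pushα T μ θ) (SiNG.pushα T μ θ)) ∧
          SiNG.TwiceDifferentiableAt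
            (fun θ' => SiNG.OT γ c (SiNG.pushα T μ θ') (SiNG.pushα T μ θ')) θ ∧
          (DifferentiableAt ℝ k θ → ∀ h₁ h₂ : EuclideanSpace ℝ (Fin d),
            SiNG.D2 (fun θ' => SiNG.OT γ c (SiNG.pushα T μ θ') (SiNG.pushα T μ θ')) θ h₁ h₂
              = -(SiNG.D2 (fun g : C(X, ℝ) =>
                      SiNG.H1 γ c g (SiNG.pushα T μ θ) (SiNG.pushα T μ θ)) (k θ)
                    (fderiv ℝ k θ h₁) (fderiv ℝ k θ h₂))
                + SiNG.D2 (fun θ' =>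
                    SiNG.H1 γ c (k θ) (SiNG.pushα T μ θ') (SiNG.pushα T μ θ')) θ h₁ h₂)) ∧
      -- the explicit expression of the Hessian of `S(α_θ, α_{θ₁})` at `θ = θ₁`
      (∀ θ₁ ∈ Θ, ∀ f k : EuclideanSpace ℝ (Fin d) → C(X, ℝ),
        (∀ θ ∈ Θ, SiNG.IsSinkhornPotential γ c (f θ) (SiNG.pushα T μ θ) (SiNG.pushα T μ θ₁)) →
        (∀ θ ∈ Θ, SiNG.IsSinkhornPotential γ c (k θ) (SiNG.pushα T μ θ) (SiNG.pushα T μ θ)) →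
        DifferentiableAt ℝ f θ₁ → DifferentiableAt ℝ k θ₁ →
        SiNG.TwiceDifferentiableAt
          (fun θ => SiNG.sinkhornDiv γ c (SiNG.pushα T μ θ) (SiNG.pushα T μ θ₁)) θ₁ ∧
        ∀ h₁ h₂ : EuclideanSpace ℝ (Fin d),
          SiNG.D2 (fun θ => SiNG.sinkhornDiv γ c (SiNG.pushα T μ θ) (SiNG.pushα T μ θ₁)) θ₁ h₁ h₂
            = (-(SiNG.closedD11 γ c (SiNG.pushα T μ θ₁) (SiNG.pushα T μ θ₁) (f θ₁)
                    (fderiv ℝ f θ₁ h₁) (fderiv ℝ f θ₁ h₂))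
                + SiNG.closedD22 γ c T μ (SiNG.pushα T μ θ₁)
                    (SiNG.sinkhornB γ c (f θ₁) (SiNG.pushα T μ θ₁) (SiNG.pushα T μ θ₁))
                    θ₁ h₁ h₂)
              - (1 / 2) *
                (-(SiNG.closedD11 γ c (SiNG.pushα T μ θ₁) (SiNG.pushα T μ θ₁) (k θ₁)
                    (fderiv ℝ k θ₁ h₁) (fderiv ℝ k θ₁ h₂))
                + SiNG.closedD22Self γ c T μ
                    (SiNG.sinkhornB γ c (k θ₁) (SiNG.pushα T μ θ₁) (SiNG.pushα T μ θ₁))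
                    θ₁ h₁ h₂))) := by
  have hcc := hc.continuous hXU
  have hp : ∀ θ ∈ Θ, IsProbabilityMeasure (SiNG.pushα T μ θ) := fun θ hθ =>
    Measure.isProbabilityMeasure_map (hT.1 θ hθ).aemeasurable
  refine ⟨fun α β _ _ => ⟨SiNG.existsUnique_sinkhornPotential hγ hcc x₀,
    fun f hf => hf.OT_eq_H1 hγ hcc⟩, fun α β _ _ f => ?_, fun β _ => ⟨fun f F hF θ hθ => ?_,
    fun f hf => ?_⟩, fun hc2 => ⟨fun f F hF θ hθ => ?_, fun k hk => ?_,
    fun θ₁ hθ₁ f k hf hk hfd hkd => ?_⟩⟩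
  · obtain ⟨H, h1, h2⟩ := SiNG.exists_hasD2At_H1 (α := α) (β := β) hγ hcc f
    exact ⟨h1.twiceDifferentiableAt, fun g₁ g₂ => by rw [h1.D2_eq, h2]⟩
  · obtain ⟨H, h1, h2⟩ := SiNG.exists_hasD2At_H1_left (μ := μ) hγ hc hU hXU hΘ hT β hF hθ
    exact ⟨h1.twiceDifferentiableAt, fun g₁ g₂ => by rw [h1.D2_eq, h2]⟩
  · obtain ⟨h1, h2⟩ := SiNG.sinkhorn_regularity_left hγ hc hU hXU hΘ hT x₀ β hf
    refine ⟨h1, fun θ hθ => ?_⟩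
    have := hp θ hθ
    obtain ⟨h3, H, H₂, k1, k2, k3⟩ := h2 θ hθ
    obtain ⟨K, e1, e2⟩ := SiNG.exists_hasD2At_H1 (α := SiNG.pushα T μ θ) (β := β) hγ hcc (f θ)
    exact ⟨h3, k1.twiceDifferentiableAt, fun hd h₁ h₂ => by
      rw [k1.D2_eq, k2.D2_eq, e1.D2_eq, e2, k3 hd]⟩
  · obtain ⟨H, h1, h2⟩ := SiNG.exists_hasD2At_H1_self (μ := μ) hγ hc hU hXU hc2 hΘ hT hF hθ
    exact ⟨h1.twiceDifferentiableAt, fun g₁ g₂ => by rw [h1.D2_eq, h2]⟩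
  · obtain ⟨h1, h2⟩ := SiNG.sinkhorn_regularity_self hγ hc hU hXU hc2 hΘ hT x₀ hk
    refine ⟨h1, fun θ hθ => ?_⟩
    have := hp θ hθ
    obtain ⟨h3, H, H₂, k1, k2, k3⟩ := h2 θ hθ
    obtain ⟨K, e1, e2⟩ := SiNG.exists_hasD2At_H1 (α := SiNG.pushα T μ θ)
      (β := SiNG.pushα T μ θ) hγ hcc (k θ)
    exact ⟨h3, k1.twiceDifferentiableAt, fun hd h₁ h₂ => by
      rw [k1.D2_eq, k2.D2_eq, e1.D2_eq, e2, k3 hd]⟩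
  · have := hp θ₁ hθ₁
    obtain ⟨xf, H, H₂, k1, k2, k3⟩ :=
      (SiNG.sinkhorn_regularity_left hγ hc hU hXU hΘ hT x₀ (SiNG.pushα T μ θ₁) hf).2 θ₁ hθ₁
    obtain ⟨xk, K, K₂, l1, l2, l3⟩ :=
      (SiNG.sinkhorn_regularity_self hγ hc hU hXU hc2 hΘ hT x₀ hk).2 θ₁ hθ₁
    obtain ⟨H₃, a1, a2⟩ := SiNG.exists_hasD2At_H1_left (μ := μ) hγ hc hU hXU hΘ hT
      (SiNG.pushα T μ θ₁) xf hθ₁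
    obtain ⟨K₃, b1, b2⟩ := SiNG.exists_hasD2At_H1_self (μ := μ) hγ hc hU hXU hc2 hΘ hT xk hθ₁
    -- In the Sinkhorn divergence the second self-transport term does not depend on the moving
    -- parameter and drops out.
    have hS := (k1.sub (l1.const_smul (1 / 2))).sub_const
      (SiNG.OT γ c (SiNG.pushα T μ θ₁) (SiNG.pushα T μ θ₁) / 2)
    have hS' : SiNG.HasD2At (fun θ => SiNG.sinkhornDiv γ c (SiNG.pushα T μ θ)
        (SiNG.pushα T μ θ₁)) (H - (1 / 2 : ℝ) • K) θ₁ := by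
      refine hS.congr_of_eventuallyEq (Eventually.of_forall fun θ => ?_)
      simp only [SiNG.sinkhornDiv, smul_eq_mul]
      ring
    refine ⟨hS'.twiceDifferentiableAt, fun h₁ h₂ => ?_⟩
    rw [hS'.D2_eq, ← a2, ← b2, ← a1.D2_eq, ← b1.D2_eq, k2.D2_eq, l2.D2_eq]
    simp only [sub_apply, smul_apply, smul_eq_mul, k3 hfd, l3 hkd]
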